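/- **Setting.** Let $n>2$, $0<s<1$, $2^*=\frac{2n}{n-2}$. Let $\Omega\subset\mathbb R^n$ be a nonempty open set and let $\mathcal D,\mathcal N\subset\mathbb R^n\setminus\overline\Omega$ be open with $\mathcal D\cup\mathcal N=\mathbb R^n\setminus\overline\Omega$ and $\mathcal D\cap\mathcal N=\emptyset$, such that $\Omega\cup\mathcal N$ is bounded with smooth boundary (i.e. $\partial(\Omega\cup\mathcal N)$ is a smooth embedded hypersurface). Put $U=\Omega\cup\mathcal N\cup(\partial\Omega\cap\overline{\mathcal N})$ and $Q=\mathbb R^{2n}\setminus(\Omega^c\times\Omega^c)$. Let $\mathcal X$ be the space of all $u\in H^1(\mathbb R^n)$ with $u|_U\in H^1_0(U)$ and $u=0$ a.e. in $U^c$, and write $$B(u,\varphi)=\int_\Omega\nabla u\cdot\nabla\varphi\,dx+\int_Q\frac{(u(x)-u(y))(\varphi(x)-\varphi(y))}{|x-y|^{n+2s}}\,dx\,dy .$$ For $g:\mathbb R\to\mathbb R$ consider the problem $$-\Delta u+(-\Delta)^su=g(u),\ u>0\ \text{in }\Omega,\qquad u=0\ \text{in }U^c,\qquad \mathcal N_su=0\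 \text{in }\mathcal N,\qquad \frac{\partial u}{\partial\nu}=0\ \text{on }\partial\Omega\cap\overline{\mathcal N},\tag{$P_g$}$$ where $\mathcal N_su(x)=\int_\Omega\frac{u(x)-u(y)}{|x-y|^{n+2s}}\,dy$. A *(positive) weak solution* of $(P_g)$ is a function $u\in\mathcal X$ with $u>0$ a.e. in $\Omega$ such that, for every $\varphi\in C_c^\infty(U)$, $g(u)\varphi\in L^1(\Omega)$ and $B(u,\varphi)=\int_\Omega g(u)\varphi\,dx$. For $g(u)=u^{-q}$ with $q>1$, a *local weak solution* is a function $u\ge 0$ a.e. in $\mathbb R^n$ with $u>0$ a.e. in $\Omega$, with $u^{(q+1)/2}\in\mathcal X$, and with locally finite energy in $U$ (that is, $u$ is weakly differentiable in $\Omega$ and, for all compact $K\subset U$, $\nabla u\in L^2(K\cap\Omega)$ and $\int_{(K\times K)\cap Q}\frac{|u(x)-u(y)|^2}{|x-y|^{n+2s}}\,dx\,dy<\infty$), such that, for every $\varphi\in C_c^\infty(U)$, $u^{-q}\varphi\in L^1(\Omega)$ and $B(u,\varphi)=\int_\Omega u^{-q}\varphi\,dx$. **Theorem.** 1. Let $q>0$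 and $g(u)=u^{-q}$. Every weak solution of $(P_g)$ belongs to $L^\infty(U)$. 2. Let $q>1$ and $g(u)=u^{-q}$. Every local weak solution of $(P_g)$ belongs to $L^\infty(U)$. 3. Let $q>0$ and, for each integer $k\ge1$, let $u_k$ be a weak solution of $(P_{g_k})$ with $g_k(t)=(t+\frac1k)^{-q}$. If $u_k\to u$ a.e. in $\mathbb R^n$, then $u\in L^\infty(U)$. 4. Let $0<q<1<p\le 2^*-1$, $\lambda>0$ and $g(u)=\lambda u^{-q}+u^p$. Every weak solution of $(P_g)$ belongs to $L^\infty(U)$. -/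

import Mathlib

open MeasureTheory Filter Topology
open scoped ENNReal ContDiff

noncomputable section

namespace MixedNeumann

/-- Euclidean space of dimension `n`. -/
abbrev Euc (n : ℕ) : Type := EuclideanSpace ℝ (Fin n)

variable {n : ℕ}

/-- `S` is a smooth embedded hypersurface: near each of its points it is the zero set of a smooth
function without critical points. -/
def IsSmoothHypersurface (S : Set (Euc n)) : Prop :=
  ∀ x ∈ S, ∃ (V : Set (Euc n)) (ρ : Euc n → ℝ), IsOpen V ∧ x ∈ V ∧ ContDiffOn ℝ ∞ ρ V ∧
    (∀ y ∈ V, fderiv ℝ ρ y ≠ 0) ∧ S ∩ V = {y ∈ V | ρ y = 0}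

/-- The geometric setting: `Ω` is a nonempty open set, the Dirichlet set `D` and the Neumann set
`N` are open and partition the complement of the closure of `Ω`, and `Ω ∪ N` is bounded with smooth
boundary. -/
structure IsMixedDomain (Ω D N : Set (Euc n)) : Prop where
  isOpen_domain : IsOpen Ω
  nonempty_domain : Ω.Nonempty
  isOpen_dirichlet : IsOpen D
  isOpen_neumann : IsOpen N
  union_eq : D ∪ N = (closure Ω)ᶜ
  disjoint : Disjoint D N
  bounded : Bornology.IsBounded (Ω ∪ N)
  smooth : IsSmoothHypersurface (frontier (Ω ∪ N))

/-- The set `U = Ω ∪ N ∪ (∂Ω ∩ closure N)`. -/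
def fullSet (Ω N : Set (Euc n)) : Set (Euc n) :=
  Ω ∪ N ∪ (frontier Ω ∩ closure N)

/-- `φ ∈ C_c^∞(O)`, extended by zero. -/
def IsTest (O : Set (Euc n)) (φ : Euc n → ℝ) : Prop :=
  ContDiff ℝ ∞ φ ∧ HasCompactSupport φ ∧ tsupport φ ⊆ O

/-- `G` is the weak gradient of `u` on `O`. -/
def HasWeakGradient (O : Set (Euc n)) (u : Euc n → ℝ) (G : Euc n → Euc n) : Prop :=
  LocallyIntegrableOn u O ∧ LocallyIntegrableOn G O ∧
    ∀ φ, IsTest O φ → ∫ x in O, u x • gradient φ x = - ∫ x in O, φ x • G x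

/-- `u` belongs to the space `X` of functions in `H¹(ℝⁿ)` whose restriction to `U` lies in `H¹₀(U)`
and which vanish a.e. on the complement of `U`; `G` is the weak gradient of `u` on `ℝⁿ`. -/
def MemXWith (U : Set (Euc n)) (u : Euc n → ℝ) (G : Euc n → Euc n) : Prop :=
  MemLp u 2 volume ∧ MemLp G 2 volume ∧ HasWeakGradient Set.univ u G ∧
    (∃ ψ : ℕ → Euc n → ℝ, (∀ k, IsTest U (ψ k)) ∧
      Tendsto (fun k => eLpNorm (fun x => ψ k x - u x) 2 (volume.restrict U)) atTop (𝓝 0) ∧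
      Tendsto (fun k => eLpNorm (fun x => gradient (ψ k) x - G x) 2 (volume.restrict U))
        atTop (𝓝 0)) ∧
    ∀ᵐ x ∂(volume.restrict Uᶜ), u x = 0

/-- `u` belongs to the space `X`. -/
def MemX (U : Set (Euc n)) (u : Euc n → ℝ) : Prop :=
  ∃ G, MemXWith U u G

/-- `Q = ℝ²ⁿ \ (Ωᶜ × Ωᶜ)`. -/
def crossSet (Ω : Set (Euc n)) : Set (Euc n × Euc n) := (Ωᶜ ×ˢ Ωᶜ)ᶜ

/-- The bilinear form
`∫_Ω ∇u · ∇φ dx + ∫_Q (u x - u y) (φ x - φ y) / |x - y| ^ (n + 2 s) dx dy`, where `G` is the weak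
gradient of `u`. -/
def energyForm (s : ℝ) (Ω : Set (Euc n)) (u : Euc n → ℝ) (G : Euc n → Euc n)
    (φ : Euc n → ℝ) : ℝ :=
  (∫ x in Ω, inner ℝ (G x) (gradient φ x)) +
    ∫ z in crossSet Ω,
      (u z.1 - u z.2) * (φ z.1 - φ z.2) / ‖z.1 - z.2‖ ^ ((n : ℝ) + 2 * s)

/-- The weak formulation of `-Δu + (-Δ)^s u = g(u)` in `Ω` with the two homogeneous Neumann
conditions, on `N` and on `∂Ω ∩ closure N`, both encoded by testing with all of `C_c^∞(U)`. -/
def WeakEquation (s : ℝ) (Ω N : Set (Euc n)) (g : ℝ → ℝ) (u : Euc n → ℝ)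
    (G : Euc n → Euc n) : Prop :=
  ∀ φ, IsTest (fullSet Ω N) φ →
    IntegrableOn (fun x => g (u x) * φ x) Ω ∧
      energyForm s Ω u G φ = ∫ x in Ω, g (u x) * φ x

/-- `u ∈ X` is a positive weak solution of the mixed problem with right hand side `g(u)`. -/
def IsWeakSolution (s : ℝ) (Ω N : Set (Euc n)) (g : ℝ → ℝ) (u : Euc n → ℝ) : Prop :=
  ∃ G, MemXWith (fullSet Ω N) u G ∧ (∀ᵐ x ∂(volume.restrict Ω), 0 < u x) ∧
    WeakEquation s Ω N g u G

/-- `u` has finite energy locally in `U`, with weak gradient `G` on `Ω`. -/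
def MemXLocWith (s : ℝ) (Ω N : Set (Euc n)) (u : Euc n → ℝ) (G : Euc n → Euc n) : Prop :=
  HasWeakGradient Ω u G ∧
    ∀ K, IsCompact K → K ⊆ fullSet Ω N →
      MemLp G 2 (volume.restrict (K ∩ Ω)) ∧
      IntegrableOn (fun z : Euc n × Euc n =>
        (u z.1 - u z.2) ^ 2 / ‖z.1 - z.2‖ ^ ((n : ℝ) + 2 * s)) ((K ×ˢ K) ∩ crossSet Ω)

/-- The notion of positive weak solution for the strongly singular problem `g(u) = u^{-q}`, `q > 1`:
`u` has locally finite energy and `u ^ ((q + 1) / 2) ∈ X`. -/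
def IsLocalWeakSolution (s q : ℝ) (Ω N : Set (Euc n)) (u : Euc n → ℝ) : Prop :=
  (∀ᵐ x, 0 ≤ u x) ∧ (∀ᵐ x ∂(volume.restrict Ω), 0 < u x) ∧
    MemX (fullSet Ω N) (fun x => u x ^ ((q + 1) / 2)) ∧
    ∃ G, MemXLocWith s Ω N u G ∧ WeakEquation s Ω N (fun t => t ^ (-q)) u G

/-- `u ∈ L^∞(O)`. -/
def MemLinfty (O : Set (Euc n)) (u : Euc n → ℝ) : Prop :=
  MemLp u ∞ (volume.restrict O)

end MixedNeumann

end

/-!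
All four bounds come from De Giorgi's iteration on the super-level sets of the solution.

**Testing.** For a smooth `T` with `0 ≤ T' ≤ 1` that vanishes on `(-1, 1)`, the function `T(u)` is an
admissible test function, and testing with it gives
`∫_Ω |∇T(u)|² + ∫_Q |T(u(x)) - T(u(y))|² / |x - y|^(n+2s) ≤ ∫_Ω g(u) T(u)`
(`HasTruncationBound`). The weak equation is only assumed for `C_c^∞(U)`, and `g(u)` need not be
integrable, so this needs a limit in two steps (`weakIdentity_comp`): the test functions
`τ(ψᵢ) χ(ψⱼ)`, with `ψᵢ` converging to `v` in `H¹` and almost everywhere, are dominated by the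
integrable function `g(u) χ(ψⱼ)` while `i → ∞`, and then by `g(u) τ(v)` while `j → ∞`. For weak
solutions `v = u`. For local weak solutions `v = u ^ m` with `m = (q + 1) / 2 ≥ 1`: away from zero,
truncations of `u` are smooth functions of `v`, and the gradient and the difference quotients of `u`
are controlled there by those of `v` (`hasTruncationBound_of_memXLocWith`). That the weak gradients
of `u` on `Ω` and of `v` on `ℝⁿ` are related by the chain rule is `ae_deriv_smul_eq`.

**Sobolev inequality.** No regularity of `∂Ω` is assumed directly, but `∂Ω` is contained in the
smooth hypersurface `∂(Ω ∪ N)`. Hence near each point of `closure Ω` there are `n` independent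
directions along which points of `Ω` can be moved inside `Ω` by a fixed distance
(`exists_interior_directions`), and the proof of the Gagliardo-Nirenberg inequality by integration
along lines applies. Together with a Poincaré inequality, in which the nonlocal term sees the zero
values of `u` far away, the energy controls the norm of `L^{2*}(Ω)`
(`IsMixedDomain.exists_lintegral_critExp_le`). Letting `T` increase to `(t - k)⁺` yields
`‖(u - k)⁺‖²_{2*} ≤ C ∫_Ω g(u) (u - k)⁺` for `k ≥ 1`
(`IsMixedDomain.exists_lintegral_level_le`).

**Iteration.** When `g ≤ 1` on `[1, ∞)` this is the hypothesis of De Giorgi's lemma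
`ae_le_two_mul_of_level_inequality`, and the resulting bound depends on the domain only; this is why
it survives the limit in the third assertion. When `g` has critical growth, the superlinear part of
the right-hand side is absorbed at high levels, because `∫_{u > k} u^{2*} → 0`
(`IsMixedDomain.exists_bound_of_critical`). Finally, a truncation of `u` that vanishes on `Ω` has no
energy and therefore vanishes everywhere (`HasTruncationBound.ae_eq_zero`): bounds on `Ω` extend to
`U`.
-/


open MeasureTheory Filter Topology
open scoped ENNReal ContDiff

namespace MixedNeumann

variable {n : ℕ}

/-! ### Segments inside a domain with smooth boundary -/

/-- A nonzero linear functional on a finite-dimensional space is positive on some basis. -/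
lemma exists_linearIndependent_forall_pos (Λ : Euc n →L[ℝ] ℝ) (hΛ : Λ ≠ 0) :
    ∃ e : Fin n → Euc n, LinearIndependent ℝ e ∧ ∀ i, 0 < Λ (e i) := by
  obtain ⟨a, ha⟩ : ∃ a, 0 < Λ a := by
    obtain ⟨a, ha⟩ := DFunLike.ne_iff.1 hΛ
    rcases lt_or_gt_of_ne ha with h | h
    · exact ⟨-a, by simpa using h⟩
    · exact ⟨a, by simpa using h⟩
  have hspan : Submodule.span ℝ {x | 0 < Λ x} = ⊤ := by
    rw [eq_top_iff]
    intro x _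
    obtain ⟨c, hc⟩ : ∃ c : ℝ, 0 < Λ x + c * Λ a := by
      refine ⟨(1 - Λ x) / Λ a, ?_⟩
      rw [div_mul_cancel₀ _ ha.ne']
      simp
    have h1 : x + c • a ∈ Submodule.span ℝ {x | 0 < Λ x} :=
      Submodule.subset_span (by simpa using hc)
    have h2 : a ∈ Submodule.span ℝ {x | 0 < Λ x} := Submodule.subset_span ha
    simpa using Submodule.sub_mem _ h1 (Submodule.smul_mem _ c h2)
  obtain ⟨f, hf, -, hli⟩ := Submodule.exists_fun_fin_finrank_span_eq ℝ {x : Euc n | 0 < Λ x}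
  have hd : n = Module.finrank ℝ (Submodule.span ℝ {x : Euc n | 0 < Λ x}) := by
    rw [hspan, finrank_top]; simp
  exact ⟨f ∘ Fin.cast hd, hli.comp _ (Fin.cast_injective hd), fun i => hf _⟩

/-- A segment that starts in an open set and avoids its frontier stays in the set. -/
lemma segment_mem_of_forall_notMem_frontier {Ω : Set (Euc n)} {x e : Euc n} {δ : ℝ}
    (hΩ : IsOpen Ω) (hx : x ∈ Ω) (h : ∀ t ∈ Set.Icc 0 δ, x + t • e ∉ frontier Ω) :
    ∀ t ∈ Set.Icc 0 δ, x + t • e ∈ Ω := by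
  intro t ht
  by_contra hcon
  have hpre : IsPreconnected ((fun t : ℝ => x + t • e) '' Set.Icc 0 δ) :=
    isPreconnected_Icc.image _ (by fun_prop)
  obtain ⟨y, -, hy1, hy2⟩ := hpre Ω (closure Ω)ᶜ hΩ isClosed_closure.isOpen_compl
    (by
      rintro _ ⟨t', ht', rfl⟩
      by_cases hmem : x + t' • e ∈ Ω
      · exact Or.inl hmem
      · refine Or.inr fun hcl => h t' ht' ?_
        rw [hΩ.frontier_eq]
        exact ⟨hcl, hmem⟩)
    ⟨x, ⟨0, ⟨le_rfl, ht.1.trans ht.2⟩, by simp⟩, hx⟩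
    ⟨_, ⟨t, ht, rfl⟩, fun hcl => h t ht (by rw [hΩ.frontier_eq]; exact ⟨hcl, hcon⟩)⟩
  exact hy2 (subset_closure hy1)

/-- If the frontier of `Ω` lies in a smooth hypersurface, then near each point of `closure Ω` there
are `n` independent directions such that each point of `Ω` can be moved inside `Ω` by a fixed
distance along all of these directions, or along all of the opposite ones. -/
lemma exists_interior_directions {Ω S : Set (Euc n)} (hΩ : IsOpen Ω)
    (hS : IsSmoothHypersurface S) (hfr : frontier Ω ⊆ S) {x₀ : Euc n} (hx₀ : x₀ ∈ closure Ω) :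
    ∃ (e : Fin n → Euc n) (r δ : ℝ), LinearIndependent ℝ e ∧ 0 < r ∧ 0 < δ ∧
      ∀ x ∈ Ω ∩ Metric.ball x₀ r,
        (∀ i, ∀ t ∈ Set.Icc 0 δ, x + t • e i ∈ Ω) ∨
        (∀ i, ∀ t ∈ Set.Icc 0 δ, x + t • (-e i) ∈ Ω) := by
  have hbound : ∀ e : Fin n → Euc n, ∀ R > 0, ∃ δ : ℝ, 0 < δ ∧ ∀ i, ∀ t ∈ Set.Icc 0 δ,
      ‖t • e i‖ < R := by
    intro e R hR
    have hnn : 0 ≤ ∑ i, ‖e i‖ := Finset.sum_nonneg fun _ _ => norm_nonneg _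
    refine ⟨R / (∑ i, ‖e i‖ + 1), by positivity, fun i t ht => ?_⟩
    rw [norm_smul, Real.norm_of_nonneg ht.1]
    have h1 : ‖e i‖ ≤ ∑ i, ‖e i‖ :=
      Finset.single_le_sum (fun _ _ => norm_nonneg _) (Finset.mem_univ i)
    calc t * ‖e i‖ ≤ R / (∑ i, ‖e i‖ + 1) * ∑ i, ‖e i‖ := by
          gcongr
          exact ht.2
      _ < R := by
          rw [div_mul_eq_mul_div, div_lt_iff₀ (by positivity)]
          nlinarith
  by_cases hxΩ : x₀ ∈ Ω
  · obtain ⟨R, hR, hball⟩ := Metric.isOpen_iff.1 hΩ x₀ hxΩ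
    let e : Fin n → Euc n := (EuclideanSpace.basisFun (Fin n) ℝ).toBasis
    obtain ⟨δ, hδ, hδR⟩ := hbound e (R / 2) (by positivity)
    refine ⟨e, R / 2, δ, (EuclideanSpace.basisFun (Fin n) ℝ).toBasis.linearIndependent,
      by positivity, hδ, fun x hx => Or.inl fun i t ht => hball ?_⟩
    have h1 := Metric.mem_ball.1 hx.2
    rw [Metric.mem_ball, dist_eq_norm] at *
    calc ‖x + t • e i - x₀‖ = ‖(x - x₀) + t • e i‖ := by congr 1; abel
      _ ≤ ‖x - x₀‖ + ‖t • e i‖ := norm_add_le _ _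
      _ < R := by linarith [hδR i t ht]
  · have hx₀S : x₀ ∈ S := hfr (by rw [hΩ.frontier_eq]; exact ⟨hx₀, hxΩ⟩)
    obtain ⟨V, ρ, hV, hxV, hρ, hρ0, hSV⟩ := hS x₀ hx₀S
    obtain ⟨e, hli, hpos⟩ := exists_linearIndependent_forall_pos (fderiv ℝ ρ x₀) (hρ0 x₀ hxV)
    have hcont : ContinuousOn (fderiv ℝ ρ) V :=
      hρ.continuousOn_fderiv_of_isOpen hV (by simp)
    have hcont' : ContinuousAt (fderiv ℝ ρ) x₀ := hcont.continuousAt (hV.mem_nhds hxV)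
    have hev : ∀ᶠ y in 𝓝 x₀, y ∈ V ∧ ∀ i, 0 < fderiv ℝ ρ y (e i) := by
      refine Filter.Eventually.and (hV.mem_nhds hxV) (eventually_all.2 fun i => ?_)
      have : ContinuousAt (fun y => fderiv ℝ ρ y (e i)) x₀ := hcont'.clm_apply continuousAt_const
      exact this.eventually_const_lt (hpos i)
    obtain ⟨R, hR, hball⟩ := Metric.eventually_nhds_iff_ball.1 hev
    obtain ⟨δ, hδ, hδR⟩ := hbound e (R / 2) (by positivity)
    have hmem : ∀ x ∈ Metric.ball x₀ (R / 2), ∀ i, ∀ t ∈ Set.Icc (-δ) δ,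
        x + t • e i ∈ Metric.ball x₀ R := by
      intro x hx i t ht
      have h1 := Metric.mem_ball.1 hx
      rw [Metric.mem_ball, dist_eq_norm] at *
      have h2 : ‖t • e i‖ < R / 2 := by
        have := hδR i |t| ⟨abs_nonneg t, abs_le.2 ht⟩
        rwa [norm_smul, Real.norm_eq_abs, abs_abs, ← Real.norm_eq_abs, ← norm_smul] at this
      calc ‖x + t • e i - x₀‖ = ‖(x - x₀) + t • e i‖ := by congr 1; abel
        _ ≤ ‖x - x₀‖ + ‖t • e i‖ := norm_add_le _ _
        _ < R := by linarith
    -- `ρ` increases along each `e i`, so moving away from `{ρ = 0}` never meets the frontier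
    have hmono : ∀ x ∈ Metric.ball x₀ (R / 2), ∀ i,
        StrictMonoOn (fun t : ℝ => ρ (x + t • e i)) (Set.Icc (-δ) δ) := by
      intro x hx i
      have hd : ∀ t ∈ Set.Icc (-δ) δ, HasDerivAt (fun t : ℝ => ρ (x + t • e i))
          (fderiv ℝ ρ (x + t • e i) (e i)) t := by
        intro t ht
        have hy := (hball _ (hmem x hx i t ht)).1
        have h1 : HasFDerivAt ρ (fderiv ℝ ρ (x + t • e i)) (x + t • e i) :=
          ((hρ.differentiableOn (by simp)).differentiableAt (hV.mem_nhds hy)).hasFDerivAt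
        have h2 : HasDerivAt (fun t : ℝ => x + t • e i) (e i) t := by
          simpa using ((hasDerivAt_id t).smul_const (e i)).const_add x
        exact h1.comp_hasDerivAt t h2
      refine strictMonoOn_of_deriv_pos (convex_Icc _ _)
        (fun t ht => (hd t ht).continuousAt.continuousWithinAt) fun t ht => ?_
      rw [interior_Icc] at ht
      have ht' := Set.Ioo_subset_Icc_self ht
      rw [(hd t ht').deriv]
      exact (hball _ (hmem x hx i t ht')).2 i
    have hnot : ∀ x ∈ Metric.ball x₀ (R / 2), ∀ i, ∀ t ∈ Set.Icc (-δ) δ,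
        ρ (x + t • e i) ≠ 0 → x + t • e i ∉ frontier Ω := by
      intro x hx i t ht hne hcon
      have : x + t • e i ∈ S ∩ V := ⟨hfr hcon, (hball _ (hmem x hx i t ht)).1⟩
      rw [hSV] at this
      exact hne this.2
    refine ⟨e, R / 2, δ, hli, by positivity, hδ, fun x hx => ?_⟩
    have hxfr : x ∉ frontier Ω := fun h => by
      rw [hΩ.frontier_eq] at h; exact h.2 hx.1
    have h0 : (0 : ℝ) ∈ Set.Icc (-δ) δ := ⟨by linarith, hδ.le⟩
    rcases le_total 0 (ρ x) with hρx | hρx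
    · refine Or.inl fun i => segment_mem_of_forall_notMem_frontier hΩ hx.1 fun t ht => ?_
      rcases ht.1.eq_or_lt with rfl | htpos
      · simpa using hxfr
      have ht' : t ∈ Set.Icc (-δ) δ := ⟨by linarith [ht.1], ht.2⟩
      have := hmono x hx.2 i h0 ht' htpos
      simp only [zero_smul, add_zero] at this
      exact hnot x hx.2 i t ht' (by linarith : 0 < ρ (x + t • e i)).ne'
    · refine Or.inr fun i => segment_mem_of_forall_notMem_frontier hΩ hx.1 fun t ht => ?_
      rcases ht.1.eq_or_lt with rfl | htpos
      · simpa using hxfr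
      have ht' : -t ∈ Set.Icc (-δ) δ := ⟨by linarith [ht.2], by linarith [ht.1]⟩
      have := hmono x hx.2 i ht' h0 (by linarith)
      simp only [zero_smul, add_zero] at this
      rw [smul_neg, ← neg_smul]
      exact hnot x hx.2 i (-t) ht' (by linarith : ρ (x + (-t) • e i) < 0).ne

/-! ### The Sobolev inequality in `W^{1,1}` -/

/-- A `C¹` function at the start of a segment is controlled by the integral of its derivative and
of its own size along the segment: the integrand is `(1 - t / δ) ψ (x + t e)`. -/
lemma enorm_le_lintegral_segment {ψ : Euc n → ℝ} (hψ : ContDiff ℝ 1 ψ) (x e : Euc n) {δ : ℝ}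
    (hδ : 0 < δ) :
    ‖ψ x‖ₑ ≤ ∫⁻ t in Set.Icc 0 δ,
      ENNReal.ofReal (‖e‖ + δ⁻¹) * (‖ψ (x + t • e)‖ₑ + ‖fderiv ℝ ψ (x + t • e)‖ₑ) := by
  have hd : ∀ t : ℝ, HasDerivAt (fun t : ℝ => (1 - t / δ) * ψ (x + t • e))
      ((-(1 / δ)) * ψ (x + t • e) + (1 - t / δ) * fderiv ℝ ψ (x + t • e) e) t := by
    intro t
    have h1 : HasDerivAt (fun t : ℝ => ψ (x + t • e)) (fderiv ℝ ψ (x + t • e) e) t := by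
      have h2 : HasDerivAt (fun t : ℝ => x + t • e) (e) t := by
        simpa using ((hasDerivAt_id t).smul_const e).const_add x
      exact ((hψ.differentiable (by simp)) _).hasFDerivAt.comp_hasDerivAt t h2
    have h3 : HasDerivAt (fun t : ℝ => 1 - t / δ) (-(1 / δ)) t := by
      simpa using ((hasDerivAt_id t).div_const δ).const_sub 1
    exact h3.mul h1
  have hC : ContDiffOn ℝ 1 (fun t : ℝ => (1 - t / δ) * ψ (x + t • e)) (Set.Icc 0 δ) := by
    apply ContDiff.contDiffOn
    fun_prop
  have h := enorm_sub_le_lintegral_deriv_of_contDiffOn_Icc hC hδ.le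
  simp only [div_self hδ.ne', sub_self, zero_mul, zero_div, sub_zero, one_mul, zero_smul, add_zero,
    zero_sub, enorm_neg] at h
  refine h.trans (setLIntegral_mono' measurableSet_Icc fun t ht => ?_)
  rw [(hd t).deriv, ← ofReal_norm, ← ofReal_norm, ← ofReal_norm,
    ← ENNReal.ofReal_add (norm_nonneg _) (norm_nonneg _), ← ENNReal.ofReal_mul (by positivity)]
  apply ENNReal.ofReal_le_ofReal
  have ht1 : ‖1 - t / δ‖ ≤ 1 := by
    have h1 : 0 ≤ t / δ := div_nonneg ht.1 hδ.le
    have h2 : t / δ ≤ 1 := (div_le_one hδ).2 ht.2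
    rw [Real.norm_eq_abs, abs_le]; constructor <;> linarith
  calc _ ≤ ‖-(1 / δ) * ψ (x + t • e)‖ + ‖(1 - t / δ) * fderiv ℝ ψ (x + t • e) e‖ := norm_add_le _ _
    _ ≤ δ⁻¹ * ‖ψ (x + t • e)‖ + 1 * (‖fderiv ℝ ψ (x + t • e)‖ * ‖e‖) := by
        rw [norm_mul, norm_mul]
        gcongr
        · simp [abs_of_pos hδ]
        · exact ContinuousLinearMap.le_opNorm _ _
    _ ≤ _ := by
        have h1 : 0 ≤ δ⁻¹ := by positivity
        nlinarith [norm_nonneg e, norm_nonneg (ψ (x + t • e)),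
          norm_nonneg (fderiv ℝ ψ (x + t • e)),
          mul_nonneg (norm_nonneg e) (norm_nonneg (ψ (x + t • e))),
          mul_nonneg h1 (norm_nonneg (fderiv ℝ ψ (x + t • e)))]

/-- The `L¹`-Sobolev inequality near a point of `closure Ω`, with the full integral over `Ω` on the
right-hand side. -/
lemma exists_local_sobolev_one (hn : 2 ≤ n) {Ω S : Set (Euc n)} (hΩ : IsOpen Ω)
    (hS : IsSmoothHypersurface S) (hfr : frontier Ω ⊆ S) {x₀ : Euc n} (hx₀ : x₀ ∈ closure Ω) :
    ∃ r > 0, ∃ C : ℝ≥0∞, C ≠ ⊤ ∧ ∀ ψ : Euc n → ℝ, ContDiff ℝ 1 ψ →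
      ∫⁻ x in Ω ∩ Metric.ball x₀ r, ‖ψ x‖ₑ ^ ((n : ℝ) / (n - 1)) ≤
        C * (∫⁻ x in Ω, (‖ψ x‖ₑ + ‖fderiv ℝ ψ x‖ₑ)) ^ ((n : ℝ) / (n - 1)) := by
  obtain ⟨e, r, δ, hli, hr, hδ, hdir⟩ := exists_interior_directions hΩ hS hfr hx₀
  have : Nonempty (Fin n) := ⟨⟨0, by omega⟩⟩
  have hn1 : (0 : ℝ) < n - 1 := by
    have : (2 : ℝ) ≤ n := by exact_mod_cast hn
    linarith
  let b : Module.Basis (Fin n) ℝ (Euc n) := basisOfLinearIndependentOfCardEqFinrank hli (by simp)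
  let L : (Fin n → ℝ) ≃L[ℝ] Euc n := b.equivFunL.symm
  have hbe : ∀ i, b i = e i := fun i => by simp [b]
  have hL : ∀ c i t, L (Function.update c i t) = L c + (t - c i) • e i := by
    intro c i t
    have : Function.update c i t = c + (t - c i) • Pi.single i (1 : ℝ) := by
      ext j
      by_cases hj : j = i
      · subst hj; simp
      · simp [hj]
    rw [this, map_add, map_smul]
    congr 2
    rw [← hbe]
    change b.equivFun.symm _ = _
    simp
  -- the image of Lebesgue measure under `L` is a multiple of Lebesgue measure
  have hmeas := L.isAddHaarMeasure_map (volume : Measure (Fin n → ℝ))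
  let c := Measure.addHaarScalarFactor (Measure.map L (volume : Measure (Fin n → ℝ)))
    (volume : Measure (Euc n))
  have hc : Measure.map L (volume : Measure (Fin n → ℝ)) = c • (volume : Measure (Euc n)) :=
    Measure.isAddLeftInvariant_eq_smul _ _
  have hc0 : (c : ℝ≥0∞) ≠ 0 := by
    intro h0
    have h0' : c = 0 := by exact_mod_cast h0
    rw [h0', zero_smul] at hc
    exact hmeas.toIsOpenPosMeasure.open_pos Set.univ isOpen_univ Set.univ_nonempty (by simp [hc])
  have hcv : ∀ g : Euc n → ℝ≥0∞, Measurable g → ∫⁻ y, g (L y) = c * ∫⁻ x, g x := by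
    intro g hg
    rw [← lintegral_map hg L.continuous.measurable, hc, lintegral_smul_measure]
    rfl
  let M : ℝ≥0∞ := ENNReal.ofReal (∑ i, (‖e i‖ + δ⁻¹))
  set p : ℝ := (n : ℝ) / (n - 1) with hp
  have hp0 : 0 ≤ p := by positivity
  refine ⟨r, hr, (c : ℝ≥0∞)⁻¹ * (M * c) ^ p, ?_, fun ψ hψ => ?_⟩
  · exact ENNReal.mul_ne_top (ENNReal.inv_ne_top.2 hc0)
      (ENNReal.rpow_ne_top_of_nonneg hp0 (ENNReal.mul_ne_top ENNReal.ofReal_ne_top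
        ENNReal.coe_ne_top))
  let f : Euc n → ℝ≥0∞ := Ω.indicator fun y => M * (‖ψ y‖ₑ + ‖fderiv ℝ ψ y‖ₑ)
  have hψc : Continuous ψ := hψ.continuous
  have hψd : Continuous (fderiv ℝ ψ) := hψ.continuous_fderiv (by simp)
  have hf : Measurable f := by
    refine Measurable.indicator ?_ hΩ.measurableSet
    fun_prop
  have hline : ∀ x ∈ Ω ∩ Metric.ball x₀ r, ∀ i, ‖ψ x‖ₑ ≤ ∫⁻ t : ℝ, f (x + t • e i) := by
    have key : ∀ x v i, ‖v‖ = ‖e i‖ → (∀ t ∈ Set.Icc 0 δ, x + t • v ∈ Ω) →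
        ‖ψ x‖ₑ ≤ ∫⁻ t : ℝ, f (x + t • v) := by
      intro x v i hv hmem
      refine (enorm_le_lintegral_segment hψ x v hδ).trans ?_
      refine (setLIntegral_mono' measurableSet_Icc fun t ht => ?_).trans
        (setLIntegral_le_lintegral _ _)
      simp only [f, Set.indicator_of_mem (hmem t ht)]
      gcongr
      rw [hv]
      refine ENNReal.ofReal_le_ofReal ?_
      exact Finset.single_le_sum (f := fun i => ‖e i‖ + δ⁻¹) (fun _ _ => by positivity)
        (Finset.mem_univ i)
    intro x hx i
    rcases hdir x hx with h | h
    · exact key x (e i) i rfl (h i)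
    · refine (key x (-e i) i (norm_neg _) (h i)).trans_eq ?_
      rw [← lintegral_neg_eq_self]
      simp
  -- the grid-lines lemma, in the coordinates given by the directions `e i`
  have hgrid := lintegral_prod_lintegral_pow_le (fun _ : Fin n => (volume : Measure ℝ)) (p := p)
    (by
      rw [Real.holderConjugate_iff]
      have : (0 : ℝ) < n := by linarith
      simp only [Fintype.card_fin, hp]
      constructor
      · linarith
      · field_simp; ring) (f := fun y => f (L y)) (hf.comp L.continuous.measurable)
  rw [← volume_pi] at hgrid
  rw [hcv f hf] at hgrid
  have hAm : MeasurableSet (Ω ∩ Metric.ball x₀ r) := hΩ.measurableSet.inter measurableSet_ball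
  have hpt : ∀ y : Fin n → ℝ, (Ω ∩ Metric.ball x₀ r).indicator (fun x => ‖ψ x‖ₑ ^ p) (L y) ≤
      ∏ i, (∫⁻ t, f (L (Function.update y i t))) ^
        ((1 : ℝ) / ((Fintype.card (Fin n) : ℝ) - 1)) := by
    intro y
    by_cases hy : L y ∈ Ω ∩ Metric.ball x₀ r
    · rw [Set.indicator_of_mem hy]
      calc ‖ψ (L y)‖ₑ ^ p =
          ∏ i : Fin n, ‖ψ (L y)‖ₑ ^ ((1 : ℝ) / ((Fintype.card (Fin n) : ℝ) - 1)) := by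
            rw [Finset.prod_const, ← ENNReal.rpow_natCast, ← ENNReal.rpow_mul]
            congr 1
            simp [hp]; field_simp
        _ ≤ _ := by
            refine Finset.prod_le_prod' fun i _ => ?_
            refine ENNReal.rpow_le_rpow ?_ (by simp; linarith)
            refine (hline _ hy i).trans_eq ?_
            simp_rw [hL]
            exact (lintegral_sub_right_eq_self (fun t => f (L y + t • e i)) (y i)).symm
    · rw [Set.indicator_of_notMem hy]; exact bot_le
  have h1 := (lintegral_mono hpt).trans hgrid
  rw [hcv _ (Measurable.indicator (by fun_prop) hAm), lintegral_indicator hAm,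
    lintegral_indicator hΩ.measurableSet, lintegral_const_mul _ (by fun_prop)] at h1
  have hct : (c : ℝ≥0∞) ≠ ⊤ := ENNReal.coe_ne_top
  calc _ = (c : ℝ≥0∞)⁻¹ * (c * ∫⁻ x in Ω ∩ Metric.ball x₀ r, ‖ψ x‖ₑ ^ p) := by
        rw [← mul_assoc, ENNReal.inv_mul_cancel hc0 hct, one_mul]
    _ ≤ (c : ℝ≥0∞)⁻¹ * (c * (M * ∫⁻ x in Ω, (‖ψ x‖ₑ + ‖fderiv ℝ ψ x‖ₑ))) ^ p := by gcongr
    _ = _ := by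
        rw [mul_assoc, ← ENNReal.mul_rpow_of_nonneg _ _ hp0]
        congr 2
        ring

/-- The `L¹`-Sobolev inequality up to the boundary of a bounded open set whose frontier lies in a
smooth hypersurface. -/
lemma exists_sobolev_one (hn : 2 ≤ n) {Ω S : Set (Euc n)} (hΩ : IsOpen Ω)
    (hb : Bornology.IsBounded Ω) (hS : IsSmoothHypersurface S) (hfr : frontier Ω ⊆ S) :
    ∃ C : ℝ≥0∞, C ≠ ⊤ ∧ ∀ ψ : Euc n → ℝ, ContDiff ℝ 1 ψ →
      ∫⁻ x in Ω, ‖ψ x‖ₑ ^ ((n : ℝ) / (n - 1)) ≤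
        C * (∫⁻ x in Ω, (‖ψ x‖ₑ + ‖fderiv ℝ ψ x‖ₑ)) ^ ((n : ℝ) / (n - 1)) := by
  have hcomp : IsCompact (closure Ω) := Metric.isCompact_of_isClosed_isBounded isClosed_closure
    hb.closure
  have key := hcomp.induction_on (p := fun s => ∃ C : ℝ≥0∞, C ≠ ⊤ ∧ ∀ ψ : Euc n → ℝ,
      ContDiff ℝ 1 ψ → ∫⁻ x in Ω ∩ s, ‖ψ x‖ₑ ^ ((n : ℝ) / (n - 1)) ≤
        C * (∫⁻ x in Ω, (‖ψ x‖ₑ + ‖fderiv ℝ ψ x‖ₑ)) ^ ((n : ℝ) / (n - 1)))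
    ⟨0, by simp, by simp⟩
    (by
      rintro s t hst ⟨C, hC, h⟩
      exact ⟨C, hC, fun ψ hψ => (lintegral_mono_set (Set.inter_subset_inter_right _ hst)).trans
        (h ψ hψ)⟩)
    (by
      rintro s t ⟨C, hC, h⟩ ⟨C', hC', h'⟩
      refine ⟨C + C', ENNReal.add_ne_top.2 ⟨hC, hC'⟩, fun ψ hψ => ?_⟩
      rw [Set.inter_union_distrib_left, add_mul]
      exact (lintegral_union_le _ _ _).trans (add_le_add (h ψ hψ) (h' ψ hψ)))
    (by
      intro x hx
      obtain ⟨r, hr, h⟩ := exists_local_sobolev_one hn hΩ hS hfr hx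
      exact ⟨_, mem_nhdsWithin_of_mem_nhds (Metric.ball_mem_nhds x hr), h⟩)
  rwa [Set.inter_eq_left.2 subset_closure] at key

/-! ### The critical Sobolev inequality -/

/-- The critical Sobolev exponent `2* = 2n / (n - 2)`. -/
noncomputable def critExp (n : ℕ) : ℝ := 2 * (n : ℝ) / ((n : ℝ) - 2)

lemma two_lt_critExp (hn : 2 < n) : 2 < critExp n := by
  have h : (2 : ℝ) < n := by exact_mod_cast hn
  rw [critExp, lt_div_iff₀ (by linarith)]
  linarith

/-- The Cauchy-Schwarz inequality for lower Lebesgue integrals. -/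
lemma lintegral_mul_le_sqrt_mul_sqrt {α : Type*} [MeasurableSpace α] (μ : Measure α)
    {f g : α → ℝ≥0∞} (hf : AEMeasurable f μ) (hg : AEMeasurable g μ) :
    ∫⁻ x, f x * g x ∂μ ≤
      (∫⁻ x, f x ^ 2 ∂μ) ^ (1 / 2 : ℝ) * (∫⁻ x, g x ^ 2 ∂μ) ^ (1 / 2 : ℝ) := by
  have h := ENNReal.lintegral_mul_le_Lp_mul_Lq μ (p := 2) (q := 2)
    ⟨by norm_num, by norm_num, by norm_num⟩ hf hg
  simpa only [Pi.mul_apply, ENNReal.rpow_ofNat] using h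

/-- The Sobolev inequality `H¹(Ω) ⊂ L^{2*}(Ω)`, deduced from the `L¹` inequality applied to
`|ψ| ^ γ` with `γ = 2 (n - 1) / (n - 2)`. -/
lemma exists_sobolev (hn : 2 < n) {Ω S : Set (Euc n)} (hΩ : IsOpen Ω)
    (hb : Bornology.IsBounded Ω) (hS : IsSmoothHypersurface S) (hfr : frontier Ω ⊆ S) :
    ∃ C : ℝ≥0∞, C ≠ ⊤ ∧ ∀ ψ : Euc n → ℝ, ContDiff ℝ 1 ψ →
      (∫⁻ x in Ω, ‖ψ x‖ₑ ^ critExp n) ^ (2 / critExp n) ≤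
        C * ((∫⁻ x in Ω, ‖ψ x‖ₑ ^ 2) + ∫⁻ x in Ω, ‖fderiv ℝ ψ x‖ₑ ^ 2) := by
  obtain ⟨C₁, hC₁, hsob⟩ := exists_sobolev_one hn.le hΩ hb hS hfr
  have hn' : (2 : ℝ) < n := by exact_mod_cast hn
  have hn2 : (0 : ℝ) < n - 2 := by linarith
  have hn1 : (0 : ℝ) < n - 1 := by linarith
  have hn0 : (0 : ℝ) < n := by linarith
  obtain ⟨γ, hγ⟩ : ∃ γ : ℝ, γ = 2 * ((n : ℝ) - 1) / (n - 2) := ⟨_, rfl⟩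
  obtain ⟨p, hp⟩ : ∃ p : ℝ, p = (n : ℝ) / (n - 1) := ⟨_, rfl⟩
  have hγ1 : 1 < γ := by rw [hγ, lt_div_iff₀ hn2]; linarith
  have hp0 : 0 < p := by rw [hp]; positivity
  have hp2 : p < 2 := by rw [hp, div_lt_iff₀ hn1]; linarith
  have hγp : γ * p = critExp n := by rw [hγ, hp, critExp]; field_simp
  have hγr : (γ - 1) * 2 = critExp n := by rw [hγ, critExp]; field_simp; ring
  have hpr : 2 / p - 1 = 2 / critExp n := by rw [hp, critExp]; field_simp; ring
  have hr := two_lt_critExp hn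
  obtain ⟨r, hrdef⟩ : ∃ r, r = critExp n := ⟨_, rfl⟩
  rw [← hrdef] at hγp hγr hpr hr ⊢
  rw [← hp] at hsob
  set Γ : ℝ≥0∞ := ENNReal.ofReal γ with hΓ
  refine ⟨(C₁ * Γ ^ p) ^ (2 / p) * 2, ?_, fun ψ hψ => ?_⟩
  · refine ENNReal.mul_ne_top (ENNReal.rpow_ne_top_of_nonneg (by positivity)
      (ENNReal.mul_ne_top hC₁ (ENNReal.rpow_ne_top_of_nonneg hp0.le ENNReal.ofReal_ne_top)))
      (by simp)
  have hψc : Continuous ψ := hψ.continuous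
  have hψd : Continuous (fderiv ℝ ψ) := hψ.continuous_fderiv (by simp)
  set I := ∫⁻ x in Ω, ‖ψ x‖ₑ ^ r with hI
  set J := ∫⁻ x in Ω, (‖ψ x‖ₑ + ‖fderiv ℝ ψ x‖ₑ) ^ 2 with hJ
  have hIfin : I ≠ ⊤ := by
    obtain ⟨B, hB⟩ := (Metric.isCompact_of_isClosed_isBounded isClosed_closure
      hb.closure).exists_bound_of_continuousOn hψc.continuousOn
    refine ((setLIntegral_mono' hΩ.measurableSet fun x hx =>
      ENNReal.rpow_le_rpow (z := r) (show ‖ψ x‖ₑ ≤ ENNReal.ofReal B by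
        rw [← ofReal_norm]
        exact ENNReal.ofReal_le_ofReal (hB x (subset_closure hx))) (by linarith)).trans_lt ?_).ne
    rw [setLIntegral_const]
    exact ENNReal.mul_lt_top (ENNReal.rpow_lt_top_of_nonneg (by linarith) ENNReal.ofReal_ne_top)
      hb.measure_lt_top
  have hJle : J ≤ 2 * ((∫⁻ x in Ω, ‖ψ x‖ₑ ^ 2) + ∫⁻ x in Ω, ‖fderiv ℝ ψ x‖ₑ ^ 2) := by
    rw [← lintegral_add_left (by fun_prop), ← lintegral_const_mul _ (by fun_prop)]
    refine lintegral_mono fun x => ?_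
    have := ENNReal.rpow_add_le_mul_rpow_add_rpow ‖ψ x‖ₑ ‖fderiv ℝ ψ x‖ₑ (p := 2) (by norm_num)
    norm_num at this
    exact this
  -- `I` reappears on the right with exponent `p / 2 < 1`; being finite, it can be absorbed
  have key : I ≤ C₁ * Γ ^ p * (I ^ (p / 2) * J ^ (p / 2)) := by
    have h1 := hsob (fun x => ‖ψ x‖ ^ γ) (hψ.norm_rpow hγ1)
    have h2 : ∀ x, ‖‖ψ x‖ ^ γ‖ₑ = ‖ψ x‖ₑ ^ γ := fun x => by
      rw [Real.enorm_rpow_of_nonneg (norm_nonneg _) (by linarith), enorm_norm]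
    simp_rw [h2, ← ENNReal.rpow_mul, hγp] at h1
    have h3 : ∀ x, ‖ψ x‖ₑ ^ γ + ‖fderiv ℝ (fun x => ‖ψ x‖ ^ γ) x‖ₑ ≤
        Γ * (‖ψ x‖ₑ ^ (γ - 1) * (‖ψ x‖ₑ + ‖fderiv ℝ ψ x‖ₑ)) := by
      intro x
      have h4 : ‖fderiv ℝ (fun x => ‖ψ x‖ ^ γ) x‖ₑ ≤ Γ * ‖ψ x‖ₑ ^ (γ - 1) * ‖fderiv ℝ ψ x‖ₑ := by
        rw [← ofReal_norm, ← ofReal_norm, ← ofReal_norm,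
          ENNReal.ofReal_rpow_of_nonneg (norm_nonneg _) (by linarith),
          ← ENNReal.ofReal_mul (by linarith), ← ENNReal.ofReal_mul (by positivity)]
        exact ENNReal.ofReal_le_ofReal (norm_fderiv_norm_rpow_le (hψ.differentiable (by simp)) hγ1)
      have h5 : ‖ψ x‖ₑ ^ γ ≤ Γ * (‖ψ x‖ₑ ^ (γ - 1) * ‖ψ x‖ₑ) := by
        have h6 : ‖ψ x‖ₑ ^ γ = ‖ψ x‖ₑ ^ (γ - 1) * ‖ψ x‖ₑ := by
          nth_rewrite 3 [← ENNReal.rpow_one ‖ψ x‖ₑ]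
          rw [← ENNReal.rpow_add_of_nonneg _ _ (by linarith) (by norm_num)]
          congr 1; ring
        rw [h6]
        exact le_mul_of_one_le_left bot_le (by rw [hΓ, ENNReal.one_le_ofReal]; exact hγ1.le)
      calc _ ≤ _ := add_le_add h5 h4
        _ = _ := by ring
    calc I ≤ _ := h1
      _ ≤ C₁ * (Γ * (I ^ (1 / 2 : ℝ) * J ^ (1 / 2 : ℝ))) ^ p := by
          gcongr
          refine (lintegral_mono h3).trans ?_
          rw [lintegral_const_mul _ (by fun_prop)]
          gcongr
          refine (lintegral_mul_le_sqrt_mul_sqrt _ (by fun_prop) (by fun_prop)).trans_eq ?_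
          congr 2
          refine lintegral_congr fun x => ?_
          rw [← ENNReal.rpow_natCast, ← ENNReal.rpow_mul]
          congr 1
      _ = _ := by
          rw [ENNReal.mul_rpow_of_nonneg _ _ hp0.le, ENNReal.mul_rpow_of_nonneg _ _ hp0.le,
            ← ENNReal.rpow_mul, ← ENNReal.rpow_mul, ← mul_assoc]
          congr 3 <;> ring
  rw [← hpr]
  rcases eq_or_ne I 0 with hI0 | hI0
  · rw [hI0, ENNReal.zero_rpow_of_pos]
    · exact bot_le
    · rw [hpr]; positivity
  have hIpow : I ^ (1 - p / 2) ≤ C₁ * Γ ^ p * J ^ (p / 2) := by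
    have h0 : I ^ (p / 2) ≠ 0 := by simp [hI0, hIfin]
    have ht : I ^ (p / 2) ≠ ⊤ := ENNReal.rpow_ne_top_of_nonneg (by positivity) hIfin
    rw [ENNReal.rpow_sub _ _ hI0 hIfin, ENNReal.rpow_one]
    refine ENNReal.div_le_of_le_mul (key.trans_eq ?_)
    ring
  calc I ^ (2 / p - 1) = (I ^ (1 - p / 2)) ^ (2 / p) := by
        rw [← ENNReal.rpow_mul]; congr 1; field_simp
    _ ≤ (C₁ * Γ ^ p * J ^ (p / 2)) ^ (2 / p) := ENNReal.rpow_le_rpow hIpow (by positivity)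
    _ = (C₁ * Γ ^ p) ^ (2 / p) * J := by
        rw [ENNReal.mul_rpow_of_nonneg _ _ (by positivity), ← ENNReal.rpow_mul J]
        congr 1
        rw [show p / 2 * (2 / p) = 1 by field_simp, ENNReal.rpow_one]
    _ ≤ _ := by
        rw [mul_assoc]
        gcongr

/-! ### Difference quotients and the Gagliardo seminorm -/

/-- The difference quotient `(w x - w y) / |x - y| ^ ((n + 2 s) / 2)`, whose square is the integrand
of the Gagliardo seminorm of `w`. -/
noncomputable def diffQuot (s : ℝ) (w : Euc n → ℝ) (z : Euc n × Euc n) : ℝ :=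
  (w z.1 - w z.2) / ‖z.1 - z.2‖ ^ (((n : ℝ) + 2 * s) / 2)

lemma diffQuot_mul_diffQuot (s : ℝ) (v w : Euc n → ℝ) (z : Euc n × Euc n) :
    diffQuot s v z * diffQuot s w z =
      (v z.1 - v z.2) * (w z.1 - w z.2) / ‖z.1 - z.2‖ ^ ((n : ℝ) + 2 * s) := by
  rw [diffQuot, diffQuot, div_mul_div_comm, ← pow_two (‖z.1 - z.2‖ ^ _),
    ← Real.rpow_mul_natCast (norm_nonneg _)]
  congr 2
  push_cast
  ring

lemma aestronglyMeasurable_diffQuot (s : ℝ) {w : Euc n → ℝ} (hw : AEStronglyMeasurable w volume) :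
    AEStronglyMeasurable (diffQuot s w) (volume : Measure (Euc n × Euc n)) := by
  have h1 : AEStronglyMeasurable (fun z : Euc n × Euc n => w z.1 - w z.2) volume :=
    (hw.comp_quasiMeasurePreserving Measure.quasiMeasurePreserving_fst).sub
      (hw.comp_quasiMeasurePreserving Measure.quasiMeasurePreserving_snd)
  have h2 : Measurable (fun z : Euc n × Euc n => ‖z.1 - z.2‖ ^ (((n : ℝ) + 2 * s) / 2)) := by
    fun_prop
  exact (h1.aemeasurable.div h2.aemeasurable).aestronglyMeasurable

lemma diffQuot_congr_ae (s : ℝ) {v w : Euc n → ℝ} (h : v =ᵐ[volume] w) :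
    diffQuot s v =ᵐ[volume] diffQuot s w := by
  filter_upwards [Measure.quasiMeasurePreserving_fst.ae_eq_comp h,
    Measure.quasiMeasurePreserving_snd.ae_eq_comp h] with z h1 h2
  simp only [Function.comp_apply] at h1 h2
  rw [diffQuot, diffQuot, h1, h2]

/-- The kernel `|h| ^ (-(n + 2 s))`. -/
noncomputable def fracKernel (s : ℝ) (h : Euc n) : ℝ≥0∞ :=
  ENNReal.ofReal (‖h‖ ^ ((n : ℝ) + 2 * s))⁻¹

lemma enorm_diffQuot_sq (s : ℝ) (w : Euc n → ℝ) (z : Euc n × Euc n) :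
    ‖diffQuot s w z‖ₑ ^ 2 = fracKernel s (z.2 - z.1) * ‖w z.2 - w z.1‖ₑ ^ 2 := by
  rw [← enorm_pow, pow_two, diffQuot_mul_diffQuot, fracKernel, ← enorm_pow,
    Real.enorm_of_nonneg (div_nonneg (mul_self_nonneg _) (by positivity)),
    Real.enorm_of_nonneg (by positivity),
    ← ENNReal.ofReal_mul (by positivity), norm_sub_rev z.2]
  congr 1
  ring

lemma measurable_fracKernel (s : ℝ) : Measurable (fracKernel (n := n) s) := by
  unfold fracKernel
  fun_prop

lemma measurable_fracKernel_mul_min (s : ℝ) :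
    Measurable fun h : Euc n => fracKernel s h * ENNReal.ofReal (min 1 (‖h‖ ^ 2)) :=
  (measurable_fracKernel s).mul (by fun_prop)

lemma lintegral_translate_le {w : Euc n → ℝ} (hw : Measurable w) (h : Euc n) :
    ∫⁻ x, ‖w (x + h) - w x‖ₑ ^ 2 ≤ 4 * ∫⁻ x, ‖w x‖ₑ ^ 2 := by
  calc ∫⁻ x, ‖w (x + h) - w x‖ₑ ^ 2 ≤ ∫⁻ x, 2 * (‖w (x + h)‖ₑ ^ 2 + ‖w x‖ₑ ^ 2) := by
        refine lintegral_mono fun x => ?_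
        have := ENNReal.rpow_add_le_mul_rpow_add_rpow ‖w (x + h)‖ₑ ‖w x‖ₑ (p := 2) (by norm_num)
        norm_num at this
        refine le_trans ?_ this
        gcongr
        exact enorm_sub_le
    _ = 4 * ∫⁻ x, ‖w x‖ₑ ^ 2 := by
        rw [lintegral_const_mul _ (by fun_prop), lintegral_add_left (by fun_prop),
          lintegral_add_right_eq_self (fun x => ‖w x‖ₑ ^ 2) h]
        ring

lemma lintegral_translate_le_fderiv {ψ : Euc n → ℝ} (hψ : ContDiff ℝ 1 ψ) (h : Euc n) :
    ∫⁻ x, ‖ψ (x + h) - ψ x‖ₑ ^ 2 ≤ ‖h‖ₑ ^ 2 * ∫⁻ x, ‖fderiv ℝ ψ x‖ₑ ^ 2 := by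
  have hψd : Continuous (fderiv ℝ ψ) := hψ.continuous_fderiv (by simp)
  have hpt : ∀ x, ‖ψ (x + h) - ψ x‖ₑ ^ 2 ≤
      ‖h‖ₑ ^ 2 * ∫⁻ t in Set.Icc (0 : ℝ) 1, ‖fderiv ℝ ψ (x + t • h)‖ₑ ^ 2 := by
    intro x
    have hd : ∀ t : ℝ, HasDerivAt (fun t : ℝ => ψ (x + t • h)) (fderiv ℝ ψ (x + t • h) h) t := by
      intro t
      have h2 : HasDerivAt (fun t : ℝ => x + t • h) h t := by
        simpa using ((hasDerivAt_id t).smul_const h).const_add x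
      exact ((hψ.differentiable (by simp)) _).hasFDerivAt.comp_hasDerivAt t h2
    have hC : ContDiffOn ℝ 1 (fun t : ℝ => ψ (x + t • h)) (Set.Icc 0 1) := by
      apply ContDiff.contDiffOn
      fun_prop
    have h1 := enorm_sub_le_lintegral_deriv_of_contDiffOn_Icc hC zero_le_one
    simp only [one_smul, zero_smul, add_zero] at h1
    have h3 : ‖ψ (x + h) - ψ x‖ₑ ≤
        ‖h‖ₑ * ∫⁻ t in Set.Icc (0 : ℝ) 1, ‖fderiv ℝ ψ (x + t • h)‖ₑ := by
      rw [← lintegral_const_mul _ (by fun_prop)]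
      refine h1.trans (lintegral_mono fun t => ?_)
      rw [(hd t).deriv, mul_comm]
      exact ContinuousLinearMap.le_opENorm _ _
    have h4 : (∫⁻ t in Set.Icc (0 : ℝ) 1, ‖fderiv ℝ ψ (x + t • h)‖ₑ) ^ 2 ≤
        ∫⁻ t in Set.Icc (0 : ℝ) 1, ‖fderiv ℝ ψ (x + t • h)‖ₑ ^ 2 := by
      have h5 := lintegral_mul_le_sqrt_mul_sqrt (volume.restrict (Set.Icc (0 : ℝ) 1))
        (f := fun t => ‖fderiv ℝ ψ (x + t • h)‖ₑ) (g := fun _ => 1) (by fun_prop) (by fun_prop)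
      simp only [mul_one, one_pow, lintegral_const, MeasurableSet.univ, Measure.restrict_apply,
        Set.univ_inter, Real.volume_Icc, sub_zero, ENNReal.ofReal_one, ENNReal.one_rpow] at h5
      calc _ ≤ ((∫⁻ t in Set.Icc (0 : ℝ) 1, ‖fderiv ℝ ψ (x + t • h)‖ₑ ^ 2) ^ (1 / 2 : ℝ)) ^ 2 := by
            gcongr
        _ = _ := by
            rw [← ENNReal.rpow_natCast, ← ENNReal.rpow_mul]
            norm_num
    calc _ ≤ (‖h‖ₑ * ∫⁻ t in Set.Icc (0 : ℝ) 1, ‖fderiv ℝ ψ (x + t • h)‖ₑ) ^ 2 := by gcongr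
      _ ≤ _ := by rw [mul_pow]; gcongr
  have hm : Measurable (Function.uncurry fun (x : Euc n) (t : ℝ) =>
      ‖fderiv ℝ ψ (x + t • h)‖ₑ ^ 2) := by
    have : Continuous (fun p : Euc n × ℝ => fderiv ℝ ψ (p.1 + p.2 • h)) := by fun_prop
    exact (this.measurable.enorm).pow_const 2
  calc _ ≤ _ := lintegral_mono hpt
    _ = ‖h‖ₑ ^ 2 * ∫⁻ t in Set.Icc (0 : ℝ) 1, ∫⁻ x, ‖fderiv ℝ ψ (x + t • h)‖ₑ ^ 2 := by
        have hm' : Measurable fun x : Euc n => ∫⁻ t in Set.Icc (0 : ℝ) 1,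
            ‖fderiv ℝ ψ (x + t • h)‖ₑ ^ 2 := hm.lintegral_prod_right'
        rw [lintegral_const_mul _ hm', lintegral_lintegral_swap hm.aemeasurable]
    _ = _ := by
        congr 1
        have : ∀ t : ℝ, ∫⁻ x, ‖fderiv ℝ ψ (x + t • h)‖ₑ ^ 2 = ∫⁻ x, ‖fderiv ℝ ψ x‖ₑ ^ 2 :=
          fun t => lintegral_add_right_eq_self (fun x => ‖fderiv ℝ ψ x‖ₑ ^ 2) (t • h)
        simp [this]

/-- Fubini's theorem in the variables `x` and `h = y - x`. -/
lemma lintegral_prod_sub_eq {w : Euc n → ℝ} (hw : Measurable w) {k : Euc n → ℝ≥0∞}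
    (hk : Measurable k) :
    ∫⁻ z : Euc n × Euc n, k (z.2 - z.1) * ‖w z.2 - w z.1‖ₑ ^ 2 =
      ∫⁻ h, k h * ∫⁻ x, ‖w (x + h) - w x‖ₑ ^ 2 := by
  have hm : Measurable (fun z : Euc n × Euc n => k (z.2 - z.1) * ‖w z.2 - w z.1‖ₑ ^ 2) := by
    fun_prop
  rw [Measure.volume_eq_prod,
    ← (measurePreserving_prod_add (volume : Measure (Euc n)) volume).lintegral_comp hm]
  simp only [add_sub_cancel_left]
  have hm2 : Measurable (fun z : Euc n × Euc n => k z.2 * ‖w (z.1 + z.2) - w z.1‖ₑ ^ 2) := by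
    fun_prop
  rw [lintegral_prod_symm' _ hm2]
  refine lintegral_congr fun h => ?_
  exact lintegral_const_mul (k h) (f := fun x => ‖w (x + h) - w x‖ₑ ^ 2) (by fun_prop)

/-- The kernel integrates `min (1, |h|²)`, because `0 < s < 1`. -/
lemma lintegral_fracKernel_lt_top (hn : 0 < n) {s : ℝ} (hs0 : 0 < s) (hs1 : s < 1) :
    ∫⁻ h : Euc n, fracKernel s h * ENNReal.ofReal (min 1 (‖h‖ ^ 2)) < ⊤ := by
  have : Nonempty (Fin n) := ⟨⟨0, hn⟩⟩
  have hint : Integrable (fun h : Euc n =>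
      (fun r : ℝ => (r ^ ((n : ℝ) + 2 * s))⁻¹ * min 1 (r ^ 2)) ‖h‖) volume := by
    rw [integrable_fun_norm_addHaar volume (f := fun r : ℝ =>
      (r ^ ((n : ℝ) + 2 * s))⁻¹ * min 1 (r ^ 2))]
    have hpow : ∀ y : ℝ, 0 < y → y ^ (Module.finrank ℝ (Euc n) - 1) *
        (y ^ ((n : ℝ) + 2 * s))⁻¹ = y ^ (-1 - 2 * s) := by
      intro y hy
      rw [← Real.rpow_neg hy.le, ← Real.rpow_natCast, ← Real.rpow_add hy]
      congr 1
      simp only [finrank_euclideanSpace, Fintype.card_fin]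
      rw [Nat.cast_sub hn]; push_cast; ring
    have h1 : IntegrableOn (fun y : ℝ => y ^ (1 - 2 * s)) (Set.Ioc 0 1) := by
      rw [← intervalIntegrable_iff_integrableOn_Ioc_of_le zero_le_one]
      exact intervalIntegral.intervalIntegrable_rpow' (by linarith)
    have h2 : IntegrableOn (fun y : ℝ => y ^ (-1 - 2 * s)) (Set.Ioi 1) :=
      integrableOn_Ioi_rpow_of_lt (by linarith) zero_lt_one
    rw [← Set.Ioc_union_Ioi_eq_Ioi zero_le_one]
    refine IntegrableOn.union ?_ ?_
    · refine Integrable.mono' h1 (by fun_prop) ?_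
      filter_upwards [ae_restrict_mem measurableSet_Ioc] with y hy
      have hy0 : 0 < y := hy.1
      rw [smul_eq_mul, ← mul_assoc, hpow y hy0, Real.norm_of_nonneg (by positivity)]
      calc y ^ (-1 - 2 * s) * min 1 (y ^ 2) ≤ y ^ (-1 - 2 * s) * y ^ 2 := by
            gcongr; exact min_le_right _ _
        _ = _ := by
            rw [← Real.rpow_natCast, ← Real.rpow_add hy0]; congr 1; push_cast; ring
    · refine Integrable.mono' h2 (by fun_prop) ?_
      filter_upwards [ae_restrict_mem measurableSet_Ioi] with y hy
      have hy0 : 0 < y := zero_lt_one.trans hy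
      rw [smul_eq_mul, ← mul_assoc, hpow y hy0, Real.norm_of_nonneg (by positivity)]
      exact mul_le_of_le_one_right (by positivity) (min_le_left _ _)
  have h3 := hint.lintegral_lt_top
  refine lt_of_le_of_lt (lintegral_mono fun h => ?_) h3
  rw [fracKernel, ← ENNReal.ofReal_mul (by positivity)]

/-- The Gagliardo seminorm of order `s < 1` is controlled by the `H¹` norm. -/
lemma exists_lintegral_diffQuot_le (hn : 0 < n) {s : ℝ} (hs0 : 0 < s) (hs1 : s < 1) :
    ∃ C : ℝ≥0∞, C ≠ ⊤ ∧ ∀ ψ : Euc n → ℝ, ContDiff ℝ 1 ψ →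
      ∫⁻ z, ‖diffQuot s ψ z‖ₑ ^ 2 ≤
        C * ((∫⁻ x, ‖ψ x‖ₑ ^ 2) + ∫⁻ x, ‖fderiv ℝ ψ x‖ₑ ^ 2) := by
  refine ⟨4 * ∫⁻ h : Euc n, fracKernel s h * ENNReal.ofReal (min 1 (‖h‖ ^ 2)),
    ENNReal.mul_ne_top (by simp) (lintegral_fracKernel_lt_top hn hs0 hs1).ne, fun ψ hψ => ?_⟩
  simp_rw [enorm_diffQuot_sq]
  rw [lintegral_prod_sub_eq hψ.continuous.measurable (measurable_fracKernel s), mul_assoc,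
    mul_comm (∫⁻ h : Euc n, _), ← mul_assoc, ← lintegral_const_mul _
      (measurable_fracKernel_mul_min s)]
  refine lintegral_mono fun h => ?_
  set A := ∫⁻ x, ‖ψ x‖ₑ ^ 2
  set B := ∫⁻ x, ‖fderiv ℝ ψ x‖ₑ ^ 2
  have h1 : ∫⁻ x, ‖ψ (x + h) - ψ x‖ₑ ^ 2 ≤ 4 * (A + B) * ENNReal.ofReal (min 1 (‖h‖ ^ 2)) := by
    rcases le_total 1 (‖h‖ ^ 2) with hh | hh
    · rw [min_eq_left hh, ENNReal.ofReal_one, mul_one]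
      exact (lintegral_translate_le hψ.continuous.measurable h).trans (by gcongr; exact le_self_add)
    · rw [min_eq_right hh, ENNReal.ofReal_pow (norm_nonneg _), ofReal_norm, mul_comm]
      refine (lintegral_translate_le_fderiv hψ h).trans ?_
      gcongr
      calc B ≤ A + B := le_add_self
        _ ≤ 4 * (A + B) := le_mul_of_one_le_left bot_le (by norm_num)
  calc _ ≤ fracKernel s h * (4 * (A + B) * ENNReal.ofReal (min 1 (‖h‖ ^ 2))) := by gcongr
    _ = _ := by ring

/-- Away from the diagonal, the Gagliardo seminorm is controlled by the `L²` norm. -/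
lemma exists_lintegral_diffQuot_offDiag_le (hn : 0 < n) {s : ℝ} (hs0 : 0 < s) (hs1 : s < 1)
    {δ : ℝ} (hδ : 0 < δ) :
    ∃ C : ℝ≥0∞, C ≠ ⊤ ∧ ∀ w : Euc n → ℝ, AEStronglyMeasurable w volume →
      ∫⁻ z in {z : Euc n × Euc n | δ ≤ ‖z.2 - z.1‖}, ‖diffQuot s w z‖ₑ ^ 2 ≤
        C * ∫⁻ x, ‖w x‖ₑ ^ 2 := by
  set c : ℝ := min 1 (δ ^ 2) with hc
  have hc0 : 0 < c := by positivity
  refine ⟨ENNReal.ofReal c⁻¹ *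
    (4 * ∫⁻ h : Euc n, fracKernel s h * ENNReal.ofReal (min 1 (‖h‖ ^ 2))),
    ENNReal.mul_ne_top ENNReal.ofReal_ne_top
      (ENNReal.mul_ne_top (by simp) (lintegral_fracKernel_lt_top hn hs0 hs1).ne), ?_⟩
  have hmain : ∀ w : Euc n → ℝ, Measurable w →
      ∫⁻ z in {z : Euc n × Euc n | δ ≤ ‖z.2 - z.1‖}, ‖diffQuot s w z‖ₑ ^ 2 ≤
        ENNReal.ofReal c⁻¹ *
    (4 * ∫⁻ h : Euc n, fracKernel s h * ENNReal.ofReal (min 1 (‖h‖ ^ 2))) *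
          ∫⁻ x, ‖w x‖ₑ ^ 2 := by
    intro w hw
    have hmk : Measurable (fun h : Euc n => ENNReal.ofReal c⁻¹ *
        (fracKernel s h * ENNReal.ofReal (min 1 (‖h‖ ^ 2)))) :=
      ((measurable_fracKernel s).mul (by fun_prop)).const_mul _
    have hS : MeasurableSet {z : Euc n × Euc n | δ ≤ ‖z.2 - z.1‖} :=
      measurableSet_le measurable_const (by fun_prop)
    calc _ ≤ ∫⁻ z in {z : Euc n × Euc n | δ ≤ ‖z.2 - z.1‖}, ENNReal.ofReal c⁻¹ *
        (fracKernel s (z.2 - z.1) * ENNReal.ofReal (min 1 (‖z.2 - z.1‖ ^ 2))) *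
          ‖w z.2 - w z.1‖ₑ ^ 2 := by
          refine setLIntegral_mono' hS fun z hz => ?_
          rw [enorm_diffQuot_sq]
          gcongr
          rw [mul_left_comm, ← ENNReal.ofReal_mul (by positivity)]
          refine le_mul_of_one_le_right bot_le ?_
          rw [ENNReal.one_le_ofReal, inv_mul_eq_div, one_le_div hc0]
          have hz' : δ ≤ ‖z.2 - z.1‖ := hz
          exact min_le_min_left _ (pow_le_pow_left₀ hδ.le hz' 2)
      _ ≤ _ := setLIntegral_le_lintegral _ _
      _ = _ := lintegral_prod_sub_eq hw hmk
      _ ≤ ∫⁻ h : Euc n, ENNReal.ofReal c⁻¹ *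
        (fracKernel s h * ENNReal.ofReal (min 1 (‖h‖ ^ 2))) * (4 * ∫⁻ x, ‖w x‖ₑ ^ 2) := by
          refine lintegral_mono fun h => ?_
          gcongr
          exact lintegral_translate_le hw h
      _ = _ := by
          rw [lintegral_mul_const _ hmk, lintegral_const_mul _ (measurable_fracKernel_mul_min s)]
          ring
  intro w hw
  have h1 : ∫⁻ z in {z : Euc n × Euc n | δ ≤ ‖z.2 - z.1‖}, ‖diffQuot s w z‖ₑ ^ 2 =
      ∫⁻ z in {z : Euc n × Euc n | δ ≤ ‖z.2 - z.1‖}, ‖diffQuot s (hw.mk w) z‖ₑ ^ 2 := by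
    refine lintegral_congr_ae (ae_restrict_of_ae ?_)
    filter_upwards [diffQuot_congr_ae s hw.ae_eq_mk] with z hz
    rw [hz]
  have h2 : ∫⁻ x, ‖w x‖ₑ ^ 2 = ∫⁻ x, ‖hw.mk w x‖ₑ ^ 2 := by
    refine lintegral_congr_ae ?_
    filter_upwards [hw.ae_eq_mk] with z hz
    rw [← hz]
  rw [h1, h2]
  exact hmain _ hw.stronglyMeasurable_mk.measurable

/-- A Poincaré inequality: the nonlocal energy of a function that vanishes outside a bounded set
sees the difference between its values in `Ω` and its zero values far away. -/
lemma exists_poincare (hn : 0 < n) (s : ℝ) (hs0 : 0 < s) {Ω U : Set (Euc n)} (hΩ : MeasurableSet Ω)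
    (hΩU : Ω ⊆ U) (hU : Bornology.IsBounded U) :
    ∃ C : ℝ≥0∞, C ≠ ⊤ ∧ ∀ w : Euc n → ℝ, AEStronglyMeasurable w volume →
      (∀ᵐ x ∂(volume.restrict Uᶜ), w x = 0) →
      ∫⁻ x in Ω, ‖w x‖ₑ ^ 2 ≤ C * ∫⁻ z in crossSet Ω, ‖diffQuot s w z‖ₑ ^ 2 := by
  obtain ⟨R, hR0, hR⟩ := hU.subset_ball_lt 0 0
  have : Nonempty (Fin n) := ⟨⟨0, hn⟩⟩
  obtain ⟨p, hp⟩ := NormedSpace.exists_lt_norm ℝ (Euc n) (R + 1)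
  set D : ℝ := R + 1 + ‖p‖ with hD
  have hD0 : 0 < D := by positivity
  set a : ℝ := (n : ℝ) + 2 * s with ha
  have ha0 : 0 < a := by positivity
  set κ : ℝ≥0∞ := ENNReal.ofReal (D ^ a)⁻¹ with hκ
  set V := volume (Metric.ball p 1) with hV
  have hκ0 : κ ≠ 0 := by
    rw [hκ, Ne, ENNReal.ofReal_eq_zero, not_le]; positivity
  have hV0 : V ≠ 0 := (Metric.measure_ball_pos volume p one_pos).ne'
  have hVt : V ≠ ⊤ := measure_ball_lt_top.ne
  refine ⟨(κ * V)⁻¹, ENNReal.inv_ne_top.2 (mul_ne_zero hκ0 hV0), fun w hw hw0 => ?_⟩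
  have hball : Metric.ball p 1 ⊆ Uᶜ := by
    intro y hy hyU
    have h1 := hR hyU
    rw [mem_ball_zero_iff] at h1
    rw [Metric.mem_ball, dist_eq_norm] at hy
    have h2 : ‖p‖ ≤ ‖y‖ + ‖y - p‖ := by
      rw [norm_sub_rev]; simpa using norm_add_le y (p - y)
    linarith
  have hw0' : ∀ᵐ y ∂(volume.restrict (Metric.ball p 1)), w y = 0 :=
    ae_restrict_of_ae_restrict_of_subset hball hw0
  have hsub : Ω ×ˢ Metric.ball p 1 ⊆ crossSet Ω := by
    rintro ⟨x, y⟩ ⟨hx, -⟩ ⟨hx', -⟩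
    exact hx' hx
  have hpt : ∀ x ∈ Ω, κ * V * ‖w x‖ₑ ^ 2 ≤
      ∫⁻ y in Metric.ball p 1, ‖diffQuot s w (x, y)‖ₑ ^ 2 := by
    intro x hx
    calc κ * V * ‖w x‖ₑ ^ 2 = ∫⁻ y in Metric.ball p 1, κ * ‖w x‖ₑ ^ 2 := by
          rw [setLIntegral_const]; ring
      _ ≤ _ := by
          refine lintegral_mono_ae ?_
          filter_upwards [hw0', ae_restrict_mem measurableSet_ball] with y hy hyb
          rw [enorm_diffQuot_sq, hy, zero_sub, enorm_neg]
          gcongr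
          apply ENNReal.ofReal_le_ofReal
          have hxU := hR (hΩU hx)
          rw [mem_ball_zero_iff] at hxU
          have hyx : 0 < ‖y - x‖ := by
            rw [norm_pos_iff, sub_ne_zero]
            rintro rfl
            exact hball hyb (hΩU hx)
          rw [Metric.mem_ball, dist_eq_norm] at hyb
          have hle : ‖y - x‖ ≤ D := by
            calc ‖y - x‖ = ‖(y - p) + p - x‖ := by congr 1; abel
              _ ≤ ‖y - p‖ + ‖p‖ + ‖x‖ := (norm_sub_le _ _).trans (by gcongr; exact norm_add_le _ _)
              _ ≤ D := by rw [hD]; linarith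
          gcongr
  have hmain : κ * V * ∫⁻ x in Ω, ‖w x‖ₑ ^ 2 ≤ ∫⁻ z in crossSet Ω, ‖diffQuot s w z‖ₑ ^ 2 := by
    rw [← lintegral_const_mul'' _ (hw.restrict.enorm.pow_const 2)]
    calc _ ≤ ∫⁻ x in Ω, ∫⁻ y in Metric.ball p 1, ‖diffQuot s w (x, y)‖ₑ ^ 2 :=
          setLIntegral_mono' hΩ hpt
      _ = ∫⁻ z in Ω ×ˢ Metric.ball p 1, ‖diffQuot s w z‖ₑ ^ 2 := by
          rw [Measure.volume_eq_prod, ← Measure.prod_restrict, lintegral_prod]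
          rw [Measure.prod_restrict]
          exact (aestronglyMeasurable_diffQuot s hw).restrict.enorm.pow_const 2
      _ ≤ _ := lintegral_mono_set hsub
  rw [mul_comm, ← div_eq_mul_inv, ENNReal.le_div_iff_mul_le (Or.inl (mul_ne_zero hκ0 hV0))
    (Or.inl (ENNReal.mul_ne_top ENNReal.ofReal_ne_top hVt)), mul_comm]
  exact hmain

/-! ### Limits of test functions in `H¹` -/

section L2

variable {α E : Type*} [MeasurableSpace α] {μ : Measure α} [NormedAddCommGroup E]

lemma eLpNorm_two_sq {f : α → E} : eLpNorm f 2 μ ^ 2 = ∫⁻ x, ‖f x‖ₑ ^ 2 ∂μ := by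
  have h := eLpNorm_nnreal_pow_eq_lintegral (μ := μ) (f := f) (p := 2) (by norm_num)
  norm_num at h
  exact_mod_cast h

lemma eLpNorm_two_eq {f : α → E} : eLpNorm f 2 μ = (∫⁻ x, ‖f x‖ₑ ^ 2 ∂μ) ^ (1 / 2 : ℝ) := by
  rw [← eLpNorm_two_sq, ← ENNReal.rpow_natCast, ← ENNReal.rpow_mul]
  norm_num

lemma tendsto_eLpNorm_two_iff {ι : Type*} {l : Filter ι} {f : ι → α → E} :
    Tendsto (fun i => eLpNorm (f i) 2 μ) l (𝓝 0) ↔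
      Tendsto (fun i => ∫⁻ x, ‖f i x‖ₑ ^ 2 ∂μ) l (𝓝 0) := by
  simp_rw [← eLpNorm_two_sq]
  constructor
  · intro h
    simpa using ENNReal.Tendsto.pow (n := 2) h
  · intro h
    have := h.ennrpow_const (1 / 2 : ℝ)
    simp_rw [← ENNReal.rpow_natCast, ← ENNReal.rpow_mul] at this
    norm_num at this
    exact this

/-- `L²` convergence is preserved by multiplication with uniformly bounded, almost everywhere
convergent factors. -/
lemma tendsto_eLpNorm_smul_sub [NormedSpace ℝ E] {c : ℕ → α → ℝ} {c' : α → ℝ} {A : ℕ → α → E}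
    {A' : α → E} {M : ℝ} (hc : ∀ k, AEStronglyMeasurable (c k) μ) (hcM : ∀ k x, |c k x| ≤ M)
    (hcc : ∀ᵐ x ∂μ, Tendsto (fun k => c k x) atTop (𝓝 (c' x)))
    (hA : ∀ k, AEStronglyMeasurable (A k) μ) (hA' : MemLp A' 2 μ)
    (hAA : Tendsto (fun k => eLpNorm (fun x => A k x - A' x) 2 μ) atTop (𝓝 0)) :
    Tendsto (fun k => eLpNorm (fun x => c k x • A k x - c' x • A' x) 2 μ) atTop (𝓝 0) := by
  have hc' : AEStronglyMeasurable c' μ := aestronglyMeasurable_of_tendsto_ae atTop hc hcc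
  have hc'M : ∀ᵐ x ∂μ, |c' x| ≤ M := by
    filter_upwards [hcc] with x hx
    exact le_of_tendsto hx.abs (Eventually.of_forall fun k => hcM k x)
  have h1 : Tendsto (fun k => eLpNorm (fun x => c k x • (A k x - A' x)) 2 μ) atTop (𝓝 0) := by
    have h2 := ENNReal.Tendsto.const_mul (a := ENNReal.ofReal M) hAA (Or.inr ENNReal.ofReal_ne_top)
    rw [mul_zero] at h2
    refine tendsto_of_tendsto_of_tendsto_of_le_of_le tendsto_const_nhds h2 (fun _ => bot_le)
      fun k => ?_
    refine eLpNorm_le_mul_eLpNorm_of_ae_le_mul (Eventually.of_forall fun x => ?_) 2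
    rw [norm_smul]
    exact mul_le_mul_of_nonneg_right (hcM k x) (norm_nonneg _)
  have h3 : Tendsto (fun k => eLpNorm (fun x => (c k x - c' x) • A' x) 2 μ) atTop (𝓝 0) := by
    rw [tendsto_eLpNorm_two_iff, ← lintegral_zero (μ := μ)]
    refine tendsto_lintegral_of_dominated_convergence'
      (fun x => ENNReal.ofReal (2 * M) ^ 2 * ‖A' x‖ₑ ^ 2) (fun k => ?_) (fun k => ?_) ?_ ?_
    · exact (((hc k).sub hc').smul hA'.1).enorm.pow_const 2
    · filter_upwards [hc'M] with x hx
      rw [enorm_smul, mul_pow]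
      gcongr
      rw [← ofReal_norm]
      apply ENNReal.ofReal_le_ofReal
      have := abs_sub (c k x) (c' x)
      rw [Real.norm_eq_abs]
      linarith [hcM k x]
    · rw [lintegral_const_mul'' _ (hA'.1.enorm.pow_const 2), ← eLpNorm_two_sq]
      exact ENNReal.mul_ne_top (ENNReal.pow_ne_top ENNReal.ofReal_ne_top)
        (ENNReal.pow_ne_top hA'.2.ne)
    · filter_upwards [hcc] with x hx
      have h4 : Tendsto (fun k => (c k x - c' x) • A' x) atTop (𝓝 0) := by
        simpa using (hx.sub_const (c' x)).smul_const (A' x)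
      simpa using ENNReal.Tendsto.pow (n := 2) h4.enorm
  have h5 := h1.add h3
  rw [add_zero] at h5
  refine tendsto_of_tendsto_of_tendsto_of_le_of_le tendsto_const_nhds h5 (fun _ => bot_le)
    fun k => ?_
  refine le_trans (le_of_eq ?_) (eLpNorm_add_le ((hc k).smul ((hA k).sub hA'.1))
    (((hc k).sub hc').smul hA'.1) (by norm_num))
  congr 1
  ext x
  simp only [Pi.add_apply]
  module

/-- `L²` convergence of one factor suffices for convergence of the integral of an inner product. -/
lemma tendsto_integral_inner [InnerProductSpace ℝ E] {f : α → E} {g : ℕ → α → E} {g' : α → E}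
    (hf : MemLp f 2 μ) (hg : ∀ k, MemLp (g k) 2 μ) (hg' : MemLp g' 2 μ)
    (hgg : Tendsto (fun k => eLpNorm (fun x => g k x - g' x) 2 μ) atTop (𝓝 0)) :
    Tendsto (fun k => ∫ x, inner ℝ (f x) (g k x) ∂μ) atTop
      (𝓝 (∫ x, inner ℝ (f x) (g' x) ∂μ)) := by
  have hcs : ∀ h : α → E, AEStronglyMeasurable h μ →
      ∫⁻ x, ‖inner ℝ (f x) (h x)‖ₑ ∂μ ≤ eLpNorm f 2 μ * eLpNorm h 2 μ := by
    intro h hh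
    rw [eLpNorm_two_eq, eLpNorm_two_eq]
    refine le_trans (lintegral_mono fun x => ?_)
      (lintegral_mul_le_sqrt_mul_sqrt μ hf.1.enorm hh.enorm)
    rw [← ofReal_norm, ← ofReal_norm, ← ofReal_norm, ← ENNReal.ofReal_mul (norm_nonneg _)]
    exact ENNReal.ofReal_le_ofReal (norm_inner_le_norm _ _)
  refine tendsto_integral_of_L1 _ (hf.1.inner hg'.1) (Eventually.of_forall fun k => ?_) ?_
  · exact ⟨hf.1.inner (hg k).1, lt_of_le_of_lt (hcs _ (hg k).1) (ENNReal.mul_lt_top hf.2 (hg k).2)⟩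
  · have h2 := ENNReal.Tendsto.const_mul (a := eLpNorm f 2 μ) hgg (Or.inr hf.2.ne)
    rw [mul_zero] at h2
    refine tendsto_of_tendsto_of_tendsto_of_le_of_le tendsto_const_nhds h2 (fun _ => bot_le)
      fun k => ?_
    refine le_trans (le_of_eq ?_) (hcs _ ((hg k).1.sub hg'.1))
    refine lintegral_congr fun x => ?_
    rw [inner_sub_right]

/-- A norm inequality between a function and two others passes to limits. -/
lemma eLpNorm_le_of_tendsto {β F F' F'' : Type*} [MeasurableSpace β] {ν : Measure β}
    [NormedAddCommGroup F] [NormedAddCommGroup F'] [NormedAddCommGroup F'']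
    {p : ℝ≥0∞} {C : ℝ≥0∞} (hC : C ≠ ⊤) {Φ : ℕ → β → F} {Φ' : β → F} {a : ℕ → α → F'} {a' : α → F'}
    {b : ℕ → α → F''} {b' : α → F''}
    (hΦ : ∀ k, AEStronglyMeasurable (Φ k) ν)
    (hΦΦ : ∀ᵐ x ∂ν, Tendsto (fun k => Φ k x) atTop (𝓝 (Φ' x)))
    (ha : ∀ k, AEStronglyMeasurable (a k) μ) (ha' : AEStronglyMeasurable a' μ)
    (hb : ∀ k, AEStronglyMeasurable (b k) μ) (hb' : AEStronglyMeasurable b' μ)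
    (haa : Tendsto (fun k => eLpNorm (fun x => a k x - a' x) 2 μ) atTop (𝓝 0))
    (hbb : Tendsto (fun k => eLpNorm (fun x => b k x - b' x) 2 μ) atTop (𝓝 0))
    (hle : ∀ k, eLpNorm (Φ k) p ν ≤ C * (eLpNorm (a k) 2 μ + eLpNorm (b k) 2 μ)) :
    eLpNorm Φ' p ν ≤ C * (eLpNorm a' 2 μ + eLpNorm b' 2 μ) := by
  have h1 := Lp.eLpNorm_lim_le_liminf_eLpNorm (p := p) hΦ Φ' hΦΦ
  have h2 : Tendsto (fun k => C * ((eLpNorm (fun x => a k x - a' x) 2 μ + eLpNorm a' 2 μ) +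
      (eLpNorm (fun x => b k x - b' x) 2 μ + eLpNorm b' 2 μ))) atTop
      (𝓝 (C * (eLpNorm a' 2 μ + eLpNorm b' 2 μ))) := by
    have h3 := ENNReal.Tendsto.const_mul (a := C)
      ((haa.add_const (eLpNorm a' 2 μ)).add (hbb.add_const (eLpNorm b' 2 μ))) (Or.inr hC)
    simpa using h3
  refine h1.trans (le_of_le_of_eq (liminf_le_liminf (Eventually.of_forall fun k => ?_))
    h2.liminf_eq)
  refine (hle k).trans ?_
  gcongr
  · refine le_trans (le_of_eq ?_) (eLpNorm_add_le ((ha k).sub ha') ha' (by norm_num))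
    congr 1; ext x; simp
  · refine le_trans (le_of_eq ?_) (eLpNorm_add_le ((hb k).sub hb') hb' (by norm_num))
    congr 1; ext x; simp

end L2

section TestFunctions

lemma inner_gradient (φ : Euc n → ℝ) (x v : Euc n) :
    inner ℝ (gradient φ x) v = fderiv ℝ φ x v := by
  rw [gradient, InnerProductSpace.toDual_symm_apply]

lemma norm_gradient (φ : Euc n → ℝ) (x : Euc n) : ‖gradient φ x‖ = ‖fderiv ℝ φ x‖ := by
  rw [gradient, LinearIsometryEquiv.norm_map]

lemma enorm_gradient (φ : Euc n → ℝ) (x : Euc n) : ‖gradient φ x‖ₑ = ‖fderiv ℝ φ x‖ₑ := by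
  rw [← ofReal_norm, norm_gradient, ofReal_norm]

variable {U : Set (Euc n)} {φ : Euc n → ℝ}

lemma continuous_gradient (hφ : ContDiff ℝ 1 φ) : Continuous (gradient φ) :=
  (LinearIsometryEquiv.continuous _).comp (hφ.continuous_fderiv (by simp))

lemma IsTest.contDiff_one (h : IsTest U φ) : ContDiff ℝ 1 φ := h.1.of_le (by simp)

lemma IsTest.memLp (h : IsTest U φ) (p : ℝ≥0∞) (μ : Measure (Euc n))
    [IsFiniteMeasureOnCompacts μ] : MemLp φ p μ :=
  h.1.continuous.memLp_of_hasCompactSupport h.2.1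

lemma gradient_eq_zero_of_notMem_tsupport {x : Euc n} (hx : x ∉ tsupport φ) :
    gradient φ x = 0 := by
  have : fderiv ℝ φ x = 0 := by
    by_contra hne
    exact hx (support_fderiv_subset ℝ hne)
  rw [gradient, this, map_zero]

lemma IsTest.hasCompactSupport_gradient (h : IsTest U φ) : HasCompactSupport (gradient φ) :=
  h.2.1.mono' fun x hx => by
    by_contra hne
    exact hx (gradient_eq_zero_of_notMem_tsupport hne)

lemma IsTest.memLp_gradient (h : IsTest U φ) (p : ℝ≥0∞) (μ : Measure (Euc n))
    [IsFiniteMeasureOnCompacts μ] : MemLp (gradient φ) p μ :=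
  (continuous_gradient h.contDiff_one).memLp_of_hasCompactSupport h.hasCompactSupport_gradient

lemma IsTest.eq_zero (h : IsTest U φ) {x : Euc n} (hx : x ∉ U) : φ x = 0 :=
  image_eq_zero_of_notMem_tsupport fun hx' => hx (h.2.2 hx')

lemma IsTest.gradient_eq_zero (h : IsTest U φ) {x : Euc n} (hx : x ∉ U) : gradient φ x = 0 :=
  gradient_eq_zero_of_notMem_tsupport fun hx' => hx (h.2.2 hx')

lemma gradient_sub {φ' : Euc n → ℝ} (h : ContDiff ℝ 1 φ) (h' : ContDiff ℝ 1 φ') (x : Euc n) :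
    gradient (fun x => φ x - φ' x) x = gradient φ x - gradient φ' x := by
  rw [gradient, gradient, gradient, fderiv_fun_sub (h.differentiable (by simp) _)
    (h'.differentiable (by simp) _), map_sub]

lemma IsTest.sub {φ' : Euc n → ℝ} (h : IsTest U φ) (h' : IsTest U φ') :
    IsTest U (fun x => φ x - φ' x) := by
  have hs : tsupport (fun x => φ x - φ' x) ⊆ tsupport φ ∪ tsupport φ' := by
    refine closure_minimal (fun x hx => ?_) ((isClosed_tsupport _).union (isClosed_tsupport _))
    by_contra hne
    rw [Set.mem_union, not_or] at hne
    refine hx ?_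
    simp [image_eq_zero_of_notMem_tsupport hne.1, image_eq_zero_of_notMem_tsupport hne.2]
  exact ⟨h.1.sub h'.1, (h.2.1.isCompact.union h'.2.1.isCompact).of_isClosed_subset
    (isClosed_tsupport _) hs, hs.trans (Set.union_subset h.2.2 h'.2.2)⟩

end TestFunctions

/-- `(w, H)` is the limit of test functions in `H¹(ℝⁿ)` and almost everywhere: `w` lies in `H¹₀(U)`,
extended by zero, and has weak gradient `H`. -/
def IsTestLimit (U : Set (Euc n)) (w : Euc n → ℝ) (H : Euc n → Euc n) : Prop :=
  MemLp w 2 volume ∧ MemLp H 2 volume ∧ ∃ ψ : ℕ → Euc n → ℝ, (∀ k, IsTest U (ψ k)) ∧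
    (∀ᵐ x, Tendsto (fun k => ψ k x) atTop (𝓝 (w x))) ∧
    Tendsto (fun k => eLpNorm (fun x => ψ k x - w x) 2 volume) atTop (𝓝 0) ∧
    Tendsto (fun k => eLpNorm (fun x => gradient (ψ k) x - H x) 2 volume) atTop (𝓝 0)

variable {U : Set (Euc n)} {w w' : Euc n → ℝ} {H H' : Euc n → Euc n}

lemma IsTest.isTestLimit {φ : Euc n → ℝ} (h : IsTest U φ) : IsTestLimit U φ (gradient φ) :=
  ⟨h.memLp 2 _, h.memLp_gradient 2 _, fun _ => φ, fun _ => h,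
    Eventually.of_forall fun _ => tendsto_const_nhds, by simp, by simp⟩

lemma IsTestLimit.sub (h : IsTestLimit U w H) (h' : IsTestLimit U w' H') :
    IsTestLimit U (fun x => w x - w' x) (fun x => H x - H' x) := by
  obtain ⟨hw, hH, ψ, hψ, hae, hL, hG⟩ := h
  obtain ⟨hw', hH', ψ', hψ', hae', hL', hG'⟩ := h'
  refine ⟨hw.sub hw', hH.sub hH', fun k x => ψ k x - ψ' k x, fun k => (hψ k).sub (hψ' k), ?_, ?_, ?_⟩
  · filter_upwards [hae, hae'] with x hx hx'
    exact hx.sub hx'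
  · have h5 := hL.add hL'
    rw [add_zero] at h5
    refine tendsto_of_tendsto_of_tendsto_of_le_of_le tendsto_const_nhds h5 (fun _ => bot_le)
      fun k => ?_
    refine le_trans (le_of_eq ?_) (eLpNorm_sub_le (((hψ k).memLp 2 _).sub hw).1
      (((hψ' k).memLp 2 _).sub hw').1 (by norm_num))
    congr 1
    ext x
    simp only [Pi.sub_apply]
    abel
  · have h5 := hG.add hG'
    rw [add_zero] at h5
    refine tendsto_of_tendsto_of_tendsto_of_le_of_le tendsto_const_nhds h5 (fun _ => bot_le)
      fun k => ?_
    refine le_trans (le_of_eq ?_) (eLpNorm_sub_le (((hψ k).memLp_gradient 2 _).sub hH).1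
      (((hψ' k).memLp_gradient 2 _).sub hH').1 (by norm_num))
    congr 1
    ext1 x
    simp only [Pi.sub_apply]
    rw [gradient_sub (hψ k).contDiff_one (hψ' k).contDiff_one]
    abel

/-- The gradient of a function in the energy space is cut off outside `U`: only its restriction to `U`
is approximated by gradients of test functions. -/
lemma isTestLimit_of_memXWith (hU : MeasurableSet U) {u : Euc n → ℝ} {G : Euc n → Euc n}
    (h : MemXWith U u G) : IsTestLimit U u (U.indicator G) := by
  obtain ⟨hu, hG, -, ⟨ψ, hψ, hL, hL'⟩, h0⟩ := h
  have h1 : ∀ k, eLpNorm (fun x => ψ k x - u x) 2 volume =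
      eLpNorm (fun x => ψ k x - u x) 2 (volume.restrict U) := by
    intro k
    rw [← eLpNorm_indicator_eq_eLpNorm_restrict hU]
    refine eLpNorm_congr_ae ?_
    have h2 := (ae_restrict_iff' hU.compl).1 h0
    filter_upwards [h2] with x hx
    by_cases hxU : x ∈ U
    · simp [hxU]
    · simp [hxU, hx hxU, (hψ k).eq_zero hxU]
  have h1' : ∀ k, eLpNorm (fun x => gradient (ψ k) x - U.indicator G x) 2 volume =
      eLpNorm (fun x => gradient (ψ k) x - G x) 2 (volume.restrict U) := by
    intro k
    rw [← eLpNorm_indicator_eq_eLpNorm_restrict hU]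
    congr 1
    ext1 x
    by_cases hxU : x ∈ U
    · simp [hxU]
    · simp [hxU, (hψ k).gradient_eq_zero hxU]
  simp_rw [← h1] at hL
  simp_rw [← h1'] at hL'
  obtain ⟨ns, hns, hae⟩ := (tendstoInMeasure_of_tendsto_eLpNorm (by norm_num)
    (fun k => ((hψ k).memLp 2 volume).1) hu.1 hL).exists_seq_tendsto_ae
  exact ⟨hu, hG.indicator hU, fun k => ψ (ns k), fun k => hψ _, hae, hL.comp hns.tendsto_atTop,
    hL'.comp hns.tendsto_atTop⟩

lemma IsTestLimit.ae_eq_zero (h : IsTestLimit U w H) :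
    ∀ᵐ x, x ∉ U → w x = 0 := by
  obtain ⟨-, -, ψ, hψ, hae, -⟩ := h
  filter_upwards [hae] with x hx hxU
  refine tendsto_nhds_unique hx ?_
  simp only [(hψ _).eq_zero hxU]
  exact tendsto_const_nhds

lemma tendsto_diffQuot (s : ℝ) {ψ : ℕ → Euc n → ℝ}
    (hae : ∀ᵐ x, Tendsto (fun k => ψ k x) atTop (𝓝 (w x))) :
    ∀ᵐ z : Euc n × Euc n, Tendsto (fun k => diffQuot s (ψ k) z) atTop (𝓝 (diffQuot s w z)) := by
  filter_upwards [Measure.quasiMeasurePreserving_fst.ae hae,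
    Measure.quasiMeasurePreserving_snd.ae hae] with z h1 h2
  exact (h1.sub h2).div_const _

/-- The Gagliardo seminorm bound for functions in `H¹₀(U)`. -/
lemma exists_eLpNorm_diffQuot_le (hn : 0 < n) {s : ℝ} (hs0 : 0 < s) (hs1 : s < 1) :
    ∃ C : ℝ≥0∞, C ≠ ⊤ ∧ ∀ (U : Set (Euc n)) w H, IsTestLimit U w H →
      eLpNorm (diffQuot s w) 2 volume ≤ C * (eLpNorm w 2 volume + eLpNorm H 2 volume) := by
  obtain ⟨C, hC, hle⟩ := exists_lintegral_diffQuot_le hn hs0 hs1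
  have hC' : C ^ (1 / 2 : ℝ) ≠ ⊤ := ENNReal.rpow_ne_top_of_nonneg (by norm_num) hC
  refine ⟨C ^ (1 / 2 : ℝ), hC', ?_⟩
  rintro U w H ⟨hw, hH, ψ, hψ, hae, hL, hG⟩
  refine eLpNorm_le_of_tendsto hC' (fun k => aestronglyMeasurable_diffQuot s
    ((hψ k).memLp 2 _).1) (tendsto_diffQuot s hae) (fun k => ((hψ k).memLp 2 _).1) hw.1
    (fun k => ((hψ k).memLp_gradient 2 _).1) hH.1 hL hG fun k => ?_
  have h1 := hle (ψ k) (hψ k).contDiff_one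
  simp_rw [← enorm_gradient] at h1
  rw [← eLpNorm_two_sq, ← eLpNorm_two_sq, ← eLpNorm_two_sq] at h1
  calc eLpNorm (diffQuot s (ψ k)) 2 volume
      = (eLpNorm (diffQuot s (ψ k)) 2 volume ^ 2) ^ (1 / 2 : ℝ) := by
        rw [← ENNReal.rpow_natCast, ← ENNReal.rpow_mul]; norm_num
    _ ≤ (C * (eLpNorm (ψ k) 2 volume + eLpNorm (gradient (ψ k)) 2 volume) ^ 2) ^ (1 / 2 : ℝ) := by
        refine ENNReal.rpow_le_rpow (h1.trans ?_) (by norm_num)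
        gcongr
        rw [add_sq]
        exact add_le_add le_self_add le_rfl
    _ = _ := by
        rw [ENNReal.mul_rpow_of_nonneg _ _ (by norm_num), ← ENNReal.rpow_natCast,
          ← ENNReal.rpow_mul]
        norm_num

lemma IsTestLimit.memLp_diffQuot (hn : 0 < n) {s : ℝ} (hs0 : 0 < s) (hs1 : s < 1)
    (h : IsTestLimit U w H) : MemLp (diffQuot s w) 2 volume := by
  obtain ⟨C, hC, hle⟩ := exists_eLpNorm_diffQuot_le hn hs0 hs1
  exact ⟨aestronglyMeasurable_diffQuot s h.1.1, (hle U w H h).trans_lt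
    (ENNReal.mul_lt_top hC.lt_top (ENNReal.add_lt_top.2 ⟨h.1.2, h.2.1.2⟩))⟩

lemma tendsto_eLpNorm_diffQuot_sub (hn : 0 < n) {s : ℝ} (hs0 : 0 < s) (hs1 : s < 1)
    {φ : ℕ → Euc n → ℝ} {K : ℕ → Euc n → Euc n} (hφ : ∀ k, IsTestLimit U (φ k) (K k))
    (h : IsTestLimit U w H)
    (hL : Tendsto (fun k => eLpNorm (fun x => φ k x - w x) 2 volume) atTop (𝓝 0))
    (hG : Tendsto (fun k => eLpNorm (fun x => K k x - H x) 2 volume) atTop (𝓝 0)) :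
    Tendsto (fun k => eLpNorm (fun z => diffQuot s (φ k) z - diffQuot s w z) 2 volume) atTop
      (𝓝 0) := by
  obtain ⟨C, hC, hle⟩ := exists_eLpNorm_diffQuot_le (n := n) hn hs0 hs1
  have h1 := ENNReal.Tendsto.const_mul (a := C) (hL.add hG) (Or.inr hC)
  rw [add_zero, mul_zero] at h1
  refine tendsto_of_tendsto_of_tendsto_of_le_of_le tendsto_const_nhds h1 (fun _ => bot_le)
    fun k => ?_
  refine le_trans (le_of_eq ?_) (hle U _ _ ((hφ k).sub h))
  congr 1
  ext z
  simp only [diffQuot]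
  ring

/-! ### Compositions with smooth functions -/

/-- Smooth functions of one variable that are bounded together with their derivative. -/
def IsBddSmooth (τ : ℝ → ℝ) : Prop :=
  ContDiff ℝ ∞ τ ∧ ∃ M, (∀ t, |τ t| ≤ M) ∧ ∀ t, |deriv τ t| ≤ M

lemma IsBddSmooth.continuous {τ : ℝ → ℝ} (h : IsBddSmooth τ) : Continuous τ := h.1.continuous

lemma IsBddSmooth.continuous_deriv {τ : ℝ → ℝ} (h : IsBddSmooth τ) : Continuous (deriv τ) :=
  h.1.continuous_deriv (by simp)

lemma IsBddSmooth.differentiable {τ : ℝ → ℝ} (h : IsBddSmooth τ) : Differentiable ℝ τ :=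
  h.1.differentiable (by simp)

lemma IsBddSmooth.exists_lipschitz {τ : ℝ → ℝ} (h : IsBddSmooth τ) :
    ∃ M, 0 ≤ M ∧ (∀ t, |τ t| ≤ M) ∧ (∀ t, |deriv τ t| ≤ M) ∧ ∀ t t', |τ t - τ t'| ≤ M * |t - t'| := by
  obtain ⟨M, hM, hM'⟩ := h.2
  refine ⟨M, (abs_nonneg _).trans (hM 0), hM, hM', fun t t' => ?_⟩
  exact Convex.norm_image_sub_le_of_norm_deriv_le (fun x _ => h.differentiable x)
    (fun x _ => hM' x) convex_univ (Set.mem_univ _) (Set.mem_univ _)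

/-- The gradient of `τ(a) χ(b)`, when `a` and `b` have gradients `A` and `B`. -/
noncomputable def prodGradient (τ χ : ℝ → ℝ) (a : Euc n → ℝ) (A : Euc n → Euc n) (b : Euc n → ℝ)
    (B : Euc n → Euc n) (x : Euc n) : Euc n :=
  (deriv τ (a x) * χ (b x)) • A x + (τ (a x) * deriv χ (b x)) • B x

lemma gradient_comp_mul_comp {τ χ : ℝ → ℝ} (hτ : IsBddSmooth τ) (hχ : IsBddSmooth χ)
    {a b : Euc n → ℝ} (ha : ContDiff ℝ 1 a) (hb : ContDiff ℝ 1 b) :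
    gradient (fun x => τ (a x) * χ (b x)) = prodGradient τ χ a (gradient a) b (gradient b) := by
  ext1 x
  have h1 : HasFDerivAt (fun x => τ (a x)) (deriv τ (a x) • fderiv ℝ a x) x :=
    (hτ.differentiable _).hasDerivAt.comp_hasFDerivAt x (ha.differentiable (by simp) x).hasFDerivAt
  have h2 : HasFDerivAt (fun x => χ (b x)) (deriv χ (b x) • fderiv ℝ b x) x :=
    (hχ.differentiable _).hasDerivAt.comp_hasFDerivAt x (hb.differentiable (by simp) x).hasFDerivAt
  rw [gradient, (h1.fun_mul h2).fderiv, prodGradient, gradient, gradient]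
  simp only [map_add, map_smul, smul_smul]
  rw [add_comm, mul_comm (χ (b x))]

lemma IsTest.comp_mul_comp {U : Set (Euc n)} {τ χ : ℝ → ℝ} (hτ : IsBddSmooth τ)
    (hχ : IsBddSmooth χ) (hχ0 : χ 0 = 0) {a b : Euc n → ℝ} (ha : IsTest U a) (hb : IsTest U b) :
    IsTest U (fun x => τ (a x) * χ (b x)) := by
  have hs : tsupport (fun x => τ (a x) * χ (b x)) ⊆ tsupport b := by
    refine closure_mono fun x hx hbx => hx ?_
    simp [hbx, hχ0]
  exact ⟨(hτ.1.comp ha.1).mul (hχ.1.comp hb.1),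
    hb.2.1.isCompact.of_isClosed_subset (isClosed_tsupport _) hs, hs.trans hb.2.2⟩

section Convergence

variable {τ χ : ℝ → ℝ} {a : ℕ → Euc n → ℝ} {A : ℕ → Euc n → Euc n}
  {b : ℕ → Euc n → ℝ} {B : ℕ → Euc n → Euc n} {w w' : Euc n → ℝ} {H H' : Euc n → Euc n}

/-- Convergence in `L²` of `τ(aₖ) χ(bₖ)`. The first factor only needs almost everywhere convergence,
which is what allows the two arguments to be approximated one after the other. -/
lemma tendsto_comp_mul_comp (hτ : IsBddSmooth τ) (hχ : IsBddSmooth χ) (hχ0 : χ 0 = 0)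
    (ha : ∀ k, AEStronglyMeasurable (a k) volume)
    (haw : ∀ᵐ x, Tendsto (fun k => a k x) atTop (𝓝 (w x)))
    (hb : ∀ k, AEStronglyMeasurable (b k) volume) (hw' : MemLp w' 2 volume)
    (hbL : Tendsto (fun k => eLpNorm (fun x => b k x - w' x) 2 volume) atTop (𝓝 0)) :
    Tendsto (fun k => eLpNorm (fun x => τ (a k x) * χ (b k x) - τ (w x) * χ (w' x)) 2 volume) atTop
      (𝓝 0) := by
  obtain ⟨M, -, hM, -⟩ := hτ.exists_lipschitz
  obtain ⟨L, hL0, hL, -, hLip⟩ := hχ.exists_lipschitz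
  refine tendsto_eLpNorm_smul_sub (c := fun k x => τ (a k x)) (A := fun k x => χ (b k x))
    (fun k => hτ.continuous.comp_aestronglyMeasurable (ha k)) (fun k x => hM _) ?_
    (fun k => hχ.continuous.comp_aestronglyMeasurable (hb k)) ?_ ?_
  · filter_upwards [haw] with x hx
    exact (hτ.continuous.tendsto _).comp hx
  · refine hw'.of_le_mul (c := L) (hχ.continuous.comp_aestronglyMeasurable hw'.1)
      (Eventually.of_forall fun x => ?_)
    simpa [hχ0] using hLip (w' x) 0
  · have h2 := ENNReal.Tendsto.const_mul (a := ENNReal.ofReal L) hbL (Or.inr ENNReal.ofReal_ne_top)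
    rw [mul_zero] at h2
    refine tendsto_of_tendsto_of_tendsto_of_le_of_le tendsto_const_nhds h2 (fun _ => bot_le)
      fun k => ?_
    exact eLpNorm_le_mul_eLpNorm_of_ae_le_mul (Eventually.of_forall fun x => hLip _ _) 2

lemma tendsto_prodGradient (hτ : IsBddSmooth τ) (hχ : IsBddSmooth χ)
    (ha : ∀ k, AEStronglyMeasurable (a k) volume)
    (haw : ∀ᵐ x, Tendsto (fun k => a k x) atTop (𝓝 (w x)))
    (hA : ∀ k, AEStronglyMeasurable (A k) volume) (hH : MemLp H 2 volume)
    (hAL : Tendsto (fun k => eLpNorm (fun x => A k x - H x) 2 volume) atTop (𝓝 0))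
    (hb : ∀ k, AEStronglyMeasurable (b k) volume)
    (hbw : ∀ᵐ x, Tendsto (fun k => b k x) atTop (𝓝 (w' x)))
    (hB : ∀ k, AEStronglyMeasurable (B k) volume) (hH' : MemLp H' 2 volume)
    (hBL : Tendsto (fun k => eLpNorm (fun x => B k x - H' x) 2 volume) atTop (𝓝 0)) :
    Tendsto (fun k => eLpNorm (fun x => prodGradient τ χ (a k) (A k) (b k) (B k) x -
      prodGradient τ χ w H w' H' x) 2 volume) atTop (𝓝 0) := by
  obtain ⟨M, hM0, hM, hM', -⟩ := hτ.exists_lipschitz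
  obtain ⟨L, hL0, hL, hL', -⟩ := hχ.exists_lipschitz
  have hw := aestronglyMeasurable_of_tendsto_ae atTop ha haw
  have hw' := aestronglyMeasurable_of_tendsto_ae atTop hb hbw
  have hm1 : ∀ k, AEStronglyMeasurable (fun x => deriv τ (a k x) * χ (b k x)) volume := fun k =>
    (hτ.continuous_deriv.comp_aestronglyMeasurable (ha k)).mul
      (hχ.continuous.comp_aestronglyMeasurable (hb k))
  have hm2 : ∀ k, AEStronglyMeasurable (fun x => τ (a k x) * deriv χ (b k x)) volume := fun k =>
    (hτ.continuous.comp_aestronglyMeasurable (ha k)).mul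
      (hχ.continuous_deriv.comp_aestronglyMeasurable (hb k))
  have h1 : Tendsto (fun k => eLpNorm (fun x => (deriv τ (a k x) * χ (b k x)) • A k x -
      (deriv τ (w x) * χ (w' x)) • H x) 2 volume) atTop (𝓝 0) := by
    refine tendsto_eLpNorm_smul_sub (M := M * L) hm1 (fun k x => ?_) ?_ hA hH hAL
    · rw [abs_mul]
      exact mul_le_mul (hM' _) (hL _) (abs_nonneg _) hM0
    · filter_upwards [haw, hbw] with x hx hx'
      exact ((hτ.continuous_deriv.tendsto _).comp hx).mul ((hχ.continuous.tendsto _).comp hx')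
  have h2 : Tendsto (fun k => eLpNorm (fun x => (τ (a k x) * deriv χ (b k x)) • B k x -
      (τ (w x) * deriv χ (w' x)) • H' x) 2 volume) atTop (𝓝 0) := by
    refine tendsto_eLpNorm_smul_sub (M := M * L) hm2 (fun k x => ?_) ?_ hB hH' hBL
    · rw [abs_mul]
      exact mul_le_mul (hM _) (hL' _) (abs_nonneg _) hM0
    · filter_upwards [haw, hbw] with x hx hx'
      exact ((hτ.continuous.tendsto _).comp hx).mul ((hχ.continuous_deriv.tendsto _).comp hx')
  have h5 := h1.add h2
  rw [add_zero] at h5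
  have hm1' : AEStronglyMeasurable (fun x => deriv τ (w x) * χ (w' x)) volume :=
    (hτ.continuous_deriv.comp_aestronglyMeasurable hw).mul
      (hχ.continuous.comp_aestronglyMeasurable hw')
  have hm2' : AEStronglyMeasurable (fun x => τ (w x) * deriv χ (w' x)) volume :=
    (hτ.continuous.comp_aestronglyMeasurable hw).mul
      (hχ.continuous_deriv.comp_aestronglyMeasurable hw')
  refine tendsto_of_tendsto_of_tendsto_of_le_of_le tendsto_const_nhds h5 (fun _ => bot_le)
    fun k => ?_
  refine le_trans (le_of_eq ?_) (eLpNorm_add_le (((hm1 k).smul (hA k)).sub (hm1'.smul hH.1))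
    (((hm2 k).smul (hB k)).sub (hm2'.smul hH'.1)) (by norm_num))
  congr 1
  ext1 x
  simp only [Pi.add_apply, prodGradient]
  abel

end Convergence

section TestLimit

variable {U : Set (Euc n)} {τ χ : ℝ → ℝ} {w w' : Euc n → ℝ} {H H' : Euc n → Euc n}

/-- Products `τ(w) χ(w')` of functions in `H¹₀(U)`. No positivity or openness of `U` enters,
since a smooth function `τ(ψ) χ(ψ')` of test functions is again a test function. -/
lemma IsTestLimit.comp_mul_comp (hτ : IsBddSmooth τ) (hχ : IsBddSmooth χ) (hχ0 : χ 0 = 0)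
    (h : IsTestLimit U w H) (h' : IsTestLimit U w' H') :
    IsTestLimit U (fun x => τ (w x) * χ (w' x)) (prodGradient τ χ w H w' H') := by
  obtain ⟨hw, hH, ψ, hψ, hae, hL, hG⟩ := h
  obtain ⟨hw', hH', ψ', hψ', hae', hL', hG'⟩ := h'
  obtain ⟨M, hM0, hM, hM', -⟩ := hτ.exists_lipschitz
  obtain ⟨L, hL0, hLb, hLb', hLip⟩ := hχ.exists_lipschitz
  refine ⟨?_, ?_, fun k x => τ (ψ k x) * χ (ψ' k x),
    fun k => IsTest.comp_mul_comp hτ hχ hχ0 (hψ k) (hψ' k), ?_, ?_, ?_⟩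
  · refine hw'.of_le_mul (c := M * L) ((hτ.continuous.comp_aestronglyMeasurable hw.1).mul
      (hχ.continuous.comp_aestronglyMeasurable hw'.1)) (Eventually.of_forall fun x => ?_)
    rw [norm_mul, mul_assoc]
    refine mul_le_mul (hM _) ?_ (norm_nonneg _) hM0
    simpa [hχ0] using hLip (w' x) 0
  · refine MemLp.add ?_ ?_
    · refine hH.of_le_mul (c := M * L) (((hτ.continuous_deriv.comp_aestronglyMeasurable hw.1).mul
        (hχ.continuous.comp_aestronglyMeasurable hw'.1)).smul hH.1)
        (Eventually.of_forall fun x => ?_)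
      rw [norm_smul, norm_mul]
      gcongr
      · exact hM' _
      · exact hLb _
    · refine hH'.of_le_mul (c := M * L) (((hτ.continuous.comp_aestronglyMeasurable hw.1).mul
        (hχ.continuous_deriv.comp_aestronglyMeasurable hw'.1)).smul hH'.1)
        (Eventually.of_forall fun x => ?_)
      rw [norm_smul, norm_mul]
      gcongr
      · exact hM _
      · exact hLb' _
  · filter_upwards [hae, hae'] with x hx hx'
    exact ((hτ.continuous.tendsto _).comp hx).mul ((hχ.continuous.tendsto _).comp hx')
  · exact tendsto_comp_mul_comp hτ hχ hχ0 (fun k => ((hψ k).memLp 2 _).1) hae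
      (fun k => ((hψ' k).memLp 2 _).1) hw' hL'
  · have := tendsto_prodGradient hτ hχ (fun k => ((hψ k).memLp 2 _).1) hae
      (fun k => ((hψ k).memLp_gradient 2 _).1) hH hG (fun k => ((hψ' k).memLp 2 _).1) hae'
      (fun k => ((hψ' k).memLp_gradient 2 _).1) hH' hG'
    refine this.congr fun k => ?_
    rw [gradient_comp_mul_comp hτ hχ (hψ k).contDiff_one (hψ' k).contDiff_one]

/-- A cutoff function that vanishes near `0` and equals `1` away from `0`. -/
lemma exists_cutoff {c : ℝ} (hc : 0 < c) :
    ∃ χ : ℝ → ℝ, IsBddSmooth χ ∧ (∀ t, |t| ≤ c / 4 → χ t = 0) ∧ ∀ t, c / 2 ≤ |t| → χ t = 1 := by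
  let f : ContDiffBump (0 : ℝ) := ⟨c / 4, c / 2, by positivity, by linarith⟩
  have hsm : ContDiff ℝ ∞ (fun t => 1 - f t) := contDiff_const.sub f.contDiff
  obtain ⟨M, hM⟩ : ∃ M, ∀ t, ‖deriv (fun t => 1 - f t) t‖ ≤ M := by
    have hcs : HasCompactSupport (deriv f) := f.hasCompactSupport.deriv
    obtain ⟨M, hM⟩ := hcs.exists_bound_of_continuous (f.contDiff.continuous_deriv le_rfl)
    refine ⟨M, fun t => ?_⟩
    simpa [deriv_const_sub] using hM t
  refine ⟨fun t => 1 - f t, ⟨hsm, max 1 M, fun t => ?_, fun t => (hM t).trans (le_max_right _ _)⟩,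
    fun t ht => ?_, fun t ht => ?_⟩
  · refine le_trans ?_ (le_max_left _ _)
    rw [abs_le]
    constructor <;> linarith [f.nonneg (x := t), f.le_one (x := t)]
  · have : f t = 1 := f.one_of_mem_closedBall (by simpa using ht)
    simp [this]
  · have : f t = 0 := f.zero_of_le_dist (by simpa using ht)
    simp [this]

/-- Composition with a function that vanishes near `0`. -/
lemma IsTestLimit.comp (hτ : IsBddSmooth τ) {c : ℝ} (hc : 0 < c) (hτ0 : ∀ t, |t| < c → τ t = 0)
    (h : IsTestLimit U w H) :
    IsTestLimit U (fun x => τ (w x)) (fun x => deriv τ (w x) • H x) := by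
  have h1 : IsBddSmooth (fun _ => (1 : ℝ)) :=
    ⟨contDiff_const, 1, by simp, by simp⟩
  have h2 := IsTestLimit.comp_mul_comp h1 hτ (hτ0 0 (by simpa using hc)) h h
  have h3 : prodGradient (fun _ => (1 : ℝ)) τ w H w H = fun x => deriv τ (w x) • H x := by
    ext1 x
    simp [prodGradient]
  simpa [h3] using h2

end TestLimit

/-! ### Nonlinear test functions in the weak equation -/

lemma deriv_eq_zero_of_abs_lt {τ : ℝ → ℝ} {c : ℝ} (hτ0 : ∀ t, |t| < c → τ t = 0) {t : ℝ}
    (ht : |t| < c) : deriv τ t = 0 := by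
  have : τ =ᶠ[𝓝 t] fun _ => 0 := by
    filter_upwards [(isOpen_lt continuous_abs continuous_const).mem_nhds ht] with t' ht'
    exact hτ0 t' ht'
  rw [this.deriv_eq]; simp

lemma deriv_eq_zero_of_lt_abs {χ : ℝ → ℝ} {c a : ℝ} (hχ1 : ∀ t, c < |t| → χ t = a) {t : ℝ}
    (ht : c < |t|) : deriv χ t = 0 := by
  have : χ =ᶠ[𝓝 t] fun _ => a := by
    filter_upwards [(isOpen_lt continuous_const continuous_abs).mem_nhds ht] with t' ht'
    exact hχ1 t' ht'
  rw [this.deriv_eq]; simp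

/-- The energy form of `u` (with gradient `G`) and `φ` (with gradient `H`). -/
noncomputable def pairing (s : ℝ) (Ω : Set (Euc n)) (u : Euc n → ℝ) (G : Euc n → Euc n)
    (φ : Euc n → ℝ) (H : Euc n → Euc n) : ℝ :=
  (∫ x in Ω, inner ℝ (G x) (H x)) + ∫ z in crossSet Ω, diffQuot s u z * diffQuot s φ z

/-- The weak equation holds for the single test pair `(φ, H)`. -/
def WeakIdentity (s : ℝ) (Ω : Set (Euc n)) (g : ℝ → ℝ) (u : Euc n → ℝ) (G : Euc n → Euc n)
    (φ : Euc n → ℝ) (H : Euc n → Euc n) : Prop :=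
  IntegrableOn (fun x => g (u x) * φ x) Ω ∧ pairing s Ω u G φ H = ∫ x in Ω, g (u x) * φ x

lemma WeakEquation.weakIdentity {s : ℝ} {Ω N : Set (Euc n)} {g : ℝ → ℝ} {u : Euc n → ℝ}
    {G : Euc n → Euc n} (h : WeakEquation s Ω N g u G) {φ : Euc n → ℝ}
    (hφ : IsTest (fullSet Ω N) φ) : WeakIdentity s Ω g u G φ (gradient φ) := by
  obtain ⟨h1, h2⟩ := h φ hφ
  refine ⟨h1, ?_⟩
  rw [← h2, pairing, energyForm]
  simp_rw [diffQuot_mul_diffQuot]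

/-- `u` has finite energy on each region where `|w|` stays away from zero: there its gradient and
its difference quotient agree with square integrable functions. -/
def FiniteEnergyWhere (s : ℝ) (Ω : Set (Euc n)) (u : Euc n → ℝ) (G : Euc n → Euc n)
    (w : Euc n → ℝ) : Prop :=
  ∀ c > 0, ∃ (F : Euc n → Euc n) (f : Euc n × Euc n → ℝ), MemLp F 2 (volume.restrict Ω) ∧
    MemLp f 2 (volume.restrict (crossSet Ω)) ∧
    (∀ᵐ x ∂(volume.restrict Ω), c ≤ |w x| → F x = G x) ∧
    ∀ᵐ z ∂(volume.restrict (crossSet Ω)), (c ≤ |w z.1| ∨ c ≤ |w z.2|) → f z = diffQuot s u z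

section Testing

variable {s : ℝ} {Ω U : Set (Euc n)} {g : ℝ → ℝ} {u : Euc n → ℝ} {G : Euc n → Euc n}

/-- The pairing only sees the part of `u` where the test pair does not vanish. -/
lemma pairing_eq {φ : Euc n → ℝ} {H : Euc n → Euc n} {w : Euc n → ℝ} {c : ℝ}
    {F : Euc n → Euc n} {f : Euc n × Euc n → ℝ}
    (hF : ∀ᵐ x ∂(volume.restrict Ω), c ≤ |w x| → F x = G x)
    (hf : ∀ᵐ z ∂(volume.restrict (crossSet Ω)), (c ≤ |w z.1| ∨ c ≤ |w z.2|) → f z = diffQuot s u z)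
    (h0 : ∀ x, |w x| < c → φ x = 0 ∧ H x = 0) :
    pairing s Ω u G φ H =
      (∫ x in Ω, inner ℝ (F x) (H x)) + ∫ z in crossSet Ω, inner ℝ (f z) (diffQuot s φ z) := by
  rw [pairing]
  congr 1
  · refine integral_congr_ae ?_
    filter_upwards [hF] with x hx
    rcases lt_or_ge (|w x|) c with h | h
    · simp [(h0 x h).2]
    · rw [hx h]
  · refine integral_congr_ae ?_
    filter_upwards [hf] with z hz
    by_cases h : c ≤ |w z.1| ∨ c ≤ |w z.2|
    · rw [hz h]
      simp [mul_comm]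
    · push Not at h
      simp [diffQuot, (h0 _ h.1).1, (h0 _ h.2).1]

/-- The weak identity passes to `H¹₀` limits of test pairs, as long as all of them vanish on a common
set `{|w| < c}` outside of which `u` has finite energy, and the right-hand sides are dominated. -/
lemma weakIdentity_of_tendsto (hn : 0 < n) (hs0 : 0 < s) (hs1 : s < 1)
    {φ : ℕ → Euc n → ℝ} {K : ℕ → Euc n → Euc n} {φ' : Euc n → ℝ} {K' : Euc n → Euc n}
    (hφ : ∀ k, IsTestLimit U (φ k) (K k)) (hφ' : IsTestLimit U φ' K')
    (hL : Tendsto (fun k => eLpNorm (fun x => φ k x - φ' x) 2 volume) atTop (𝓝 0))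
    (hG : Tendsto (fun k => eLpNorm (fun x => K k x - K' x) 2 volume) atTop (𝓝 0))
    (hae : ∀ᵐ x, Tendsto (fun k => φ k x) atTop (𝓝 (φ' x)))
    (hweak : ∀ k, WeakIdentity s Ω g u G (φ k) (K k)) {w : Euc n → ℝ}
    (hfin : FiniteEnergyWhere s Ω u G w) {c : ℝ} (hc : 0 < c)
    (h0 : ∀ k x, |w x| < c → φ k x = 0 ∧ K k x = 0) (h0' : ∀ x, |w x| < c → φ' x = 0 ∧ K' x = 0)
    {B : Euc n → ℝ} (hB : IntegrableOn B Ω)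
    (hdom : ∀ k, ∀ᵐ x ∂(volume.restrict Ω), ‖g (u x) * φ k x‖ ≤ B x) :
    WeakIdentity s Ω g u G φ' K' := by
  obtain ⟨F, f, hF, hf, hFG, hfu⟩ := hfin c hc
  have hlim : ∀ᵐ x ∂(volume.restrict Ω),
      Tendsto (fun k => g (u x) * φ k x) atTop (𝓝 (g (u x) * φ' x)) := by
    filter_upwards [ae_restrict_of_ae hae] with x hx
    exact hx.const_mul _
  have hmeas : AEStronglyMeasurable (fun x => g (u x) * φ' x) (volume.restrict Ω) :=
    aestronglyMeasurable_of_tendsto_ae atTop (fun k => (hweak k).1.1) hlim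
  have hdom' : ∀ᵐ x ∂(volume.restrict Ω), ‖g (u x) * φ' x‖ ≤ B x := by
    filter_upwards [hlim, ae_all_iff.2 hdom] with x hx hx'
    exact le_of_tendsto hx.norm (Eventually.of_forall hx')
  refine ⟨hB.mono' hmeas hdom', ?_⟩
  have h1 : Tendsto (fun k => ∫ x in Ω, g (u x) * φ k x) atTop (𝓝 (∫ x in Ω, g (u x) * φ' x)) :=
    tendsto_integral_of_dominated_convergence B (fun k => (hweak k).1.1) hB hdom hlim
  have hmono : ∀ {E : Type} [NormedAddCommGroup E] {X : Type} [MeasurableSpace X] {μ : Measure X}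
      (S : Set X) (v : ℕ → X → E), Tendsto (fun k => eLpNorm (v k) 2 μ) atTop (𝓝 0) →
      Tendsto (fun k => eLpNorm (v k) 2 (μ.restrict S)) atTop (𝓝 0) := by
    intro E _ X _ μ S v hv
    exact tendsto_of_tendsto_of_tendsto_of_le_of_le tendsto_const_nhds hv (fun _ => bot_le)
      fun k => eLpNorm_restrict_le _ _ _ _
  have h2 := (tendsto_integral_inner hF (fun k => (hφ k).2.1.restrict Ω) (hφ'.2.1.restrict Ω)
    (hmono Ω _ hG)).add (tendsto_integral_inner hf
      (fun k => ((hφ k).memLp_diffQuot hn hs0 hs1).restrict (crossSet Ω))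
      ((hφ'.memLp_diffQuot hn hs0 hs1).restrict (crossSet Ω))
      (hmono (crossSet Ω) _ (tendsto_eLpNorm_diffQuot_sub hn hs0 hs1 hφ hφ' hL hG)))
  rw [pairing_eq hFG hfu h0']
  refine tendsto_nhds_unique h2 (h1.congr fun k => ?_)
  rw [← (hweak k).2, pairing_eq hFG hfu (h0 k)]

variable {N : Set (Euc n)} {τ : ℝ → ℝ} {v : Euc n → ℝ} {H : Euc n → Euc n}

/-- Nonlinear test functions `τ(v)`, for `v` in `H¹₀` and `τ` vanishing near zero. The test
functions `τ(ψᵢ) χ(ψⱼ)`, with `ψᵢ → v`, are admissible; since `g(u) χ(ψⱼ)` is integrable,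
dominated convergence permits `i → ∞` for fixed `j`, and then `j → ∞`. -/
lemma weakIdentity_comp (hn : 0 < n) (hs0 : 0 < s) (hs1 : s < 1)
    (hweak : WeakEquation s Ω N g u G) (hv : IsTestLimit (fullSet Ω N) v H)
    (hfin : ∀ ψ, IsTest (fullSet Ω N) ψ → FiniteEnergyWhere s Ω u G ψ)
    (hfinv : FiniteEnergyWhere s Ω u G v) (hτ : IsBddSmooth τ) {c : ℝ} (hc : 0 < c)
    (hτ0 : ∀ t, |t| < c → τ t = 0) (hint : IntegrableOn (fun x => g (u x) * τ (v x)) Ω) :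
    WeakIdentity s Ω g u G (fun x => τ (v x)) (fun x => deriv τ (v x) • H x) := by
  obtain ⟨χ, hχ, hχ0, hχ1⟩ := exists_cutoff hc
  have hχz : χ 0 = 0 := hχ0 0 (by simp; positivity)
  have hχ0' : ∀ t, |t| < c / 4 → χ t = 0 := fun t ht => hχ0 t ht.le
  have hχ1' : ∀ t, c / 2 < |t| → χ t = 1 := fun t ht => hχ1 t ht.le
  obtain ⟨M, hM0, hM, -, -⟩ := hτ.exists_lipschitz
  obtain ⟨L, hL0, hL, -, -⟩ := hχ.exists_lipschitz
  have hv' := hv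
  obtain ⟨hvL, hH, ψ, hψ, hae, hLψ, hGψ⟩ := hv
  have hone : IsBddSmooth (fun _ => (1 : ℝ)) := ⟨contDiff_const, 1, by simp, by simp⟩
  -- for fixed `j` the limit `i → ∞` is dominated by a multiple of `g(u) χ(ψⱼ)`
  have hfirst : ∀ j, WeakIdentity s Ω g u G (fun x => τ (v x) * χ (ψ j x))
      (prodGradient τ χ v H (ψ j) (gradient (ψ j))) := by
    intro j
    have hint' := ((hweak _ (IsTest.comp_mul_comp hone hχ hχz (hψ j) (hψ j))).1.norm).const_mul M
    have hj := (hψ j).isTestLimit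
    refine weakIdentity_of_tendsto (φ := fun i x => τ (ψ i x) * χ (ψ j x))
      (K := fun i => prodGradient τ χ (ψ i) (gradient (ψ i)) (ψ j) (gradient (ψ j)))
      hn hs0 hs1 (fun i => (hψ i).isTestLimit.comp_mul_comp hτ hχ hχz hj)
      (hv'.comp_mul_comp hτ hχ hχz hj)
      (tendsto_comp_mul_comp hτ hχ hχz (fun k => ((hψ k).memLp 2 _).1) hae
        (fun k => ((hψ j).memLp 2 _).1) ((hψ j).memLp 2 _) (by simp))
      (tendsto_prodGradient hτ hχ (fun k => ((hψ k).memLp 2 _).1) hae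
        (fun k => ((hψ k).memLp_gradient 2 _).1) hH hGψ (fun k => ((hψ j).memLp 2 _).1)
        (Eventually.of_forall fun _ => tendsto_const_nhds)
        (fun k => ((hψ j).memLp_gradient 2 _).1) ((hψ j).memLp_gradient 2 _) (by simp))
      ?_ (fun i => ?_) (hfin (ψ j) (hψ j)) (c := c / 4) (by positivity) ?_ ?_ hint' ?_
    · filter_upwards [hae] with x hx
      exact ((hτ.continuous.tendsto _).comp hx).mul_const _
    · have := hweak.weakIdentity (IsTest.comp_mul_comp hτ hχ hχz (hψ i) (hψ j))
      rwa [gradient_comp_mul_comp hτ hχ (hψ i).contDiff_one (hψ j).contDiff_one] at this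
    · intro k x hx
      simp [prodGradient, hχ0' _ hx, deriv_eq_zero_of_abs_lt hχ0' hx]
    · intro x hx
      simp [prodGradient, hχ0' _ hx, deriv_eq_zero_of_abs_lt hχ0' hx]
    · intro k
      refine Eventually.of_forall fun x => ?_
      rw [one_mul, norm_mul, norm_mul, norm_mul, mul_left_comm]
      exact mul_le_mul_of_nonneg_right (hM _) (by positivity)
  have hprod : (fun x => τ (v x) * χ (v x)) = fun x => τ (v x) := by
    ext x
    rcases lt_or_ge (|v x|) c with h | h
    · simp [hτ0 _ h]
    · rw [hχ1 _ (by linarith), mul_one]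
  have hgrad : prodGradient τ χ v H v H = fun x => deriv τ (v x) • H x := by
    ext1 x
    rw [prodGradient]
    rcases lt_or_ge (|v x|) c with h | h
    · simp [hτ0 _ h, deriv_eq_zero_of_abs_lt hτ0 h]
    · rw [hχ1 _ (by linarith), deriv_eq_zero_of_lt_abs hχ1' (by linarith)]
      simp
  rw [← hprod, ← hgrad]
  refine weakIdentity_of_tendsto (φ := fun j x => τ (v x) * χ (ψ j x))
      (K := fun j => prodGradient τ χ v H (ψ j) (gradient (ψ j)))
      hn hs0 hs1 (fun j => hv'.comp_mul_comp hτ hχ hχz (hψ j).isTestLimit)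
      (hv'.comp_mul_comp hτ hχ hχz hv')
      (tendsto_comp_mul_comp hτ hχ hχz (fun k => hvL.1)
        (Eventually.of_forall fun _ => tendsto_const_nhds)
        (fun k => ((hψ k).memLp 2 _).1) hvL hLψ)
      (tendsto_prodGradient hτ hχ (fun k => hvL.1)
        (Eventually.of_forall fun _ => tendsto_const_nhds) (fun k => hH.1) hH (by simp)
        (fun k => ((hψ k).memLp 2 _).1) hae (fun k => ((hψ k).memLp_gradient 2 _).1) hH hGψ)
      ?_ hfirst hfinv hc ?_ ?_ (hint.norm.const_mul L) ?_
  · filter_upwards [hae] with x hx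
    exact ((hχ.continuous.tendsto _).comp hx).const_mul _
  · intro k x hx
    simp [prodGradient, hτ0 _ hx, deriv_eq_zero_of_abs_lt hτ0 hx]
  · intro x hx
    simp [prodGradient, hτ0 _ hx, deriv_eq_zero_of_abs_lt hτ0 hx]
  · intro k
    refine Eventually.of_forall fun x => ?_
    rw [← mul_assoc, norm_mul, mul_comm]
    exact mul_le_mul_of_nonneg_right (hL _) (norm_nonneg _)

end Testing

/-! ### The chain rule for weak derivatives on the whole space -/

/-- Almost everywhere convergence together with a bound of the `L¹` norms by that of the limit
implies `L¹` convergence, by Fatou's lemma for `‖fₖ‖ + ‖f‖ - ‖fₖ - f‖`. -/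
lemma tendsto_lintegral_enorm_sub {α : Type*} [MeasurableSpace α] {μ : Measure α}
    {f : ℕ → α → ℝ} {f' : α → ℝ} (hf : ∀ k, AEStronglyMeasurable (f k) μ)
    (hf' : Integrable f' μ) (hae : ∀ᵐ x ∂μ, Tendsto (fun k => f k x) atTop (𝓝 (f' x)))
    (hle : ∀ k, ∫⁻ x, ‖f k x‖ₑ ∂μ ≤ ∫⁻ x, ‖f' x‖ₑ ∂μ) :
    Tendsto (fun k => ∫⁻ x, ‖f k x - f' x‖ₑ ∂μ) atTop (𝓝 0) := by
  set I := ∫⁻ x, ‖f' x‖ₑ ∂μ with hI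
  have hIfin : I ≠ ⊤ := hf'.2.ne
  let D : ℕ → α → ℝ≥0∞ := fun k x => ‖f k x‖ₑ + ‖f' x‖ₑ - ‖f k x - f' x‖ₑ
  have hDm : ∀ k, AEMeasurable (D k) μ := fun k =>
    ((hf k).enorm.add hf'.1.enorm).sub ((hf k).sub hf'.1).enorm
  have hsplit : ∀ k, ∫⁻ x, D k x ∂μ + ∫⁻ x, ‖f k x - f' x‖ₑ ∂μ ≤ 2 * I := by
    intro k
    rw [← lintegral_add_left' (hDm k)]
    calc _ = ∫⁻ x, (‖f k x‖ₑ + ‖f' x‖ₑ) ∂μ := by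
          refine lintegral_congr fun x => ?_
          exact tsub_add_cancel_of_le enorm_sub_le
      _ ≤ 2 * I := by
          rw [lintegral_add_left' (hf k).enorm, two_mul]
          gcongr
          exact hle k
  have hD : Tendsto (fun k => ∫⁻ x, D k x ∂μ) atTop (𝓝 (2 * I)) := by
    refine tendsto_of_le_liminf_of_limsup_le ?_ ?_
    · calc 2 * I = ∫⁻ x, liminf (fun k => D k x) atTop ∂μ := by
            rw [hI, ← lintegral_const_mul'' _ hf'.1.enorm]
            refine lintegral_congr_ae ?_
            filter_upwards [hae] with x hx
            have h1 : Tendsto (fun k => D k x) atTop (𝓝 (‖f' x‖ₑ + ‖f' x‖ₑ - ‖f' x - f' x‖ₑ)) := by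
              refine ENNReal.Tendsto.sub (hx.enorm.add tendsto_const_nhds)
                (hx.sub tendsto_const_nhds).enorm (Or.inr ?_)
              exact enorm_ne_top
            rw [h1.liminf_eq]
            simp [two_mul]
        _ ≤ _ := lintegral_liminf_le' hDm
    · refine (limsup_le_limsup (Eventually.of_forall fun k => ?_)).trans_eq
        (limsup_const (2 * I))
      exact le_self_add.trans (hsplit k)
  have h2I : 2 * I ≠ ⊤ := ENNReal.mul_ne_top (by simp) hIfin
  have h3 : Tendsto (fun k => 2 * I - ∫⁻ x, D k x ∂μ) atTop (𝓝 (2 * I - 2 * I)) :=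
    ENNReal.Tendsto.sub tendsto_const_nhds hD (Or.inr h2I)
  rw [tsub_self] at h3
  refine tendsto_of_tendsto_of_tendsto_of_le_of_le tendsto_const_nhds h3 (fun _ => bot_le)
    fun k => ?_
  refine ENNReal.le_sub_of_add_le_left ?_ (hsplit k)
  exact ne_top_of_le_ne_top h2I (le_self_add.trans (hsplit k))

/-- Mollification: a function with an integrable weak derivative in direction `e` is an almost
everywhere limit of `C¹` functions whose derivatives in direction `e` converge in `L¹`. -/
lemma exists_mollification {w h : Euc n → ℝ} (hw : Integrable w) (hh : Integrable h) (e : Euc n)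
    (hwh : ∀ ξ, IsTest Set.univ ξ → ∫ x, w x * fderiv ℝ ξ x e = - ∫ x, ξ x * h x) :
    ∃ f : ℕ → Euc n → ℝ, (∀ k, ContDiff ℝ 1 (f k)) ∧
      (∀ᵐ x, Tendsto (fun k => f k x) atTop (𝓝 (w x))) ∧
      Tendsto (fun k => ∫⁻ x, ‖fderiv ℝ (f k) x e - h x‖ₑ) atTop (𝓝 0) := by
  let ρ : ℕ → ContDiffBump (0 : Euc n) := fun k =>
    ⟨1 / ((k : ℝ) + 1), 2 / ((k : ℝ) + 1), by positivity, by gcongr; norm_num⟩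
  have hρ0 : Tendsto (fun k => (ρ k).rOut) atTop (𝓝 0) := by
    have := (tendsto_one_div_add_atTop_nhds_zero_nat (𝕜 := ℝ)).const_mul 2
    simpa [ρ, div_eq_mul_inv] using this
  have hρK : ∀ᶠ k in atTop, (ρ k).rOut ≤ 2 * (ρ k).rIn := by
    refine Eventually.of_forall fun k => ?_
    simp only [ρ]
    exact le_of_eq (by ring)
  let r : ℕ → Euc n → ℝ := fun k => (ρ k).normed volume
  have hr : ∀ k, ContDiff ℝ ∞ (r k) := fun k => (ρ k).contDiff_normed
  have hrc : ∀ k, HasCompactSupport (r k) := fun k => (ρ k).hasCompactSupport_normed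
  have hr0 : ∀ k x, 0 ≤ r k x := fun k x => (ρ k).nonneg_normed x
  have hr1 : ∀ k, ∫ x, r k x = 1 := fun k => (ρ k).integral_normed
  have hconv : ∀ {g : Euc n → ℝ}, Integrable g → ∀ᵐ x, Tendsto (fun k =>
      (convolution g (r k) (ContinuousLinearMap.mul ℝ ℝ) volume) x) atTop (𝓝 (g x)) := by
    intro g hg
    filter_upwards [ContDiffBump.ae_convolution_tendsto_right_of_locallyIntegrable (μ := volume)
      hρ0 hρK hg.locallyIntegrable] with x hx
    refine hx.congr fun k => ?_
    rw [convolution_eq_swap, convolution_def]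
    refine integral_congr_ae (Eventually.of_forall fun t => ?_)
    simp [r, mul_comm]
  let f : ℕ → Euc n → ℝ := fun k => convolution w (r k) (ContinuousLinearMap.mul ℝ ℝ) volume
  have hderiv : ∀ k x, fderiv ℝ (f k) x e =
      convolution h (r k) (ContinuousLinearMap.mul ℝ ℝ) volume x := by
    intro k x
    have h1 := (hrc k).hasFDerivAt_convolution_right (ContinuousLinearMap.mul ℝ ℝ)
      hw.locallyIntegrable ((hr k).of_le (by simp)) x
    rw [h1.fderiv, convolution_precompR_apply _ hw.locallyIntegrable ((hrc k).fderiv ℝ)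
      ((hr k).continuous_fderiv (by simp)), convolution_def, convolution_def]
    simp only [ContinuousLinearMap.mul_apply']
    have hξ : IsTest Set.univ (fun y => r k (x - y)) := by
      refine ⟨(hr k).comp (contDiff_const.sub contDiff_id), ?_, Set.subset_univ _⟩
      exact (hrc k).comp_homeomorph (Homeomorph.subLeft x)
    have h2 := hwh _ hξ
    have h3 : ∀ y, fderiv ℝ (fun y => r k (x - y)) y e = - fderiv ℝ (r k) (x - y) e := by
      intro y
      have h4 : HasFDerivAt (fun y => x - y) (-ContinuousLinearMap.id ℝ (Euc n)) y :=
        (hasFDerivAt_id y).const_sub x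
      have h5 := (((hr k).differentiable (by simp)) (x - y)).hasFDerivAt.comp y h4
      have h6 : HasFDerivAt (fun y => r k (x - y))
        ((fderiv ℝ (r k) (x - y)).comp (-ContinuousLinearMap.id ℝ (Euc n))) y := h5
      rw [h6.fderiv]
      simp
    simp_rw [h3, mul_neg] at h2
    rw [integral_neg, neg_inj] at h2
    rw [h2]
    refine integral_congr_ae (Eventually.of_forall fun t => ?_)
    exact mul_comm _ _
  refine ⟨f, fun k => ?_, hconv hw, ?_⟩
  · exact (hrc k).contDiff_convolution_right (n := 1) _ hw.locallyIntegrable ((hr k).of_le (by simp))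
  · simp_rw [hderiv]
    refine tendsto_lintegral_enorm_sub (fun k => ?_) hh (hconv hh) fun k => ?_
    · exact ((hrc k).continuous_convolution_right _ hh.locallyIntegrable
        (hr k).continuous).aestronglyMeasurable
    · have hm : AEMeasurable (fun p : Euc n × Euc n => ‖h p.2 * r k (p.1 - p.2)‖ₑ)
          (volume.prod volume) :=
        (hh.1.convolution_integrand (ContinuousLinearMap.mul ℝ ℝ)
          (hr k).continuous.aestronglyMeasurable).enorm
      calc ∫⁻ x, ‖convolution h (r k) (ContinuousLinearMap.mul ℝ ℝ) volume x‖ₑ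
          ≤ ∫⁻ x, ∫⁻ t, ‖h t * r k (x - t)‖ₑ := lintegral_mono fun x => by
            rw [convolution_def]
            exact enorm_integral_le_lintegral_enorm _
        _ = ∫⁻ t, ∫⁻ x, ‖h t * r k (x - t)‖ₑ := lintegral_lintegral_swap hm
        _ = ∫⁻ t, ‖h t‖ₑ := by
            refine lintegral_congr fun t => ?_
            simp_rw [enorm_mul]
            rw [lintegral_const_mul' _ _ enorm_ne_top,
              lintegral_sub_right_eq_self (fun x => ‖r k x‖ₑ) t]
            have h7 : ∫⁻ x, ‖r k x‖ₑ = 1 := by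
              have h8 := ofReal_integral_eq_lintegral_ofReal (μ := volume) (f := r k)
                ((hr k).continuous.integrable_of_hasCompactSupport (hrc k))
                (Eventually.of_forall (hr0 k))
              rw [hr1 k, ENNReal.ofReal_one] at h8
              rw [h8]
              refine lintegral_congr fun x => ?_
              rw [Real.enorm_of_nonneg (hr0 k x)]
            rw [h7, mul_one]

/-- The chain rule for the weak derivative of an integrable function on the whole space. -/
lemma integral_comp_mul_fderiv {w h : Euc n → ℝ} (hw : Integrable w) (hh : Integrable h) (e : Euc n)
    (hwh : ∀ ξ, IsTest Set.univ ξ → ∫ x, w x * fderiv ℝ ξ x e = - ∫ x, ξ x * h x)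
    {θ : ℝ → ℝ} (hθ : IsBddSmooth θ) {φ : Euc n → ℝ} (hφ : IsTest Set.univ φ) :
    ∫ x, θ (w x) * fderiv ℝ φ x e = - ∫ x, φ x * (deriv θ (w x) * h x) := by
  obtain ⟨f, hf, hfw, hfh⟩ := exists_mollification hw hh e hwh
  obtain ⟨M, hM0, hM, hM', -⟩ := hθ.exists_lipschitz
  have hφd : Continuous (fun x => fderiv ℝ φ x e) :=
    (hφ.contDiff_one.continuous_fderiv (by simp)).clm_apply continuous_const
  have hφdc : HasCompactSupport (fun x => fderiv ℝ φ x e) := by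
    have := (hφ.2.1.fderiv ℝ).comp_left (g := fun L : Euc n →L[ℝ] ℝ => L e) (by simp)
    exact this
  obtain ⟨Bφ, hBφ⟩ := hφ.2.1.exists_bound_of_continuous hφ.1.continuous
  have hfd : ∀ k, Continuous (fun x => fderiv ℝ (f k) x e) := fun k =>
    ((hf k).continuous_fderiv (by simp)).clm_apply continuous_const
  have hparts : ∀ k, ∫ x, θ (f k x) * fderiv ℝ φ x e =
      - ∫ x, (φ x * deriv θ (f k x)) * fderiv ℝ (f k) x e := by
    intro k
    have hcomp : ∀ x, HasFDerivAt (fun x => θ (f k x)) (deriv θ (f k x) • fderiv ℝ (f k) x) x :=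
      fun x => (hθ.differentiable _).hasDerivAt.comp_hasFDerivAt x
        ((hf k).differentiable (by simp) x).hasFDerivAt
    have hθf : Continuous (fun x => θ (f k x)) := hθ.continuous.comp (hf k).continuous
    have hθf' : Continuous (fun x => deriv θ (f k x)) := hθ.continuous_deriv.comp (hf k).continuous
    have h1 := integral_mul_fderiv_eq_neg_fderiv_mul_of_integrable (μ := volume)
      (f := fun x => θ (f k x)) (g := φ) (v := e) ?_ ?_ ?_ (fun x _ => (hcomp x).differentiableAt)
      (fun x _ => hφ.contDiff_one.differentiable (by simp) x)
    · rw [h1]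
      congr 1
      refine integral_congr_ae (Eventually.of_forall fun x => ?_)
      simp only [(hcomp x).fderiv, smul_apply, smul_eq_mul]
      ring
    · simp_rw [(hcomp _).fderiv, smul_apply, smul_eq_mul]
      exact ((hθf'.mul (hfd k)).mul hφ.1.continuous).integrable_of_hasCompactSupport
        hφ.2.1.mul_left
    · exact (hθf.mul hφd).integrable_of_hasCompactSupport hφdc.mul_left
    · exact (hθf.mul hφ.1.continuous).integrable_of_hasCompactSupport hφ.2.1.mul_left
  have hlim1 : Tendsto (fun k => ∫ x, θ (f k x) * fderiv ℝ φ x e) atTop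
      (𝓝 (∫ x, θ (w x) * fderiv ℝ φ x e)) := by
    refine tendsto_integral_of_dominated_convergence (fun x => M * ‖fderiv ℝ φ x e‖) (fun k => ?_)
      ((hφd.integrable_of_hasCompactSupport hφdc).norm.const_mul M) (fun k => ?_) ?_
    · exact ((hθ.continuous.comp (hf k).continuous).mul hφd).aestronglyMeasurable
    · refine Eventually.of_forall fun x => ?_
      rw [norm_mul]
      exact mul_le_mul_of_nonneg_right (hM _) (norm_nonneg _)
    · filter_upwards [hfw] with x hx
      exact ((hθ.continuous.tendsto _).comp hx).mul_const _
  have hcoef : ∀ k x, ‖φ x * deriv θ (f k x)‖ ≤ Bφ * M := fun k x => by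
    rw [norm_mul]
    exact mul_le_mul (hBφ x) (hM' _) (norm_nonneg _) ((norm_nonneg _).trans (hBφ x))
  have hcoefm : ∀ k, Continuous (fun x => φ x * deriv θ (f k x)) := fun k =>
    hφ.1.continuous.mul (hθ.continuous_deriv.comp (hf k).continuous)
  have hdint : ∀ k, ∫⁻ x, ‖fderiv ℝ (f k) x e - h x‖ₑ ≠ ⊤ →
      Integrable (fun x => fderiv ℝ (f k) x e - h x) := fun k hk =>
    ⟨(hfd k).aestronglyMeasurable.sub hh.1, lt_top_iff_ne_top.2 hk⟩
  have hev : ∀ᶠ k in atTop, Integrable (fun x => fderiv ℝ (f k) x e - h x) := by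
    filter_upwards [hfh.eventually_lt_const (by simp : (0 : ℝ≥0∞) < 1)] with k hk
    exact hdint k (hk.trans_le le_top).ne
  have hlim2 : Tendsto (fun k => ∫ x, (φ x * deriv θ (f k x)) * h x) atTop
      (𝓝 (∫ x, (φ x * deriv θ (w x)) * h x)) := by
    refine tendsto_integral_of_dominated_convergence (fun x => Bφ * M * ‖h x‖) (fun k => ?_)
      (hh.norm.const_mul _) (fun k => ?_) ?_
    · exact (hcoefm k).aestronglyMeasurable.mul hh.1
    · refine Eventually.of_forall fun x => ?_
      rw [norm_mul]
      exact mul_le_mul_of_nonneg_right (hcoef k x) (norm_nonneg _)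
    · filter_upwards [hfw] with x hx
      exact (((hθ.continuous_deriv.tendsto _).comp hx).const_mul _).mul_const _
  have hlim3 : Tendsto (fun k => ∫ x, (φ x * deriv θ (f k x)) * (fderiv ℝ (f k) x e - h x)) atTop
      (𝓝 0) := by
    have hbd : ∀ k, ∀ᵐ x, ‖φ x * deriv θ (f k x)‖ ≤ Bφ * M := fun k =>
      Eventually.of_forall (hcoef k)
    have h6 := ENNReal.Tendsto.const_mul (a := ENNReal.ofReal (Bφ * M)) hfh
      (Or.inr ENNReal.ofReal_ne_top)
    rw [mul_zero] at h6
    have h7 := tendsto_integral_of_L1 (μ := volume) (l := atTop)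
      (F := fun k x => (φ x * deriv θ (f k x)) * (fderiv ℝ (f k) x e - h x)) (fun _ => (0 : ℝ))
      aestronglyMeasurable_const ?_ ?_
    · simpa using h7
    · filter_upwards [hev] with k hk
      exact hk.bdd_mul (hcoefm k).aestronglyMeasurable (hbd k)
    · refine tendsto_of_tendsto_of_tendsto_of_le_of_le tendsto_const_nhds h6 (fun _ => bot_le)
        fun k => ?_
      simp only [sub_zero]
      rw [← lintegral_const_mul' _ _ ENNReal.ofReal_ne_top]
      refine lintegral_mono fun x => ?_
      rw [enorm_mul]
      gcongr
      rw [← ofReal_norm]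
      exact ENNReal.ofReal_le_ofReal (hcoef k x)
  have hlim4 : Tendsto (fun k => ∫ x, (φ x * deriv θ (f k x)) * fderiv ℝ (f k) x e) atTop
      (𝓝 (∫ x, (φ x * deriv θ (w x)) * h x)) := by
    have h5 := hlim3.add hlim2
    rw [zero_add] at h5
    refine h5.congr' ?_
    filter_upwards [hev] with k hk
    have hbd : ∀ᵐ x, ‖φ x * deriv θ (f k x)‖ ≤ Bφ * M := Eventually.of_forall (hcoef k)
    rw [← integral_add (hk.bdd_mul (hcoefm k).aestronglyMeasurable hbd)
      (hh.bdd_mul (hcoefm k).aestronglyMeasurable hbd)]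
    refine integral_congr_ae (Eventually.of_forall fun x => ?_)
    simp only
    ring
  refine tendsto_nhds_unique hlim1 ((hlim4.neg.congr fun k => (hparts k).symm).trans_eq ?_)
  simp_rw [mul_assoc]

/-! ### The chain rule for weak gradients on open sets -/

section WeakGradient

variable {F : Type*} [NormedAddCommGroup F] [NormedSpace ℝ F]

lemma integrable_smul_of_locallyIntegrableOn {O K : Set (Euc n)} {f : Euc n → F} {φ : Euc n → ℝ}
    (hf : LocallyIntegrableOn f O) (hφ : Continuous φ) (hK : IsCompact K) (hKO : K ⊆ O)
    (h0 : ∀ x ∉ K, φ x = 0) : Integrable (fun x => φ x • f x) := by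
  have h1 : IntegrableOn (fun x => φ x • f x) K :=
    (hf.integrableOn_compact_subset hKO hK).continuousOn_smul hφ.continuousOn hK
  refine (integrableOn_iff_integrable_of_support_subset fun x hx => ?_).1 h1
  by_contra hxK
  exact hx (by simp [h0 x hxK])

lemma integrable_smul_of_locallyIntegrableOn_left {O K : Set (Euc n)} {f : Euc n → ℝ} {φ : Euc n → F}
    (hf : LocallyIntegrableOn f O) (hφ : Continuous φ) (hK : IsCompact K) (hKO : K ⊆ O)
    (h0 : ∀ x ∉ K, φ x = 0) : Integrable (fun x => f x • φ x) := by
  have h1 : IntegrableOn (fun x => f x • φ x) K :=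
    (hf.integrableOn_compact_subset hKO hK).smul_continuousOn hφ.continuousOn hK
  refine (integrableOn_iff_integrable_of_support_subset fun x hx => ?_).1 h1
  by_contra hxK
  exact hx (by simp [h0 x hxK])

lemma inner_gradient_right (φ : Euc n → ℝ) (x e : Euc n) :
    inner ℝ e (gradient φ x) = fderiv ℝ φ x e := by
  rw [real_inner_comm, inner_gradient]

/-- The defining identity of the weak gradient in direction `e`. -/
lemma HasWeakGradient.integral_mul_fderiv {O : Set (Euc n)} {u : Euc n → ℝ} {G : Euc n → Euc n}
    (h : HasWeakGradient O u G) {φ : Euc n → ℝ} (hφ : IsTest O φ) (e : Euc n) :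
    ∫ x, u x * fderiv ℝ φ x e = - ∫ x, φ x * inner ℝ e (G x) := by
  obtain ⟨hu, hG, hint⟩ := h
  have h1 := hint φ hφ
  have hi1 : Integrable (fun x => u x • gradient φ x) :=
    integrable_smul_of_locallyIntegrableOn_left hu (continuous_gradient hφ.contDiff_one)
      hφ.2.1.isCompact hφ.2.2 fun x hx => gradient_eq_zero_of_notMem_tsupport hx
  have hi2 : Integrable (fun x => φ x • G x) :=
    integrable_smul_of_locallyIntegrableOn hG hφ.1.continuous
      hφ.2.1.isCompact hφ.2.2 fun x hx => image_eq_zero_of_notMem_tsupport hx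
  rw [setIntegral_eq_integral_of_forall_compl_eq_zero fun x hx => by
      simp [hφ.gradient_eq_zero hx],
    setIntegral_eq_integral_of_forall_compl_eq_zero fun x hx => by simp [hφ.eq_zero hx]] at h1
  have h2 := congrArg (fun y => inner ℝ e y) h1
  simp only [inner_neg_right] at h2
  rw [← integral_inner hi1, ← integral_inner hi2] at h2
  simpa only [inner_smul_right, inner_gradient_right] using h2

/-- The limit `H` of the gradients of test functions is a weak gradient of the limit. -/
lemma IsTestLimit.integral_mul_fderiv {U : Set (Euc n)} {w : Euc n → ℝ} {H : Euc n → Euc n}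
    (h : IsTestLimit U w H) {φ : Euc n → ℝ} (hφ : IsTest Set.univ φ) (e : Euc n) :
    ∫ x, w x * fderiv ℝ φ x e = - ∫ x, φ x * inner ℝ e (H x) := by
  obtain ⟨hw, hH, ψ, hψ, -, hL, hG⟩ := h
  have hφd : MemLp (fun x => fderiv ℝ φ x e) 2 volume := by
    simp_rw [← inner_gradient_right]
    exact (hφ.memLp_gradient 2 volume).const_inner e
  have h1 := tendsto_integral_inner hφd (fun k => (hψ k).memLp 2 _) hw hL
  have h2 := tendsto_integral_inner (f := fun x => φ x • e)
    ((hφ.1.continuous.smul continuous_const).memLp_of_hasCompactSupport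
      hφ.2.1.smul_right) (fun k => (hψ k).memLp_gradient 2 _) hH hG
  simp only [real_inner_smul_left, inner_gradient_right] at h2
  have h3 : ∀ k, ∫ x, inner ℝ (fderiv ℝ φ x e) (ψ k x) = - ∫ x, φ x * fderiv ℝ (ψ k) x e := by
    intro k
    have hc : ∀ {f : Euc n → ℝ}, IsTest Set.univ f → Continuous (fun x => fderiv ℝ f x e) :=
      fun hf => (hf.contDiff_one.continuous_fderiv (by simp)).clm_apply continuous_const
    have hψ' : IsTest Set.univ (ψ k) := ⟨(hψ k).1, (hψ k).2.1, Set.subset_univ _⟩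
    have h4 := integral_mul_fderiv_eq_neg_fderiv_mul_of_integrable (μ := volume)
      (f := ψ k) (g := φ) (v := e)
      (((hc hψ').mul hφ.1.continuous).integrable_of_hasCompactSupport hφ.2.1.mul_left)
      (((hψ k).1.continuous.mul (hc hφ)).integrable_of_hasCompactSupport (hψ k).2.1.mul_right)
      (((hψ k).1.continuous.mul hφ.1.continuous).integrable_of_hasCompactSupport
        hφ.2.1.mul_left)
      (fun x _ => (hψ k).contDiff_one.differentiable (by simp) x)
      (fun x _ => hφ.contDiff_one.differentiable (by simp) x)
    simp_rw [mul_comm (φ _)]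
    simpa using h4
  simp_rw [h3] at h1
  have h5 := tendsto_nhds_unique h1 h2.neg
  simpa using h5

/-- The chain rule for the weak gradient on an open set. -/
lemma HasWeakGradient.integral_comp_mul_fderiv {O : Set (Euc n)} (hO : IsOpen O) {u : Euc n → ℝ}
    {G : Euc n → Euc n} (h : HasWeakGradient O u G) {θ : ℝ → ℝ} (hθ : IsBddSmooth θ)
    {φ : Euc n → ℝ} (hφ : IsTest O φ) (e : Euc n) :
    ∫ x, θ (u x) * fderiv ℝ φ x e = - ∫ x, φ x * (deriv θ (u x) * inner ℝ e (G x)) := by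
  obtain ⟨L, hL, hφL, hLO⟩ := exists_compact_between hφ.2.1.isCompact hO hφ.2.2
  obtain ⟨η, hη1, hη0, -⟩ := exists_contMDiffMap_one_nhds_of_subset_interior
    (n := (⊤ : ℕ∞)) (modelWithCornersSelf ℝ (Euc n)) (isClosed_tsupport φ) hφL
  have hηs : ContDiff ℝ ∞ η := η.contMDiff.contDiff
  have hη1' : ∀ x ∈ tsupport φ, η =ᶠ[𝓝 x] fun _ => 1 := fun x hx =>
    (eventually_nhdsSet_iff_forall.1 hη1) x hx
  have hηts : tsupport η ⊆ L := closure_minimal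
    (fun x hx => by by_contra hxL; exact hx (hη0 x hxL)) hL.isClosed
  have hηt : IsTest O η := ⟨hηs, hL.of_isClosed_subset (isClosed_tsupport _) hηts,
    hηts.trans hLO⟩
  have hηd : Continuous (fun x => fderiv ℝ η x e) :=
    (hηt.contDiff_one.continuous_fderiv (by simp)).clm_apply continuous_const
  have hGe : LocallyIntegrableOn (fun x => inner ℝ e (G x)) O := fun x hx => by
    obtain ⟨t, ht, hti⟩ := h.2.1 x hx
    exact ⟨t, ht, hti.const_inner e⟩
  -- the cutoff `η u` is integrable on `ℝⁿ` and equals `u` near the support of `φ`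
  have hw : Integrable (fun x => η x * u x) :=
    integrable_smul_of_locallyIntegrableOn h.1 hηs.continuous hL hLO hη0
  have hh1 : Integrable (fun x => η x * inner ℝ e (G x)) :=
    integrable_smul_of_locallyIntegrableOn hGe hηs.continuous hL hLO hη0
  have hh2 : Integrable (fun x => fderiv ℝ η x e * u x) :=
    integrable_smul_of_locallyIntegrableOn h.1 hηd hL hLO fun x hx => by
      rw [← inner_gradient_right, gradient_eq_zero_of_notMem_tsupport (fun hx' => hx (hηts hx')),
        inner_zero_right]
  have hwh : ∀ ξ, IsTest Set.univ ξ → ∫ x, (η x * u x) * fderiv ℝ ξ x e =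
      - ∫ x, ξ x * (η x * inner ℝ e (G x) + fderiv ℝ η x e * u x) := by
    intro ξ hξ
    have hprod : IsTest O (fun x => η x * ξ x) := by
      have hs : tsupport (fun x => η x * ξ x) ⊆ tsupport η :=
        closure_mono fun x hx hηx => hx (by simp [hηx])
      exact ⟨hηs.mul hξ.1, hηt.2.1.isCompact.of_isClosed_subset (isClosed_tsupport _) hs,
        hs.trans hηt.2.2⟩
    have h1 := h.integral_mul_fderiv hprod e
    have h2 : ∀ x, fderiv ℝ (fun x => η x * ξ x) x e =
        η x * fderiv ℝ ξ x e + ξ x * fderiv ℝ η x e := by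
      intro x
      rw [fderiv_fun_mul (hηt.contDiff_one.differentiable (by simp) x)
        (hξ.contDiff_one.differentiable (by simp) x)]
      simp
    simp_rw [h2, mul_add] at h1
    have hξb : ∃ C, ∀ x, ‖ξ x‖ ≤ C := hξ.2.1.exists_bound_of_continuous hξ.1.continuous
    obtain ⟨C, hC⟩ := hξb
    have hξd : Continuous (fun x => fderiv ℝ ξ x e) :=
      (hξ.contDiff_one.continuous_fderiv (by simp)).clm_apply continuous_const
    obtain ⟨C', hC'⟩ : ∃ C', ∀ x, ‖fderiv ℝ ξ x e‖ ≤ C' := by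
      have : HasCompactSupport (fun x => fderiv ℝ ξ x e) := by
        have := (hξ.2.1.fderiv ℝ).comp_left (g := fun L : Euc n →L[ℝ] ℝ => L e) (by simp)
        exact this
      exact this.exists_bound_of_continuous hξd
    have hi1 : Integrable (fun x => fderiv ℝ ξ x e * (η x * u x)) :=
      hw.bdd_mul hξd.aestronglyMeasurable (Eventually.of_forall hC')
    have hi2 : Integrable (fun x => ξ x * (fderiv ℝ η x e * u x)) :=
      hh2.bdd_mul hξ.1.continuous.aestronglyMeasurable (Eventually.of_forall hC)
    have hi3 : Integrable (fun x => ξ x * (η x * inner ℝ e (G x))) :=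
      hh1.bdd_mul hξ.1.continuous.aestronglyMeasurable (Eventually.of_forall hC)
    have e1 : ∫ x, (u x * (η x * fderiv ℝ ξ x e) + u x * (ξ x * fderiv ℝ η x e)) =
        (∫ x, (η x * u x) * fderiv ℝ ξ x e) + ∫ x, ξ x * (fderiv ℝ η x e * u x) := by
      rw [← integral_add (by simpa only [mul_comm] using hi1) hi2]
      refine integral_congr_ae (Eventually.of_forall fun x => ?_)
      simp only
      ring
    have e2 : ∫ x, ξ x * (η x * inner ℝ e (G x) + fderiv ℝ η x e * u x) =
        (∫ x, ξ x * (η x * inner ℝ e (G x))) + ∫ x, ξ x * (fderiv ℝ η x e * u x) := by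
      rw [← integral_add hi3 hi2]
      simp_rw [mul_add]
    have e3 : ∫ x, η x * ξ x * inner ℝ e (G x) = ∫ x, ξ x * (η x * inner ℝ e (G x)) := by
      refine integral_congr_ae (Eventually.of_forall fun x => ?_)
      simp only
      ring
    rw [e1, e3] at h1
    rw [e2]
    linarith
  have hmain := MixedNeumann.integral_comp_mul_fderiv hw (hh1.add hh2) e hwh hθ
    (φ := φ) ⟨hφ.1, hφ.2.1, Set.subset_univ _⟩
  have hl : ∀ x, θ (η x * u x) * fderiv ℝ φ x e = θ (u x) * fderiv ℝ φ x e := by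
    intro x
    by_cases hx : x ∈ tsupport φ
    · rw [(hη1' x hx).eq_of_nhds, one_mul]
    · rw [← inner_gradient_right, gradient_eq_zero_of_notMem_tsupport hx]
      simp
  have hr : ∀ x, φ x * (deriv θ (η x * u x) * (η x * inner ℝ e (G x) + fderiv ℝ η x e * u x)) =
      φ x * (deriv θ (u x) * inner ℝ e (G x)) := by
    intro x
    by_cases hx : x ∈ tsupport φ
    · rw [(hη1' x hx).eq_of_nhds, (hη1' x hx).fderiv_eq]
      simp
    · rw [image_eq_zero_of_notMem_tsupport hx]
      simp
  simp only [Pi.add_apply] at hmain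
  simp_rw [hl, hr] at hmain
  exact hmain

lemma locallyIntegrableOn_bdd_smul {O : Set (Euc n)} {f : Euc n → F}
    (hf : LocallyIntegrableOn f O) {c : Euc n → ℝ} {M : ℝ}
    (hc : AEStronglyMeasurable c (volume.restrict O)) (hM : ∀ x, |c x| ≤ M) :
    LocallyIntegrableOn (fun x => c x • f x) O := by
  intro x hx
  obtain ⟨t, ht, hti⟩ := hf x hx
  have hOx : O ∈ 𝓝[O] x := self_mem_nhdsWithin
  refine ⟨t ∩ O, inter_mem ht hOx, ?_⟩
  exact (hti.mono_set Set.inter_subset_left).bdd_smul M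
    (hc.mono_measure (Measure.restrict_mono Set.inter_subset_right le_rfl))
    (Eventually.of_forall hM)

/-- If `θ(u) = τ(v)` on an open set, then the gradients given by the two chain rules agree. -/
lemma ae_deriv_smul_eq {O U : Set (Euc n)} (hO : IsOpen O) {u v : Euc n → ℝ}
    {G H : Euc n → Euc n} (hu : HasWeakGradient O u G) (hv : IsTestLimit U v H) {θ τ : ℝ → ℝ}
    (hθ : IsBddSmooth θ) (hτ : IsBddSmooth τ) {c : ℝ} (hc : 0 < c)
    (hτ0 : ∀ t, |t| < c → τ t = 0) (heq : ∀ᵐ x ∂(volume.restrict O), θ (u x) = τ (v x)) :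
    ∀ᵐ x ∂(volume.restrict O), deriv θ (u x) • G x = deriv τ (v x) • H x := by
  obtain ⟨M, hM0, hM, hM', -⟩ := hθ.exists_lipschitz
  have hτv := hv.comp hτ hc hτ0
  have hl1 : LocallyIntegrableOn (fun x => deriv θ (u x) • G x) O :=
    locallyIntegrableOn_bdd_smul hu.2.1
      (hθ.continuous_deriv.comp_aestronglyMeasurable hu.1.aestronglyMeasurable) (fun x => hM' _)
  have hl2 : LocallyIntegrableOn (fun x => deriv τ (v x) • H x) O :=
    (hτv.2.1.locallyIntegrable (by norm_num)).locallyIntegrableOn O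
  have key := hO.ae_eq_zero_of_integral_contDiff_smul_eq_zero (μ := volume) (hl1.sub hl2) ?_
  · rw [ae_restrict_iff' hO.measurableSet]
    filter_upwards [key] with x hx hxO
    exact sub_eq_zero.1 (hx hxO)
  · intro φ hφ1 hφ2 hφ3
    have hφ : IsTest O φ := ⟨hφ1, hφ2, hφ3⟩
    have hi1 : Integrable (fun x => φ x • (deriv θ (u x) • G x)) :=
      integrable_smul_of_locallyIntegrableOn hl1 hφ.1.continuous hφ.2.1.isCompact hφ.2.2
        fun x hx => image_eq_zero_of_notMem_tsupport hx
    have hi2 : Integrable (fun x => φ x • (deriv τ (v x) • H x)) :=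
      integrable_smul_of_locallyIntegrableOn hl2 hφ.1.continuous hφ.2.1.isCompact hφ.2.2
        fun x hx => image_eq_zero_of_notMem_tsupport hx
    simp only [Pi.sub_apply, smul_sub]
    rw [integral_sub hi1 hi2, sub_eq_zero]
    refine ext_inner_left ℝ fun e => ?_
    rw [← integral_inner hi1, ← integral_inner hi2]
    simp only [inner_smul_right]
    rw [← neg_inj, ← hu.integral_comp_mul_fderiv hO hθ hφ e]
    have h2 := hτv.integral_mul_fderiv (φ := φ) ⟨hφ.1, hφ.2.1, Set.subset_univ _⟩ e
    simp only [inner_smul_right] at h2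
    rw [← h2]
    rw [ae_restrict_iff' hO.measurableSet] at heq
    refine integral_congr_ae ?_
    filter_upwards [heq] with x hx
    by_cases hxO : x ∈ O
    · simp only [hx hxO]
    · rw [← inner_gradient_right, hφ.gradient_eq_zero hxO]
      simp

end WeakGradient

/-! ### Smooth truncations and the energy inequality -/

section Truncations

/-- A smooth bounded approximation, from below, of the truncation `t ↦ (t - a)⁺`. -/
noncomputable def smoothTruncation (a : ℝ) (j : ℕ) (t : ℝ) : ℝ :=
  ∫ x in a..t, Real.smoothTransition (j * (x - a)) * Real.smoothTransition (j - x)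

lemma contDiff_smoothTruncation_integrand (a : ℝ) (j : ℕ) :
    ContDiff ℝ ∞ fun x => Real.smoothTransition (j * (x - a)) * Real.smoothTransition (j - x) :=
  (Real.smoothTransition.contDiff.comp (contDiff_const.mul (contDiff_id.sub contDiff_const))).mul
    (Real.smoothTransition.contDiff.comp (contDiff_const.sub contDiff_id))

lemma hasDerivAt_smoothTruncation (a : ℝ) (j : ℕ) (t : ℝ) :
    HasDerivAt (smoothTruncation a j)
      (Real.smoothTransition (j * (t - a)) * Real.smoothTransition (j - t)) t :=
  (contDiff_smoothTruncation_integrand a j).continuous.integral_hasStrictDerivAt a t |>.hasDerivAt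

lemma deriv_smoothTruncation (a : ℝ) (j : ℕ) (t : ℝ) : deriv (smoothTruncation a j) t =
    Real.smoothTransition (j * (t - a)) * Real.smoothTransition (j - t) :=
  (hasDerivAt_smoothTruncation a j t).deriv

lemma deriv_smoothTruncation_nonneg (a : ℝ) (j : ℕ) (t : ℝ) :
    0 ≤ deriv (smoothTruncation a j) t := by
  rw [deriv_smoothTruncation]
  exact mul_nonneg (Real.smoothTransition.nonneg _) (Real.smoothTransition.nonneg _)

lemma deriv_smoothTruncation_le_one (a : ℝ) (j : ℕ) (t : ℝ) :
    deriv (smoothTruncation a j) t ≤ 1 := by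
  rw [deriv_smoothTruncation]
  exact mul_le_one₀ (Real.smoothTransition.le_one _) (Real.smoothTransition.nonneg _)
    (Real.smoothTransition.le_one _)

lemma contDiff_smoothTruncation (a : ℝ) (j : ℕ) : ContDiff ℝ ∞ (smoothTruncation a j) := by
  refine contDiff_infty_iff_deriv.2
    ⟨fun t => (hasDerivAt_smoothTruncation a j t).differentiableAt, ?_⟩
  have : deriv (smoothTruncation a j) = _ := funext (deriv_smoothTruncation a j)
  rw [this]
  exact contDiff_smoothTruncation_integrand a j

lemma monotone_smoothTruncation (a : ℝ) (j : ℕ) : Monotone (smoothTruncation a j) :=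
  monotone_of_deriv_nonneg ((contDiff_smoothTruncation a j).differentiable (by simp))
    (deriv_smoothTruncation_nonneg a j)

lemma smoothTruncation_eq_zero {a t : ℝ} (j : ℕ) (h : t ≤ a) : smoothTruncation a j t = 0 := by
  rw [smoothTruncation, intervalIntegral.integral_congr (g := fun _ => (0 : ℝ))]
  · simp
  · intro x hx
    rw [Set.uIcc_of_ge h] at hx
    have : (j : ℝ) * (x - a) ≤ 0 :=
      mul_nonpos_of_nonneg_of_nonpos (Nat.cast_nonneg j) (by linarith [hx.2])
    simp [Real.smoothTransition.zero_of_nonpos this]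

lemma smoothTruncation_nonneg (a : ℝ) (j : ℕ) (t : ℝ) : 0 ≤ smoothTruncation a j t := by
  rcases le_total t a with h | h
  · rw [smoothTruncation_eq_zero j h]
  · exact (smoothTruncation_eq_zero j le_rfl).symm.le.trans (monotone_smoothTruncation a j h)

lemma smoothTruncation_le (a : ℝ) (j : ℕ) (t : ℝ) : smoothTruncation a j t ≤ max (t - a) 0 := by
  rcases le_total t a with h | h
  · rw [smoothTruncation_eq_zero j h]
    exact le_max_right _ _
  · refine le_trans ?_ (le_max_left _ _)
    rw [smoothTruncation]
    refine (intervalIntegral.integral_mono_on (g := fun _ => (1 : ℝ)) h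
      ((contDiff_smoothTruncation_integrand a j).continuous.intervalIntegrable _ _)
      (continuous_const.intervalIntegrable _ _) fun x _ => ?_).trans_eq (by simp)
    rw [← deriv_smoothTruncation]
    exact deriv_smoothTruncation_le_one a j x

lemma smoothTruncation_eq_of_le {a t : ℝ} {j : ℕ} (h : (j : ℝ) ≤ t) :
    smoothTruncation a j t = smoothTruncation a j j := by
  have hc := (contDiff_smoothTruncation_integrand a j).continuous
  rw [smoothTruncation, smoothTruncation, ← intervalIntegral.integral_add_adjacent_intervals
    (hc.intervalIntegrable a j) (hc.intervalIntegrable j t), add_eq_left,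
    intervalIntegral.integral_congr (g := fun _ => (0 : ℝ))]
  · simp
  · intro x hx
    rw [Set.uIcc_of_le h] at hx
    simp [Real.smoothTransition.zero_of_nonpos (sub_nonpos.2 hx.1)]

lemma isBddSmooth_smoothTruncation (a : ℝ) (j : ℕ) : IsBddSmooth (smoothTruncation a j) := by
  refine ⟨contDiff_smoothTruncation a j, max 1 (smoothTruncation a j j), fun t => ?_, fun t => ?_⟩
  · rw [abs_of_nonneg (smoothTruncation_nonneg a j t)]
    refine le_trans ?_ (le_max_right _ _)
    rcases le_total (j : ℝ) t with h | h
    · exact (smoothTruncation_eq_of_le h).le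
    · exact monotone_smoothTruncation a j h
  · rw [abs_of_nonneg (deriv_smoothTruncation_nonneg a j t)]
    exact (deriv_smoothTruncation_le_one a j t).trans (le_max_left _ _)

lemma eventually_deriv_smoothTruncation_eq_one {a t : ℝ} (h : a < t) :
    ∀ᶠ j : ℕ in atTop, deriv (smoothTruncation a j) t = 1 := by
  have h1 : ∀ᶠ j : ℕ in atTop, 1 ≤ (j : ℝ) * (t - a) :=
    (tendsto_natCast_atTop_atTop.atTop_mul_const (sub_pos.2 h)).eventually_ge_atTop 1
  have h2 : ∀ᶠ j : ℕ in atTop, t + 1 ≤ (j : ℝ) :=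
    tendsto_natCast_atTop_atTop.eventually_ge_atTop _
  filter_upwards [h1, h2] with j hj hj'
  rw [deriv_smoothTruncation, Real.smoothTransition.one_of_one_le hj,
    Real.smoothTransition.one_of_one_le (by linarith), one_mul]

lemma tendsto_smoothTruncation (a t : ℝ) :
    Tendsto (fun j => smoothTruncation a j t) atTop (𝓝 (max (t - a) 0)) := by
  rcases le_total t a with h | h
  · simp only [smoothTruncation_eq_zero _ h]
    rw [max_eq_right (by linarith)]
    exact tendsto_const_nhds
  · rw [max_eq_left (by linarith)]
    have h1 : t - a = ∫ _ in a..t, (1 : ℝ) := by simp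
    rw [h1]
    refine intervalIntegral.tendsto_integral_filter_of_dominated_convergence (fun _ => (1 : ℝ))
      (Eventually.of_forall fun j =>
        (contDiff_smoothTruncation_integrand a j).continuous.aestronglyMeasurable)
      (Eventually.of_forall fun j => Eventually.of_forall fun x _ => ?_)
      (continuous_const.intervalIntegrable _ _) (Eventually.of_forall fun x hx => ?_)
    · rw [← deriv_smoothTruncation, Real.norm_eq_abs,
        abs_of_nonneg (deriv_smoothTruncation_nonneg a j x)]
      exact deriv_smoothTruncation_le_one a j x
    · rw [Set.uIoc_of_le h] at hx
      refine tendsto_const_nhds.congr' ?_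
      filter_upwards [eventually_deriv_smoothTruncation_eq_one hx.1] with j hj
      rw [← hj, deriv_smoothTruncation]

/-- The reflection `t ↦ -τ(-t)`, which turns truncations from above into truncations from below. -/
lemma IsBddSmooth.neg_comp_neg {τ : ℝ → ℝ} (h : IsBddSmooth τ) :
    IsBddSmooth (fun t => - τ (-t)) := by
  obtain ⟨M, -, hM, hM', -⟩ := h.exists_lipschitz
  refine ⟨(h.1.comp contDiff_neg).neg, M, fun t => ?_, fun t => ?_⟩
  · rw [abs_neg]
    exact hM _
  · rw [deriv.fun_neg, deriv_comp_neg, neg_neg]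
    exact hM' _

lemma deriv_neg_comp_neg (τ : ℝ → ℝ) (t : ℝ) : deriv (fun t => - τ (-t)) t = deriv τ (-t) := by
  rw [deriv.fun_neg, deriv_comp_neg, neg_neg]

/-- If `θ` is smooth, bounded, with bounded derivative, and vanishes near zero, then the same holds
for `t ↦ θ (t₊ ^ (1 / m))`, `m ≥ 1`. -/
lemma IsBddSmooth.comp_rpow {θ : ℝ → ℝ} (hθ : IsBddSmooth θ) {ε : ℝ} (hε : 0 < ε)
    (hθ0 : ∀ t, |t| < ε → θ t = 0) {m : ℝ} (hm : 1 ≤ m) :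
    IsBddSmooth (fun t => θ (max t 0 ^ m⁻¹)) ∧ (∀ t, |t| < ε ^ m → θ (max t 0 ^ m⁻¹) = 0) ∧
      ∀ t, 0 < t →
        deriv (fun t => θ (max t 0 ^ m⁻¹)) t = deriv θ (t ^ m⁻¹) * (m⁻¹ * t ^ (m⁻¹ - 1)) := by
  have hm0 : 0 < m := by linarith
  have hεm : 0 < ε ^ m := Real.rpow_pos_of_pos hε m
  have hzero : ∀ t, t < ε ^ m → θ (max t 0 ^ m⁻¹) = 0 := by
    intro t ht
    refine hθ0 _ ?_
    rw [abs_of_nonneg (Real.rpow_nonneg (le_max_right _ _) _),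
      Real.rpow_inv_lt_iff_of_pos (le_max_right _ _) hε.le hm0]
    exact max_lt ht hεm
  have heq : ∀ t, 0 < t → (fun t => θ (max t 0 ^ m⁻¹)) =ᶠ[𝓝 t] fun t => θ (t ^ m⁻¹) := by
    intro t ht
    filter_upwards [lt_mem_nhds ht] with t' ht'
    rw [max_eq_left ht'.le]
  have hder : ∀ t, 0 < t →
      deriv (fun t => θ (max t 0 ^ m⁻¹)) t = deriv θ (t ^ m⁻¹) * (m⁻¹ * t ^ (m⁻¹ - 1)) := by
    intro t ht
    rw [(heq t ht).deriv_eq]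
    exact ((hθ.differentiable _).hasDerivAt.comp t
      (Real.hasDerivAt_rpow_const (Or.inl ht.ne'))).deriv
  obtain ⟨M, hM0, hM, hM', -⟩ := hθ.exists_lipschitz
  refine ⟨⟨?_, max M (M * (m⁻¹ * (ε ^ m) ^ (m⁻¹ - 1))), fun t => (hM _).trans (le_max_left _ _),
    fun t => ?_⟩, fun t ht => hzero t ((le_abs_self t).trans_lt ht), hder⟩
  · refine contDiff_iff_contDiffAt.2 fun t => ?_
    rcases lt_or_ge t (ε ^ m) with ht | ht
    · have : (fun t => θ (max t 0 ^ m⁻¹)) =ᶠ[𝓝 t] fun _ => 0 := by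
        filter_upwards [gt_mem_nhds ht] with t' ht'
        exact hzero t' ht'
      exact contDiffAt_const.congr_of_eventuallyEq this
    · have ht0 := hεm.trans_le ht
      exact (hθ.1.contDiffAt.comp t
        (Real.contDiffAt_rpow_const_of_ne ht0.ne')).congr_of_eventuallyEq (heq t ht0)
  · rcases lt_or_ge t (ε ^ m) with ht | ht
    · have : (fun t => θ (max t 0 ^ m⁻¹)) =ᶠ[𝓝 t] fun _ => 0 := by
        filter_upwards [gt_mem_nhds ht] with t' ht'
        exact hzero t' ht'
      rw [this.deriv_eq]
      simp [hM0]
    · have ht0 := hεm.trans_le ht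
      rw [hder t ht0, abs_mul]
      refine le_trans ?_ (le_max_right _ _)
      have h1 : m⁻¹ - 1 ≤ 0 := by
        have := inv_le_one_of_one_le₀ hm
        linarith
      refine mul_le_mul (hM' _) ?_ (abs_nonneg _) hM0
      rw [abs_of_nonneg (by positivity)]
      exact mul_le_mul_of_nonneg_left (Real.rpow_le_rpow_of_nonpos hεm ht h1) (by positivity)

end Truncations

section Energy

variable {s : ℝ} {Ω U N : Set (Euc n)} {g : ℝ → ℝ} {u v : Euc n → ℝ} {G H : Euc n → Euc n}

lemma IsTestLimit.congr {w w' : Euc n → ℝ} (h : IsTestLimit U w H) (hw : w =ᵐ[volume] w') :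
    IsTestLimit U w' H := by
  obtain ⟨hwL, hH, ψ, hψ, hae, hL, hG⟩ := h
  refine ⟨hwL.ae_eq hw, hH, ψ, hψ, ?_, hL.congr fun k => eLpNorm_congr_ae ?_, hG⟩
  · filter_upwards [hae, hw] with x hx hx'
    rwa [← hx']
  · filter_upwards [hw] with x hx
    rw [hx]

lemma integrable_inner_of_memLp {α E : Type*} [MeasurableSpace α] {μ : Measure α}
    [NormedAddCommGroup E] [InnerProductSpace ℝ E] {F K : α → E} (hF : MemLp F 2 μ)
    (hK : MemLp K 2 μ) : Integrable (fun x => inner ℝ (F x) (K x)) μ :=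
  (hF.norm.integrable_mul hK.norm).mono' (hF.1.inner hK.1)
    (Eventually.of_forall fun _ => norm_inner_le_norm _ _)

/-- Truncations of `u` have the energy bound obtained by testing the equation with them. -/
def HasTruncationBound (s : ℝ) (Ω U : Set (Euc n)) (g : ℝ → ℝ) (u : Euc n → ℝ) : Prop :=
  ∀ T, IsBddSmooth T → (∀ t, 0 ≤ deriv T t) → (∀ t, deriv T t ≤ 1) → (∀ t, |t| < 1 → T t = 0) →
    IntegrableOn (fun x => g (u x) * T (u x)) Ω → ∃ H, IsTestLimit U (fun x => T (u x)) H ∧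
      (∫⁻ x in Ω, ‖H x‖ₑ ^ 2) + ∫⁻ z in crossSet Ω, ‖diffQuot s (fun x => T (u x)) z‖ₑ ^ 2 ≤
        ENNReal.ofReal (∫ x in Ω, g (u x) * T (u x))

/-- Monotone `1`-Lipschitz functions contract the nonlocal energy density. -/
lemma sq_le_mul_of_deriv {T : ℝ → ℝ} (hT : Differentiable ℝ T) (h0 : ∀ t, 0 ≤ deriv T t)
    (h1 : ∀ t, deriv T t ≤ 1) (a b : ℝ) : (T a - T b) ^ 2 ≤ (a - b) * (T a - T b) := by
  wlog hab : b ≤ a generalizing a b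
  · have := this b a (by linarith)
    linarith [sq_nonneg (T a - T b)]
  have hm : Monotone T := monotone_of_deriv_nonneg hT h0
  have hl := hm hab
  have h2 : T a - T b ≤ 1 * (a - b) :=
    Convex.image_sub_le_mul_sub_of_deriv_le convex_univ hT.continuous.continuousOn
      hT.differentiableOn (fun x _ => h1 x) b (Set.mem_univ _) a (Set.mem_univ _) hab
  nlinarith

/-- The energy inequality for a truncation `T(u)` that can be written as a smooth function `τ(v)` of
some `v` in `H¹₀`: the equation is tested with `τ(v) = T(u)`, and the left-hand side dominates the
energy of `T(u)` because `0 ≤ T' ≤ 1`. -/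
lemma exists_lintegral_sq_le_of_weakEquation (hn : 0 < n) (hs0 : 0 < s) (hs1 : s < 1)
    (hweak : WeakEquation s Ω N g u G) (hv : IsTestLimit (fullSet Ω N) v H)
    (hfin : ∀ ψ, IsTest (fullSet Ω N) ψ → FiniteEnergyWhere s Ω u G ψ)
    (hfinv : FiniteEnergyWhere s Ω u G v) {T : ℝ → ℝ} (hT : IsBddSmooth T)
    (hT0 : ∀ t, 0 ≤ deriv T t) (hT1 : ∀ t, deriv T t ≤ 1)
    (hint : IntegrableOn (fun x => g (u x) * T (u x)) Ω) {τ : ℝ → ℝ} (hτ : IsBddSmooth τ)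
    {c : ℝ} (hc : 0 < c) (hτ0 : ∀ t, |t| < c → τ t = 0) (heq : ∀ᵐ x, τ (v x) = T (u x))
    (hgrad : ∀ᵐ x ∂(volume.restrict Ω), deriv T (u x) • G x = deriv τ (v x) • H x) :
    ∃ H, IsTestLimit (fullSet Ω N) (fun x => T (u x)) H ∧
      (∫⁻ x in Ω, ‖H x‖ₑ ^ 2) + ∫⁻ z in crossSet Ω, ‖diffQuot s (fun x => T (u x)) z‖ₑ ^ 2 ≤
        ENNReal.ofReal (∫ x in Ω, g (u x) * T (u x)) := by
  have hlim := hv.comp hτ hc hτ0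
  have hae : (fun x => g (u x) * T (u x)) =ᵐ[volume.restrict Ω] fun x => g (u x) * τ (v x) := by
    filter_upwards [ae_restrict_of_ae heq] with x hx
    rw [hx]
  have hid := weakIdentity_comp hn hs0 hs1 hweak hv hfin hfinv hτ hc hτ0 (hint.congr hae)
  refine ⟨fun x => deriv τ (v x) • H x, hlim.congr heq, ?_⟩
  obtain ⟨F, f, hF, hf, hFG, hfu⟩ := hfinv c hc
  set K := fun x => deriv τ (v x) • H x with hK
  have hdq : diffQuot s (fun x => τ (v x)) =ᵐ[volume] diffQuot s (fun x => T (u x)) :=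
    diffQuot_congr_ae s heq
  have hfK := integrable_inner_of_memLp hF (hlim.2.1.restrict Ω)
  have hfq := integrable_inner_of_memLp hf
    ((hlim.memLp_diffQuot hn hs0 hs1).restrict (crossSet Ω))
  have h0 : ∀ x, |v x| < c → τ (v x) = 0 ∧ K x = 0 := fun x hx =>
    ⟨hτ0 _ hx, by simp [hK, deriv_eq_zero_of_abs_lt hτ0 hx]⟩
  have hI1 : ∀ᵐ x ∂(volume.restrict Ω), ‖K x‖ ^ 2 ≤ inner ℝ (F x) (K x) := by
    filter_upwards [hFG, hgrad] with x hx hx'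
    rcases lt_or_ge |v x| c with h | h
    · simp [(h0 x h).2]
    · rw [hx h, hK]
      simp only
      rw [← hx', inner_smul_right, norm_smul, real_inner_self_eq_norm_sq, mul_pow,
        Real.norm_eq_abs, sq_abs]
      refine mul_le_mul_of_nonneg_right ?_ (sq_nonneg _)
      nlinarith [hT0 (u x), hT1 (u x)]
  have hI2 : ∀ᵐ z ∂(volume.restrict (crossSet Ω)),
      diffQuot s (fun x => T (u x)) z ^ 2 ≤ inner ℝ (f z) (diffQuot s (fun x => τ (v x)) z) := by
    filter_upwards [hfu, ae_restrict_of_ae hdq] with z hz hz'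
    rw [hz']
    by_cases h : c ≤ |v z.1| ∨ c ≤ |v z.2|
    · rw [hz h]
      simp only [RCLike.inner_apply, conj_trivial]
      rw [mul_comm, diffQuot_mul_diffQuot, sq, diffQuot_mul_diffQuot, ← sq]
      exact div_le_div_of_nonneg_right
        (sq_le_mul_of_deriv hT.differentiable hT0 hT1 (u z.1) (u z.2)) (by positivity)
    · push Not at h
      have h4 : diffQuot s (fun x => τ (v x)) z = 0 := by
        simp [diffQuot, (h0 _ h.1).1, (h0 _ h.2).1]
      rw [← hz', h4]
      simp
  have hJ1 : ∫⁻ x in Ω, ‖K x‖ₑ ^ 2 ≤ ENNReal.ofReal (∫ x in Ω, inner ℝ (F x) (K x)) := by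
    rw [ofReal_integral_eq_lintegral_ofReal hfK
      (hI1.mono fun x hx => (sq_nonneg _).trans hx)]
    refine lintegral_mono_ae (hI1.mono fun x hx => ?_)
    rw [← ofReal_norm, ← ENNReal.ofReal_pow (norm_nonneg _)]
    exact ENNReal.ofReal_le_ofReal hx
  have hJ2 : ∫⁻ z in crossSet Ω, ‖diffQuot s (fun x => T (u x)) z‖ₑ ^ 2 ≤
      ENNReal.ofReal (∫ z in crossSet Ω, inner ℝ (f z) (diffQuot s (fun x => τ (v x)) z)) := by
    rw [ofReal_integral_eq_lintegral_ofReal hfq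
      (hI2.mono fun x hx => (sq_nonneg _).trans hx)]
    refine lintegral_mono_ae (hI2.mono fun x hx => ?_)
    rw [← ofReal_norm, ← ENNReal.ofReal_pow (norm_nonneg _)]
    refine ENNReal.ofReal_le_ofReal ?_
    rwa [Real.norm_eq_abs, sq_abs]
  refine (add_le_add hJ1 hJ2).trans ?_
  rw [← ENNReal.ofReal_add (integral_nonneg_of_ae (hI1.mono fun x hx => (sq_nonneg _).trans hx))
    (integral_nonneg_of_ae (hI2.mono fun x hx => (sq_nonneg _).trans hx)),
    ← pairing_eq hFG hfu h0, hid.2, integral_congr_ae hae]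

lemma measurableSet_fullSet (hΩ : IsOpen Ω) (hN : IsOpen N) : MeasurableSet (fullSet Ω N) :=
  (hΩ.union hN).measurableSet.union (isClosed_frontier.inter isClosed_closure).measurableSet

lemma subset_fullSet (Ω N : Set (Euc n)) : Ω ⊆ fullSet Ω N :=
  fun _ hx => Or.inl (Or.inl hx)

lemma hasTruncationBound_of_memXWith (hn : 0 < n) (hs0 : 0 < s) (hs1 : s < 1) (hΩ : IsOpen Ω)
    (hN : IsOpen N) (hu : MemXWith (fullSet Ω N) u G) (hweak : WeakEquation s Ω N g u G) :
    HasTruncationBound s Ω (fullSet Ω N) g u := by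
  have hlim := isTestLimit_of_memXWith (measurableSet_fullSet hΩ hN) hu
  have hfin : ∀ w, FiniteEnergyWhere s Ω u G w := fun w c _ =>
    ⟨G, diffQuot s u, hu.2.1.restrict Ω, (hlim.memLp_diffQuot hn hs0 hs1).restrict _,
      Eventually.of_forall fun _ _ => rfl, Eventually.of_forall fun _ _ => rfl⟩
  intro T hT hT0 hT1 hTz hint
  refine exists_lintegral_sq_le_of_weakEquation hn hs0 hs1 hweak hlim (fun ψ _ => hfin ψ) (hfin u) hT hT0 hT1 hint
    hT one_pos hTz (Eventually.of_forall fun _ => rfl) ?_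
  filter_upwards [ae_restrict_mem hΩ.measurableSet] with x hx
  rw [Set.indicator_of_mem (subset_fullSet Ω N hx)]

end Energy

/-! ### Solutions with locally finite energy -/

lemma abs_sub_le_mul_abs_rpow_sub {m k a b : ℝ} (hm : 1 ≤ m) (hk : 0 < k) (ha : 0 ≤ a)
    (hb : 0 ≤ b) (h : k ≤ a ∨ k ≤ b) : |a - b| ≤ k ^ (1 - m) * |a ^ m - b ^ m| := by
  wlog hab : b ≤ a generalizing a b
  · rw [abs_sub_comm, abs_sub_comm (a ^ m)]
    exact this hb ha h.symm (by linarith)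
  have hka : k ≤ a := h.elim id fun h' => h'.trans hab
  have ha0 : 0 < a := hk.trans_le hka
  have h1 : a ^ m = a ^ (m - 1) * a := by
    rw [Real.rpow_sub_one ha0.ne']
    field_simp
  have h2 : b ^ m ≤ a ^ (m - 1) * b := by
    rcases hb.eq_or_lt with rfl | hb0
    · rw [Real.zero_rpow (by linarith), mul_zero]
    · have : b ^ m = b ^ (m - 1) * b := by
        rw [Real.rpow_sub_one hb0.ne']
        field_simp
      rw [this]
      exact mul_le_mul_of_nonneg_right (Real.rpow_le_rpow hb hab (by linarith)) hb
  rw [abs_of_nonneg (sub_nonneg.2 hab),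
    abs_of_nonneg (sub_nonneg.2 (Real.rpow_le_rpow hb hab (by linarith)))]
  have h3 : 1 ≤ k ^ (1 - m) * a ^ (m - 1) := by
    have h4 : k ^ (1 - m) * k ^ (m - 1) = 1 := by
      rw [← Real.rpow_add hk]
      simp
    refine h4.symm.le.trans (mul_le_mul_of_nonneg_left (Real.rpow_le_rpow hk.le hka (sub_nonneg.2 hm))
      (Real.rpow_nonneg hk.le _))
  calc a - b ≤ (k ^ (1 - m) * a ^ (m - 1)) * (a - b) :=
        le_mul_of_one_le_left (sub_nonneg.2 hab) h3
    _ = k ^ (1 - m) * (a ^ m - a ^ (m - 1) * b) := by rw [h1]; ring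
    _ ≤ k ^ (1 - m) * (a ^ m - b ^ m) := by gcongr

section LocalSolutions

variable {s : ℝ} {Ω N : Set (Euc n)} {g : ℝ → ℝ} {u : Euc n → ℝ} {G H : Euc n → Euc n}

lemma abs_diffQuot (s : ℝ) (w : Euc n → ℝ) (z : Euc n × Euc n) :
    |diffQuot s w z| = |w z.1 - w z.2| / ‖z.1 - z.2‖ ^ (((n : ℝ) + 2 * s) / 2) := by
  rw [diffQuot, abs_div, abs_of_nonneg (a := ‖z.1 - z.2‖ ^ _) (by positivity)]

/-- Where a test function `ψ` is at least `c`, a function in `L²` with locally finite energy has finite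
energy: by uniform continuity of `ψ`, either both points of a pair lie in the compact set
`{|ψ| ≥ c / 2}`, or the pair is away from the diagonal. -/
lemma MemXLocWith.finiteEnergyWhere (hn : 0 < n) (hs0 : 0 < s) (hs1 : s < 1)
    (hloc : MemXLocWith s Ω N u G) (hu : MemLp u 2 volume) {ψ : Euc n → ℝ}
    (hψ : IsTest (fullSet Ω N) ψ) : FiniteEnergyWhere s Ω u G ψ := by
  intro c hc
  have hK : ∀ {d : ℝ}, 0 < d → IsCompact {x | d ≤ |ψ x|} ∧ {x | d ≤ |ψ x|} ⊆ fullSet Ω N := by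
    intro d hd
    have hsub : {x | d ≤ |ψ x|} ⊆ tsupport ψ := fun x hx => subset_tsupport ψ fun h0 => by
      rw [Set.mem_ofPred_eq, h0, abs_zero] at hx
      linarith
    exact ⟨hψ.2.1.isCompact.of_isClosed_subset
      (isClosed_le continuous_const hψ.1.continuous.abs) hsub, hsub.trans hψ.2.2⟩
  have hmeas : MeasurableSet {x | c ≤ |ψ x|} := (hK hc).1.measurableSet
  set A : Set (Euc n × Euc n) := {z | c ≤ |ψ z.1| ∨ c ≤ |ψ z.2|} with hA
  have hAm : MeasurableSet A := (measurable_fst hmeas).union (measurable_snd hmeas)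
  have hdqm := aestronglyMeasurable_diffQuot s hu.1
  refine ⟨{x | c ≤ |ψ x|}.indicator G, A.indicator (diffQuot s u), ?_, ⟨?_, ?_⟩,
    Eventually.of_forall fun x hx => Set.indicator_of_mem (s := {x | c ≤ |ψ x|}) hx G,
    Eventually.of_forall fun z hz => Set.indicator_of_mem (s := A) hz _⟩
  · rw [memLp_indicator_iff_restrict hmeas, Measure.restrict_restrict hmeas]
    exact (hloc.2 _ (hK hc).1 (hK hc).2).1
  · exact hdqm.restrict.indicator hAm
  · obtain ⟨δ, hδ, hδψ⟩ := Metric.uniformContinuous_iff.1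
      (hψ.2.1.uniformContinuous_of_continuous hψ.1.continuous) (c / 2) (by positivity)
    set K' := {x | c / 2 ≤ |ψ x|} with hK'
    obtain ⟨hK'c, hK'U⟩ := hK (half_pos hc)
    have hsub : A ⊆ K' ×ˢ K' ∪ {z | δ ≤ ‖z.2 - z.1‖} := by
      intro z hz
      by_cases hd : δ ≤ ‖z.2 - z.1‖
      · exact Or.inr hd
      · left
        rw [not_le, ← dist_eq_norm] at hd
        have h1 := hδψ hd
        rw [Real.dist_eq] at h1
        have h2 := abs_abs_sub_abs_le_abs_sub (ψ z.2) (ψ z.1)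
        have h3 := abs_lt.1 (h2.trans_lt h1)
        rcases hz with hz | hz
        · exact ⟨by rw [hK', Set.mem_ofPred_eq]; linarith,
            by rw [hK', Set.mem_ofPred_eq]; linarith [h3.1]⟩
        · exact ⟨by rw [hK', Set.mem_ofPred_eq]; linarith [h3.2],
            by rw [hK', Set.mem_ofPred_eq]; linarith⟩
    obtain ⟨C, hC, hCle⟩ := exists_lintegral_diffQuot_offDiag_le hn hs0 hs1 hδ
    have h1 : ∫⁻ z in K' ×ˢ K' ∩ crossSet Ω, ‖diffQuot s u z‖ₑ ^ 2 < ⊤ := by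
      refine lt_of_eq_of_lt (lintegral_congr fun z => ?_) (hloc.2 K' hK'c hK'U).2.2
      rw [sq ‖_‖ₑ, ← enorm_mul, diffQuot_mul_diffQuot, ← sq]
    have h2 : ∫⁻ z in {z | δ ≤ ‖z.2 - z.1‖}, ‖diffQuot s u z‖ₑ ^ 2 < ⊤ := by
      refine (hCle u hu.1).trans_lt (ENNReal.mul_lt_top hC.lt_top ?_)
      rw [← eLpNorm_two_sq]
      exact ENNReal.pow_lt_top hu.2
    rw [eLpNorm_two_eq]
    refine ENNReal.rpow_lt_top_of_nonneg (by norm_num) (ne_of_lt ?_)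
    calc ∫⁻ z in crossSet Ω, ‖A.indicator (diffQuot s u) z‖ₑ ^ 2
        = ∫⁻ z in A ∩ crossSet Ω, ‖diffQuot s u z‖ₑ ^ 2 := by
          rw [← Measure.restrict_restrict hAm, ← lintegral_indicator hAm]
          refine lintegral_congr fun z => ?_
          by_cases hz : z ∈ A <;> simp [hz]
      _ ≤ ∫⁻ z in (K' ×ˢ K' ∩ crossSet Ω) ∪ {z | δ ≤ ‖z.2 - z.1‖}, ‖diffQuot s u z‖ₑ ^ 2 := by
          refine lintegral_mono_set fun z hz => ?_
          rcases hsub hz.1 with h | h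
          · exact Or.inl ⟨h, hz.2⟩
          · exact Or.inr h
      _ ≤ _ := lintegral_union_le _ _ _
      _ < ⊤ := ENNReal.add_lt_top.2 ⟨h1, h2⟩

/-- For `u ≥ 0` with locally finite energy and `u ^ m` in the energy space, `m ≥ 1`, truncations of
`u` away from zero are smooth functions of `u ^ m`, hence admissible test functions. -/
lemma hasTruncationBound_of_memXLocWith (hn : 0 < n) (hs0 : 0 < s) (hs1 : s < 1) (hΩ : IsOpen Ω)
    (hN : IsOpen N) (hb : Bornology.IsBounded (fullSet Ω N)) (hu0 : ∀ᵐ x, 0 ≤ u x) {m : ℝ}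
    (hm : 1 ≤ m) (hv : MemX (fullSet Ω N) (fun x => u x ^ m)) (hloc : MemXLocWith s Ω N u G)
    (hweak : WeakEquation s Ω N g u G) :
    MemLp u 2 volume ∧ HasTruncationBound s Ω (fullSet Ω N) g u := by
  obtain ⟨Gv, hGv⟩ := hv
  have hUm := measurableSet_fullSet hΩ hN
  have hlim := isTestLimit_of_memXWith hUm hGv
  set U := fullSet Ω N with hU
  set v : Euc n → ℝ := fun x => u x ^ m with hvdef
  set H := U.indicator Gv
  have hm0 : 0 < m := by linarith
  -- measurability of `u` is recovered from that of `v`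
  have hroot : ∀ᵐ x, max (v x) 0 ^ m⁻¹ = u x := by
    filter_upwards [hu0] with x hx
    rw [max_eq_left (Real.rpow_nonneg hx m), Real.rpow_rpow_inv hx hm0.ne']
  have hum : AEStronglyMeasurable u volume := by
    have h1 : Continuous fun t : ℝ => max t 0 ^ m⁻¹ :=
      (continuous_id.max continuous_const).rpow_const fun _ => Or.inr (by positivity)
    exact (h1.comp_aestronglyMeasurable hlim.1.1).congr hroot
  have hu2 : MemLp u 2 volume := by
    have h1 : MemLp (U.indicator fun _ => (1 : ℝ)) 2 volume :=
      memLp_indicator_const 2 hUm 1 (Or.inr hb.measure_lt_top.ne)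
    refine (h1.add hlim.1).of_le hum ?_
    filter_upwards [hu0, hlim.ae_eq_zero] with x hx hx0
    by_cases hxU : x ∈ U
    · simp only [Pi.add_apply, Set.indicator_of_mem hxU, Real.norm_eq_abs]
      have hvx : 0 ≤ v x := Real.rpow_nonneg hx m
      rw [abs_of_nonneg hx, abs_of_nonneg (by linarith)]
      rcases le_total (u x) 1 with h | h
      · linarith
      · have : u x ≤ v x := Real.self_le_rpow_of_one_le h hm
        linarith
    · have : u x = 0 := (Real.rpow_eq_zero hx hm0.ne').1 (hx0 hxU)
      simp [this]
  have hchain : ∀ {θ : ℝ → ℝ} {ε : ℝ}, IsBddSmooth θ → 0 < ε → (∀ t, |t| < ε → θ t = 0) →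
      ∀ᵐ x ∂(volume.restrict Ω),
        deriv θ (u x) • G x = deriv (fun t => θ (max t 0 ^ m⁻¹)) (v x) • H x := by
    intro θ ε hθ hε hθ0
    obtain ⟨h1, h2, -⟩ := hθ.comp_rpow hε hθ0 hm
    refine ae_deriv_smul_eq hΩ hloc.1 hlim hθ h1 (Real.rpow_pos_of_pos hε m) h2 ?_
    filter_upwards [ae_restrict_of_ae hroot] with x hx
    rw [hx]
  have hfinv : FiniteEnergyWhere s Ω u G v := by
    intro c hc
    set b := c ^ m⁻¹ with hbdef
    have hb0 : 0 < b := Real.rpow_pos_of_pos hc _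
    have hvm : AEMeasurable (fun x => |v x|) volume := hlim.1.1.norm.aemeasurable
    have hlow : ∀ᵐ x, c ≤ |v x| → b ≤ u x := by
      filter_upwards [hu0] with x hx hcx
      rw [abs_of_nonneg (Real.rpow_nonneg hx m)] at hcx
      exact (Real.rpow_inv_le_iff_of_pos hc.le hx hm0).2 hcx
    -- where `u ≥ b` the chain rule recovers `G = m⁻¹ v ^ (m⁻¹ - 1) H`, with a bounded coefficient
    have hGb : ∀ᵐ x ∂(volume.restrict Ω), c ≤ |v x| →
        ‖G x‖ ≤ (m⁻¹ * c ^ (m⁻¹ - 1)) * ‖H x‖ := by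
      have hall : ∀ᵐ x ∂(volume.restrict Ω), ∀ j : ℕ, deriv (smoothTruncation (b / 2) j) (u x) •
          G x = deriv (fun t => smoothTruncation (b / 2) j (max t 0 ^ m⁻¹)) (v x) • H x :=
        ae_all_iff.2 fun j => hchain (isBddSmooth_smoothTruncation _ j) (half_pos hb0)
          fun t ht => smoothTruncation_eq_zero j ((le_abs_self t).trans ht.le)
      filter_upwards [hall, ae_restrict_of_ae hu0, ae_restrict_of_ae hlow] with x hx hx0 hxl hcx
      have hbu := hxl hcx
      obtain ⟨j, hj⟩ := (eventually_deriv_smoothTruncation_eq_one (a := b / 2) (t := u x)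
        (by linarith)).exists
      have hxj := hx j
      rw [abs_of_nonneg (Real.rpow_nonneg hx0 m)] at hcx
      rw [hj, one_smul, ((isBddSmooth_smoothTruncation (b / 2) j).comp_rpow (half_pos hb0)
        (fun t ht => smoothTruncation_eq_zero j ((le_abs_self t).trans ht.le)) hm).2.2 (v x)
        (hc.trans_le hcx), Real.rpow_rpow_inv hx0 hm0.ne', hj, one_mul] at hxj
      have hvx : 0 < v x := hc.trans_le hcx
      rw [hxj, norm_smul, Real.norm_of_nonneg (by positivity)]
      have h1 : m⁻¹ - 1 ≤ 0 := by
        have := inv_le_one_of_one_le₀ hm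
        linarith
      exact mul_le_mul_of_nonneg_right (mul_le_mul_of_nonneg_left
        (Real.rpow_le_rpow_of_nonpos hc hcx h1) (by positivity)) (norm_nonneg _)
    have hnull : NullMeasurableSet {x | c ≤ |v x|} volume :=
      nullMeasurableSet_le aemeasurable_const hvm
    have hnullA : NullMeasurableSet {z : Euc n × Euc n | c ≤ |v z.1| ∨ c ≤ |v z.2|} volume :=
      (hnull.preimage Measure.quasiMeasurePreserving_fst).union
        (hnull.preimage Measure.quasiMeasurePreserving_snd)
    refine ⟨{x | c ≤ |v x|}.indicator G,
      {z : Euc n × Euc n | c ≤ |v z.1| ∨ c ≤ |v z.2|}.indicator (diffQuot s u), ?_, ?_,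
      Eventually.of_forall fun x hx => Set.indicator_of_mem (s := {x | c ≤ |v x|}) hx G,
      Eventually.of_forall fun z hz => Set.indicator_of_mem
        (s := {z : Euc n × Euc n | c ≤ |v z.1| ∨ c ≤ |v z.2|}) hz _⟩
    · refine (hlim.2.1.restrict Ω).of_le_mul (c := m⁻¹ * c ^ (m⁻¹ - 1))
        (hloc.1.2.1.aestronglyMeasurable.indicator₀
          (hnull.mono_ac Measure.absolutelyContinuous_restrict)) ?_
      filter_upwards [hGb] with x hx
      by_cases hxc : c ≤ |v x|
      · rw [Set.indicator_of_mem (s := {x | c ≤ |v x|}) hxc]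
        exact hx hxc
      · rw [Set.indicator_of_notMem (s := {x | c ≤ |v x|}) hxc, norm_zero]
        positivity
    · refine MemLp.restrict _ ((hlim.memLp_diffQuot hn hs0 hs1).of_le_mul (c := b ^ (1 - m))
        ((aestronglyMeasurable_diffQuot s hum).indicator₀ hnullA) ?_)
      filter_upwards [Measure.quasiMeasurePreserving_fst.ae (hu0.and hlow),
        Measure.quasiMeasurePreserving_snd.ae (hu0.and hlow)] with z h1 h2
      by_cases hz : c ≤ |v z.1| ∨ c ≤ |v z.2|
      · rw [Set.indicator_of_mem (s := {z : Euc n × Euc n | c ≤ |v z.1| ∨ c ≤ |v z.2|}) hz,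
          Real.norm_eq_abs, Real.norm_eq_abs, abs_diffQuot, abs_diffQuot, ← mul_div_assoc]
        refine div_le_div_of_nonneg_right ?_ (by positivity)
        exact abs_sub_le_mul_abs_rpow_sub hm hb0 h1.1 h2.1 (hz.imp h1.2 h2.2)
      · rw [Set.indicator_of_notMem (s := {z : Euc n × Euc n | c ≤ |v z.1| ∨ c ≤ |v z.2|}) hz,
          norm_zero]
        positivity
  refine ⟨hu2, fun T hT hT0 hT1 hTz hint => ?_⟩
  obtain ⟨h1, h2, -⟩ := hT.comp_rpow one_pos hTz hm
  refine exists_lintegral_sq_le_of_weakEquation hn hs0 hs1 hweak hlim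
    (fun ψ hψ => hloc.finiteEnergyWhere hn hs0 hs1 hu2 hψ) hfinv hT hT0 hT1 hint h1
    (Real.rpow_pos_of_pos one_pos m) h2 ?_ (hchain hT one_pos hTz)
  filter_upwards [hroot] with x hx
  rw [hx]

end LocalSolutions

/-! ### The level set inequality -/

section Domain

variable {Ω D N : Set (Euc n)}

lemma IsMixedDomain.isBounded_fullSet (h : IsMixedDomain Ω D N) :
    Bornology.IsBounded (fullSet Ω N) := by
  refine h.bounded.closure.subset ?_
  rintro x (hx | hx)
  · exact subset_closure hx
  · exact closure_mono Set.subset_union_right hx.2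

/-- Every boundary point of `Ω` is a boundary point of `Ω ∪ N`, so `∂Ω` lies in a smooth hypersurface. -/
lemma IsMixedDomain.frontier_subset (h : IsMixedDomain Ω D N) :
    frontier Ω ⊆ frontier (Ω ∪ N) := by
  intro x hx
  rw [(h.isOpen_domain.union h.isOpen_neumann).frontier_eq]
  refine ⟨closure_mono Set.subset_union_left (frontier_subset_closure hx), ?_⟩
  rintro (hx' | hx')
  · rw [h.isOpen_domain.frontier_eq] at hx
    exact hx.2 hx'
  · have : x ∈ (closure Ω)ᶜ := h.union_eq ▸ Or.inr hx'
    exact this (frontier_subset_closure hx)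

variable {s : ℝ}

/-- The Sobolev inequality on `Ω` for functions in `H¹₀(U)`. -/
lemma IsMixedDomain.exists_eLpNorm_critExp_le (hn : 2 < n) (h : IsMixedDomain Ω D N) :
    ∃ C : ℝ≥0∞, C ≠ ⊤ ∧ ∀ (U : Set (Euc n)) w H, IsTestLimit U w H →
      eLpNorm w (ENNReal.ofReal (critExp n)) (volume.restrict Ω) ≤
        C * (eLpNorm w 2 (volume.restrict Ω) + eLpNorm H 2 (volume.restrict Ω)) := by
  obtain ⟨C, hC, hle⟩ := exists_sobolev hn h.isOpen_domain
    (h.bounded.subset Set.subset_union_left) h.smooth h.frontier_subset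
  have hr := two_lt_critExp hn
  have hC' : C ^ (1 / 2 : ℝ) ≠ ⊤ := ENNReal.rpow_ne_top_of_nonneg (by norm_num) hC
  refine ⟨C ^ (1 / 2 : ℝ), hC', ?_⟩
  rintro U w H ⟨hw, hH, ψ, hψ, hae, hL, hG⟩
  have hres : ∀ {E : Type} [NormedAddCommGroup E] (f : ℕ → Euc n → E),
      Tendsto (fun k => eLpNorm (f k) 2 volume) atTop (𝓝 0) →
      Tendsto (fun k => eLpNorm (f k) 2 (volume.restrict Ω)) atTop (𝓝 0) := by
    intro E _ f hf
    exact tendsto_of_tendsto_of_tendsto_of_le_of_le tendsto_const_nhds hf (fun _ => bot_le)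
      fun k => eLpNorm_restrict_le _ _ _ _
  refine eLpNorm_le_of_tendsto hC' (fun k => ((hψ k).memLp 2 _).1) (ae_restrict_of_ae hae)
    (fun k => ((hψ k).memLp 2 _).1) hw.1.restrict (fun k => ((hψ k).memLp_gradient 2 _).1)
    hH.1.restrict (hres _ hL) (hres _ hG) fun k => ?_
  have h1 := hle (ψ k) (hψ k).contDiff_one
  simp_rw [← enorm_gradient] at h1
  rw [← eLpNorm_two_sq, ← eLpNorm_two_sq] at h1
  have h2 := ENNReal.rpow_le_rpow h1 (by norm_num : (0 : ℝ) ≤ 1 / 2)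
  rw [← ENNReal.rpow_mul, ENNReal.mul_rpow_of_nonneg _ _ (by norm_num)] at h2
  rw [eLpNorm_eq_lintegral_rpow_enorm_toReal (by simp; linarith) ENNReal.ofReal_ne_top,
    ENNReal.toReal_ofReal (by linarith)]
  have h3 : ∀ a b : ℝ≥0∞, (a ^ 2 + b ^ 2) ^ (1 / 2 : ℝ) ≤ a + b := by
    intro a b
    have h4 : a ^ 2 + b ^ 2 ≤ (a + b) ^ 2 := by
      rw [add_sq]
      gcongr
      exact le_self_add
    refine (ENNReal.rpow_le_rpow h4 (by norm_num)).trans_eq ?_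
    rw [← ENNReal.rpow_natCast, ← ENNReal.rpow_mul]
    norm_num
  have h5 : 2 / critExp n * (1 / 2) = 1 / critExp n := by ring
  rw [h5] at h2
  exact h2.trans (mul_le_mul_right (h3 _ _) _)

/-- Sobolev and Poincaré inequalities combined: the energy on `Ω` and `Q` controls the critical
norm on `Ω`. -/
lemma IsMixedDomain.exists_lintegral_critExp_le (hn : 2 < n) (hs0 : 0 < s)
    (h : IsMixedDomain Ω D N) :
    ∃ C : ℝ≥0∞, C ≠ ⊤ ∧ ∀ w H, IsTestLimit (fullSet Ω N) w H →
      (∫⁻ x in Ω, ‖w x‖ₑ ^ critExp n) ^ (2 / critExp n) ≤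
        C * ((∫⁻ x in Ω, ‖H x‖ₑ ^ 2) + ∫⁻ z in crossSet Ω, ‖diffQuot s w z‖ₑ ^ 2) := by
  obtain ⟨C, hC, hle⟩ := h.exists_eLpNorm_critExp_le hn
  obtain ⟨P, hP, hPle⟩ := exists_poincare (by lia) s hs0 h.isOpen_domain.measurableSet
    (subset_fullSet Ω N) h.isBounded_fullSet
  have hr := two_lt_critExp hn
  refine ⟨C ^ 2 * (2 * (P + 1)), ENNReal.mul_ne_top (ENNReal.pow_ne_top hC)
    (ENNReal.mul_ne_top (by simp) (by simp [hP])), fun w H hw => ?_⟩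
  have h1 := hPle w hw.1.1 ((ae_restrict_iff'
    (measurableSet_fullSet h.isOpen_domain h.isOpen_neumann).compl).2 hw.ae_eq_zero)
  have h2 := hle _ w H hw
  rw [eLpNorm_eq_lintegral_rpow_enorm_toReal (by simp; linarith) ENNReal.ofReal_ne_top,
    ENNReal.toReal_ofReal (by linarith)] at h2
  have h3 := pow_le_pow_left₀ bot_le h2 2
  rw [mul_pow, ← ENNReal.rpow_natCast, ← ENNReal.rpow_mul] at h3
  have h4 : ∀ a b : ℝ≥0∞, (a + b) ^ 2 ≤ 2 * (a ^ 2 + b ^ 2) := by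
    intro a b
    have := ENNReal.rpow_add_le_mul_rpow_add_rpow a b (p := 2) (by norm_num)
    norm_num at this
    exact_mod_cast this
  set A := ∫⁻ x in Ω, ‖H x‖ₑ ^ 2
  set B := ∫⁻ z in crossSet Ω, ‖diffQuot s w z‖ₑ ^ 2
  calc _ = ((∫⁻ x in Ω, ‖w x‖ₑ ^ critExp n) ^ (1 / critExp n * ((2 : ℕ) : ℝ))) := by
        congr 1
        push_cast
        ring
    _ ≤ _ := h3
    _ ≤ C ^ 2 * (2 * (P * B + A)) := by
        gcongr
        refine (h4 _ _).trans ?_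
        rw [eLpNorm_two_sq, eLpNorm_two_sq]
        gcongr
    _ ≤ C ^ 2 * (2 * (P * (A + B) + 1 * (A + B))) := by
        rw [one_mul]
        gcongr
        · exact le_add_self
        · exact le_self_add
    _ = _ := by rw [← add_mul]; ring

end Domain

section Levels

variable {s : ℝ} {Ω U D N : Set (Euc n)} {g : ℝ → ℝ} {u : Euc n → ℝ}

/-- If an admissible truncation of `u` vanishes on `Ω`, its energy is zero, so it vanishes
everywhere. -/
lemma HasTruncationBound.ae_eq_zero (hn : 0 < n) (hΩ : IsOpen Ω) (hne : Ω.Nonempty)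
    (h : HasTruncationBound s Ω U g u) {T : ℝ → ℝ} (hT : IsBddSmooth T) (hT0 : ∀ t, 0 ≤ deriv T t)
    (hT1 : ∀ t, deriv T t ≤ 1) (hTz : ∀ t, |t| < 1 → T t = 0)
    (h0 : ∀ᵐ x ∂(volume.restrict Ω), T (u x) = 0) : ∀ᵐ x, T (u x) = 0 := by
  have hz : (fun x => g (u x) * T (u x)) =ᵐ[volume.restrict Ω] fun _ => 0 := by
    filter_upwards [h0] with x hx
    rw [hx, mul_zero]
  obtain ⟨H, hH, hle⟩ := h T hT hT0 hT1 hTz ((integrable_zero _ _ _).congr hz.symm)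
  rw [integral_congr_ae hz, integral_zero, ENNReal.ofReal_zero] at hle
  have h1 := (add_eq_zero.1 (le_antisymm hle bot_le)).2
  have hm : AEMeasurable (fun z => ‖diffQuot s (fun x => T (u x)) z‖ₑ ^ 2)
      (volume.restrict (crossSet Ω)) :=
    ((aestronglyMeasurable_diffQuot s hH.1.1).enorm.pow_const 2).restrict
  rw [lintegral_eq_zero_iff' hm] at h1
  -- the difference quotient vanishes on `Ω × ℝⁿ`; one good point of `Ω` is enough
  have hsub : Ω ×ˢ Set.univ ⊆ crossSet Ω := fun z hz hz' => hz'.1 hz.1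
  have h2 := ae_restrict_of_ae_restrict_of_subset hsub h1
  rw [Measure.volume_eq_prod, ← Measure.prod_restrict, Measure.restrict_univ] at h2
  have h3 := Measure.ae_ae_of_ae_prod h2
  have hpos : (volume.restrict Ω) ≠ 0 := by
    rw [Ne, Measure.restrict_eq_zero]
    exact (hΩ.measure_pos volume hne).ne'
  have : (ae (volume.restrict Ω)).NeBot := ae_neBot.2 hpos
  obtain ⟨x, hx, hx0⟩ := (h3.and h0).exists
  have : Nonempty (Fin n) := ⟨⟨0, hn⟩⟩
  filter_upwards [hx, Measure.ae_ne volume x] with y hy hyx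
  have h4 : diffQuot s (fun x => T (u x)) (x, y) = 0 := by
    simpa using hy
  have h5 : 0 < ‖x - y‖ := norm_pos_iff.2 (sub_ne_zero.2 hyx.symm)
  rw [diffQuot, div_eq_zero_iff, hx0, zero_sub, neg_eq_zero] at h4
  exact h4.resolve_right (Real.rpow_pos_of_pos h5 _).ne'

lemma smoothTruncation_eq_zero_of_abs_lt_one {k : ℝ} (hk : 1 ≤ k) (j : ℕ) (t : ℝ) (ht : |t| < 1) :
    smoothTruncation k j t = 0 :=
  smoothTruncation_eq_zero j ((le_abs_self t).trans (ht.le.trans hk))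

/-- An upper bound on `Ω` propagates to the whole space. -/
lemma HasTruncationBound.ae_le (hn : 0 < n) (hΩ : IsOpen Ω) (hne : Ω.Nonempty)
    (h : HasTruncationBound s Ω U g u) {k : ℝ} (hk : 1 ≤ k)
    (h0 : ∀ᵐ x ∂(volume.restrict Ω), u x ≤ k) : ∀ᵐ x, u x ≤ k := by
  have h1 : ∀ j, ∀ᵐ x, smoothTruncation k j (u x) = 0 := fun j =>
    h.ae_eq_zero hn hΩ hne (isBddSmooth_smoothTruncation k j) (deriv_smoothTruncation_nonneg k j)
      (deriv_smoothTruncation_le_one k j) (smoothTruncation_eq_zero_of_abs_lt_one hk j)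
      (h0.mono fun x hx => smoothTruncation_eq_zero j hx)
  filter_upwards [ae_all_iff.2 h1] with x hx
  have h2 := tendsto_smoothTruncation k (u x)
  simp only [hx] at h2
  have h3 := tendsto_nhds_unique h2 tendsto_const_nhds
  have := le_max_left (u x - k) 0
  linarith

/-- Since `u` is positive on `Ω`, its truncation below `-1` vanishes there, hence everywhere. -/
lemma HasTruncationBound.neg_one_le (hn : 0 < n) (hΩ : IsOpen Ω) (hne : Ω.Nonempty)
    (h : HasTruncationBound s Ω U g u) (h0 : ∀ᵐ x ∂(volume.restrict Ω), 0 < u x) :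
    ∀ᵐ x, -1 ≤ u x := by
  have h1 : ∀ j, ∀ᵐ x, -smoothTruncation 1 j (-u x) = 0 := fun j =>
    h.ae_eq_zero hn hΩ hne (isBddSmooth_smoothTruncation 1 j).neg_comp_neg
      (fun t => by rw [deriv_neg_comp_neg]; exact deriv_smoothTruncation_nonneg 1 j _)
      (fun t => by rw [deriv_neg_comp_neg]; exact deriv_smoothTruncation_le_one 1 j _)
      (fun t ht => by
        rw [smoothTruncation_eq_zero_of_abs_lt_one le_rfl j _ (by rwa [abs_neg]), neg_zero])
      (h0.mono fun x hx => by rw [smoothTruncation_eq_zero j (by linarith), neg_zero])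
  filter_upwards [ae_all_iff.2 h1] with x hx
  have h2 := tendsto_smoothTruncation 1 (-u x)
  simp only [neg_eq_zero] at hx
  simp only [hx] at h2
  have h3 := tendsto_nhds_unique h2 tendsto_const_nhds
  have := le_max_left (-u x - 1) 0
  linarith

/-- The Caccioppoli type inequality on super-level sets that starts the De Giorgi iteration. -/
lemma IsMixedDomain.exists_lintegral_level_le (hn : 2 < n) (hs0 : 0 < s)
    (hdom : IsMixedDomain Ω D N) :
    ∃ C : ℝ≥0∞, C ≠ ⊤ ∧ ∀ (g : ℝ → ℝ) (u : Euc n → ℝ), Measurable g → (∀ t, 1 ≤ t → 0 ≤ g t) →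
      AEMeasurable u (volume.restrict Ω) → HasTruncationBound s Ω (fullSet Ω N) g u →
      ∀ k, 1 ≤ k → ∫⁻ x in Ω, ENNReal.ofReal (g (u x)) * ENNReal.ofReal (u x - k) ≠ ⊤ →
      ∫⁻ x in Ω, ENNReal.ofReal (u x - k) ^ critExp n ≤
        (C * ∫⁻ x in Ω, ENNReal.ofReal (g (u x)) * ENNReal.ofReal (u x - k)) ^
          (critExp n / 2) := by
  obtain ⟨C, hC, hle⟩ := hdom.exists_lintegral_critExp_le hn hs0
  refine ⟨C, hC, fun g u hg hg0 hu htr k hk hfin => ?_⟩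
  have hr := two_lt_critExp hn
  set I := ∫⁻ x in Ω, ENNReal.ofReal (g (u x)) * ENNReal.ofReal (u x - k) with hI
  have hpt : ∀ j x, ‖g (u x) * smoothTruncation k j (u x)‖ₑ ≤
      ENNReal.ofReal (g (u x)) * ENNReal.ofReal (u x - k) := by
    intro j x
    rcases le_total (u x) k with h | h
    · simp [smoothTruncation_eq_zero j h]
    · rw [enorm_mul, Real.enorm_of_nonneg (hg0 _ (hk.trans h)),
        Real.enorm_of_nonneg (smoothTruncation_nonneg _ _ _)]
      gcongr
      refine (smoothTruncation_le k j (u x)).trans_eq (max_eq_left ?_)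
      linarith
  have hj : ∀ j, ∫⁻ x in Ω, ‖smoothTruncation k j (u x)‖ₑ ^ critExp n ≤
      (C * I) ^ (critExp n / 2) := by
    intro j
    have hint : IntegrableOn (fun x => g (u x) * smoothTruncation k j (u x)) Ω := by
      refine ⟨((hg.comp_aemeasurable hu).mul
        ((isBddSmooth_smoothTruncation k j).continuous.measurable.comp_aemeasurable
          hu)).aestronglyMeasurable, ?_⟩
      exact (lintegral_mono (hpt j)).trans_lt (lt_top_iff_ne_top.2 hfin)
    obtain ⟨H, hH, hen⟩ := htr _ (isBddSmooth_smoothTruncation k j)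
      (deriv_smoothTruncation_nonneg k j) (deriv_smoothTruncation_le_one k j)
      (smoothTruncation_eq_zero_of_abs_lt_one hk j) hint
    have h1 : ENNReal.ofReal (∫ x in Ω, g (u x) * smoothTruncation k j (u x)) ≤ I := by
      refine (ENNReal.ofReal_le_ofReal (le_abs_self _)).trans ?_
      rw [← Real.norm_eq_abs, ofReal_norm]
      exact (enorm_integral_le_lintegral_enorm _).trans (lintegral_mono (hpt j))
    have h2 := (hle _ H hH).trans (mul_le_mul_right (hen.trans h1) C)
    have h3 := ENNReal.rpow_le_rpow h2 (by linarith : 0 ≤ critExp n / 2)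
    rwa [← ENNReal.rpow_mul, div_mul_div_comm, mul_comm 2, div_self (by positivity),
      ENNReal.rpow_one] at h3
  calc ∫⁻ x in Ω, ENNReal.ofReal (u x - k) ^ critExp n
      = ∫⁻ x in Ω, liminf (fun j => ‖smoothTruncation k j (u x)‖ₑ ^ critExp n) atTop := by
        refine lintegral_congr fun x => ?_
        have h1 := ((tendsto_smoothTruncation k (u x)).enorm).ennrpow_const (critExp n)
        rw [h1.liminf_eq, Real.enorm_of_nonneg (le_max_right _ _)]
        simp
    _ ≤ liminf (fun j => ∫⁻ x in Ω, ‖smoothTruncation k j (u x)‖ₑ ^ critExp n) atTop := by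
        refine lintegral_liminf_le' fun j => ?_
        exact (((isBddSmooth_smoothTruncation k j).continuous.measurable.comp_aemeasurable
          hu).enorm).pow_const _
    _ ≤ (C * I) ^ (critExp n / 2) :=
        liminf_le_of_frequently_le' (Frequently.of_forall hj)

end Levels

/-! ### De Giorgi iteration -/

section DeGiorgi

/-- Superlinear recursion with geometric growth, started from a small value. -/
lemma tendsto_zero_of_fast_decay {y : ℕ → ℝ} {D B α : ℝ} (hα : 0 < α) (hB : 1 < B) (hD : 0 ≤ D)
    (hy : ∀ j, 0 ≤ y j) (hrec : ∀ j, y (j + 1) ≤ D * B ^ j * y j ^ (1 + α))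
    (h0 : D * y 0 ^ α * B ^ (1 / α) ≤ 1) : Tendsto y atTop (𝓝 0) := by
  have hB0 : 0 < B := by linarith
  -- the ratio `l` is chosen so that `B * l ^ α = 1`: the growth `B ^ j` is exactly compensated
  set l := B ^ (-(1 / α)) with hl
  have hl0 : 0 < l := Real.rpow_pos_of_pos hB0 _
  have hl1 : l < 1 := Real.rpow_lt_one_of_one_lt_of_neg hB (by simp [hα])
  have hlα : B * l ^ α = 1 := by
    rw [hl, ← Real.rpow_mul hB0.le, neg_mul, one_div, inv_mul_cancel₀ hα.ne', Real.rpow_neg_one,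
      mul_inv_cancel₀ hB0.ne']
  have h0' : D * y 0 ^ α ≤ l := by
    have h1 : B ^ (1 / α) * l = 1 := by
      rw [hl, ← Real.rpow_add hB0, add_neg_cancel, Real.rpow_zero]
    calc D * y 0 ^ α = (D * y 0 ^ α * B ^ (1 / α)) * l := by rw [mul_assoc, h1, mul_one]
      _ ≤ 1 * l := by gcongr
      _ = l := one_mul l
  have hle : ∀ j, y j ≤ y 0 * l ^ j := by
    intro j
    induction j with
    | zero => simp
    | succ j ih =>
      have hp : 0 ≤ y 0 * l ^ j := mul_nonneg (hy 0) (by positivity)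
      calc y (j + 1) ≤ D * B ^ j * y j ^ (1 + α) := hrec j
        _ ≤ D * B ^ j * (y 0 * l ^ j) ^ (1 + α) :=
            mul_le_mul_of_nonneg_left (Real.rpow_le_rpow (hy j) ih (by positivity))
              (by positivity)
        _ = D * B ^ j * ((y 0 * l ^ j) * (y 0 ^ α * (l ^ α) ^ j)) := by
            rw [Real.rpow_add_of_nonneg hp zero_le_one hα.le, Real.rpow_one,
              Real.mul_rpow (hy 0) (by positivity), ← Real.rpow_natCast l j, ← Real.rpow_mul hl0.le,
              ← Real.rpow_natCast (l ^ α), ← Real.rpow_mul hl0.le, mul_comm α]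
        _ = (D * y 0 ^ α) * (y 0 * l ^ j) * (B * l ^ α) ^ j := by rw [mul_pow]; ring
        _ = (D * y 0 ^ α) * (y 0 * l ^ j) := by rw [hlα, one_pow, mul_one]
        _ ≤ l * (y 0 * l ^ j) := by gcongr
        _ = y 0 * l ^ (j + 1) := by ring
  have hlim : Tendsto (fun j => y 0 * l ^ j) atTop (𝓝 0) := by
    simpa using (tendsto_pow_atTop_nhds_zero_of_lt_one hl0.le hl1).const_mul (y 0)
  exact tendsto_of_tendsto_of_tendsto_of_le_of_le tendsto_const_nhds hlim hy hle

variable {α : Type*} [MeasurableSpace α] {μ : Measure α} {u : α → ℝ} {r : ℝ}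

/-- Hölder's inequality on the super-level set `{u > k}`. -/
lemma lintegral_ofReal_sub_le (hu : AEMeasurable u μ) (hr : 1 < r) (k : ℝ) :
    ∫⁻ x, ENNReal.ofReal (u x - k) ∂μ ≤
      (∫⁻ x, ENNReal.ofReal (u x - k) ^ r ∂μ) ^ (1 / r) * μ {x | k < u x} ^ ((r - 1) / r) := by
  have hr0 : 0 < r := by linarith
  have hpq : r.HolderConjugate (r / (r - 1)) := Real.HolderConjugate.conjExponent hr
  have hnull : NullMeasurableSet {x | k < u x} μ := nullMeasurableSet_lt aemeasurable_const hu
  have h1 := ENNReal.lintegral_mul_le_Lp_mul_Lq μ hpq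
    (f := fun x => ENNReal.ofReal (u x - k)) (g := {x | k < u x}.indicator 1)
    (hu.sub_const k).ennreal_ofReal (aemeasurable_const.indicator₀ hnull)
  have h2 : ∀ x, ({x | k < u x}.indicator (1 : α → ℝ≥0∞) x) ^ (r / (r - 1)) =
      {x | k < u x}.indicator 1 x := by
    intro x
    by_cases hx : k < u x
    · simp [Set.indicator_of_mem (s := {x | k < u x}) hx]
    · rw [Set.indicator_of_notMem (s := {x | k < u x}) hx]
      exact ENNReal.zero_rpow_of_pos (div_pos hr0 (by linarith))
  simp_rw [h2] at h1
  rw [lintegral_indicator_one₀ hnull, one_div_div] at h1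
  refine le_trans (lintegral_mono fun x => ?_) h1
  by_cases hx : k < u x
  · simp [Set.indicator_of_mem (s := {x | k < u x}) hx]
  · simp [ENNReal.ofReal_of_nonpos (sub_nonpos.2 (not_lt.1 hx))]

/-- Chebyshev's inequality between two levels. -/
lemma ofReal_rpow_mul_measure_le (hu : AEMeasurable u μ) (hr : 0 < r) {k h : ℝ} (hkh : k ≤ h) :
    ENNReal.ofReal ((h - k) ^ r) * μ {x | h < u x} ≤ ∫⁻ x, ENNReal.ofReal (u x - k) ^ r ∂μ := by
  refine le_trans ?_ (mul_meas_ge_le_lintegral₀ ((hu.sub_const k).ennreal_ofReal.pow_const r)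
    (ENNReal.ofReal ((h - k) ^ r)))
  gcongr with x
  intro hx
  rw [← ENNReal.ofReal_rpow_of_nonneg (by linarith) hr.le]
  gcongr

/-- De Giorgi's iteration: if the level set functions `(u - k)⁺` satisfy the reverse inequality
`‖(u - k)⁺‖_r² ≤ a ‖(u - k)⁺‖₁` for `K ≤ k ≤ 2K`, then `u ≤ 2K` as soon as the measure of
`{u > K}` is small compared with `K` and `a`. -/
lemma ae_le_two_mul_of_level_inequality (hu : AEMeasurable u μ) (hr : 2 < r) {K a : ℝ} (hK : 0 < K)
    (ha : 0 ≤ a) (hfin : ∫⁻ x, ENNReal.ofReal (u x - K) ∂μ ≠ ⊤)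
    (hlev : ∀ k, K ≤ k → k ≤ 2 * K → ∫⁻ x, ENNReal.ofReal (u x - k) ^ r ∂μ ≤
      (ENNReal.ofReal a * ∫⁻ x, ENNReal.ofReal (u x - k) ∂μ) ^ (r / 2))
    (hμ : μ {x | K < u x} ≠ ⊤)
    (hsmall : a ^ r * μ.real {x | K < u x} ^ (r - 2) * (2 ^ r * (2 ^ r) ^ (1 / (r - 2))) ≤ K ^ r) :
    ∀ᵐ x ∂μ, u x ≤ 2 * K := by
  have hr0 : 0 < r := by linarith
  -- after Hölder's inequality, half of the exponent of `‖(u - k)⁺‖_r^r` can be absorbed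
  have hA : ∀ k, K ≤ k → k ≤ 2 * K → ∫⁻ x, ENNReal.ofReal (u x - k) ^ r ∂μ ≤
      ENNReal.ofReal (a ^ r) * μ {x | k < u x} ^ (r - 1) := by
    intro k hk hk'
    set W := ∫⁻ x, ENNReal.ofReal (u x - k) ^ r ∂μ with hW
    set m := μ {x | k < u x}
    have hφ : ∫⁻ x, ENNReal.ofReal (u x - k) ∂μ ≠ ⊤ :=
      ne_top_of_le_ne_top hfin (lintegral_mono fun x => ENNReal.ofReal_le_ofReal (by linarith))
    have hWle := hlev k hk hk'
    have hWtop : W ≠ ⊤ := ne_top_of_le_ne_top (ENNReal.rpow_ne_top_of_nonneg (by linarith)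
      (ENNReal.mul_ne_top ENNReal.ofReal_ne_top hφ)) hWle
    rcases eq_or_ne W 0 with h0 | h0
    · rw [h0]; exact bot_le
    have h1 : W ≤ (ENNReal.ofReal a * (W ^ (1 / r) * m ^ ((r - 1) / r))) ^ (r / 2) :=
      hWle.trans (by
        gcongr
        exact lintegral_ofReal_sub_le hu (by linarith) k)
    have h2 : (ENNReal.ofReal a * (W ^ (1 / r) * m ^ ((r - 1) / r))) ^ (r / 2) =
        (ENNReal.ofReal a ^ r * m ^ (r - 1)) ^ (1 / 2 : ℝ) * W ^ (1 / 2 : ℝ) := by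
      have hh : (0 : ℝ) ≤ r / 2 := by linarith
      have hh' : (0 : ℝ) ≤ 1 / 2 := by norm_num
      rw [ENNReal.mul_rpow_of_nonneg _ _ hh, ENNReal.mul_rpow_of_nonneg _ _ hh,
        ENNReal.mul_rpow_of_nonneg _ _ hh', ← ENNReal.rpow_mul, ← ENNReal.rpow_mul,
        ← ENNReal.rpow_mul, ← ENNReal.rpow_mul]
      have e1 : 1 / r * (r / 2) = 1 / 2 := by field_simp
      have e2 : (r - 1) / r * (r / 2) = (r - 1) * (1 / 2) := by field_simp
      have e3 : r / 2 = r * (1 / 2) := by ring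
      rw [e1, e2, e3]
      ring
    rw [h2] at h1
    have hW2 : W = W ^ (1 / 2 : ℝ) * W ^ (1 / 2 : ℝ) := by
      rw [← ENNReal.rpow_add _ _ h0 hWtop]
      norm_num
    have h3 : W ^ (1 / 2 : ℝ) ≤ (ENNReal.ofReal a ^ r * m ^ (r - 1)) ^ (1 / 2 : ℝ) := by
      refine (ENNReal.mul_le_mul_iff_left (c := W ^ (1 / 2 : ℝ)) ?_ ?_).1 (hW2.symm.le.trans h1)
      · exact (ENNReal.rpow_pos (pos_iff_ne_zero.2 h0) hWtop).ne'
      · exact ENNReal.rpow_ne_top_of_nonneg (by norm_num) hWtop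
    rw [← ENNReal.ofReal_rpow_of_nonneg ha hr0.le]
    exact (ENNReal.rpow_le_rpow_iff (by norm_num)).1 h3
  have hfinite : ∀ k, K ≤ k → μ {x | k < u x} ≠ ⊤ := fun k hk =>
    ne_top_of_le_ne_top hμ (measure_mono fun x hx => lt_of_le_of_lt hk hx)
  -- levels increasing from `K` to `2K`
  let κ : ℕ → ℝ := fun j => K * (2 - (1 / 2) ^ j)
  have hpow : ∀ j : ℕ, (0 : ℝ) < (1 / 2) ^ j ∧ ((1 : ℝ) / 2) ^ j ≤ 1 := fun j =>
    ⟨by positivity, pow_le_one₀ (by norm_num) (by norm_num)⟩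
  have hκ1 : ∀ j, K ≤ κ j := fun j => le_mul_of_one_le_right hK.le (by linarith [(hpow j).2])
  have hκ2 : ∀ j, κ j ≤ 2 * K := fun j => by
    rw [mul_comm 2]
    exact mul_le_mul_of_nonneg_left (by linarith [(hpow j).1]) hK.le
  have hκ3 : ∀ j, κ (j + 1) - κ j = K / 2 * (1 / 2) ^ j := fun j => by
    simp only [κ, pow_succ]; ring
  let y : ℕ → ℝ := fun j => μ.real {x | κ j < u x}
  have hrec : ∀ j, y (j + 1) ≤ (a ^ r * 2 ^ r / K ^ r) * (2 ^ r) ^ j * y j ^ (1 + (r - 2)) := by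
    intro j
    have hd : κ j ≤ κ (j + 1) := by
      have := hκ3 j
      have : 0 ≤ K / 2 * (1 / 2) ^ j := by positivity
      linarith
    have h1 := (ofReal_rpow_mul_measure_le hu hr0 hd).trans (hA (κ j) (hκ1 j) (hκ2 j))
    have h2 := ENNReal.toReal_mono (ENNReal.mul_ne_top ENNReal.ofReal_ne_top
      (ENNReal.rpow_ne_top_of_nonneg (by linarith) (hfinite _ (hκ1 j)))) h1
    rw [ENNReal.toReal_mul, ENNReal.toReal_mul, ← ENNReal.toReal_rpow,
      ENNReal.toReal_ofReal (by positivity), hκ3,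
      ENNReal.toReal_ofReal (by positivity)] at h2
    have h3 : (K / 2 * (1 / 2) ^ j) ^ r = K ^ r / (2 ^ r * (2 ^ r) ^ j) := by
      rw [Real.mul_rpow (by positivity) (by positivity), Real.div_rpow hK.le (by norm_num),
        ← Real.rpow_natCast (1 / 2) j, ← Real.rpow_mul (by norm_num), mul_comm (j : ℝ),
        Real.rpow_mul (by norm_num), Real.rpow_natCast, Real.div_rpow (by norm_num) (by norm_num),
        Real.one_rpow, div_pow, one_pow, div_mul_div_comm, mul_one]
    rw [h3, div_mul_eq_mul_div, div_le_iff₀ (by positivity)] at h2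
    have hKr : 0 < K ^ r := by positivity
    have e : 1 + (r - 2) = r - 1 := by ring
    rw [e]
    calc y (j + 1) = (K ^ r * y (j + 1)) / K ^ r := by field_simp
      _ ≤ (a ^ r * y j ^ (r - 1) * (2 ^ r * (2 ^ r) ^ j)) / K ^ r :=
          div_le_div_of_nonneg_right h2 hKr.le
      _ = _ := by ring
  have hlim := tendsto_zero_of_fast_decay (y := y) (α := r - 2) (B := 2 ^ r)
    (D := a ^ r * 2 ^ r / K ^ r) (by linarith) (Real.one_lt_rpow (by norm_num) hr0) (by positivity)
    (fun j => measureReal_nonneg) hrec ?_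
  · have hy2 : ∀ j, μ.real {x | 2 * K < u x} ≤ y j := fun j =>
      measureReal_mono (fun x hx => lt_of_le_of_lt (hκ2 j) hx) (hfinite _ (hκ1 j))
    have h1 : μ.real {x | 2 * K < u x} ≤ 0 := ge_of_tendsto' hlim hy2
    have h2 : μ {x | 2 * K < u x} = 0 :=
      (measureReal_eq_zero_iff (hfinite _ (by linarith))).1 (le_antisymm h1 measureReal_nonneg)
    rw [ae_iff]
    simpa only [not_le] using h2
  · have hy0 : y 0 = μ.real {x | K < u x} := by
      simp only [y, κ, pow_zero]
      norm_num
    rw [hy0]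
    have hKr : 0 < K ^ r := by positivity
    calc _ = (a ^ r * μ.real {x | K < u x} ^ (r - 2) * (2 ^ r * (2 ^ r) ^ (1 / (r - 2)))) /
          K ^ r := by ring
      _ ≤ 1 := (div_le_one hKr).2 hsmall

end DeGiorgi

/-! ### Bounds for solutions -/

section Bounds

variable {s : ℝ} {Ω D N : Set (Euc n)} {g : ℝ → ℝ} {u : Euc n → ℝ}

lemma lintegral_ofReal_sub_ne_top {α : Type*} [MeasurableSpace α] {μ : Measure α} {u : α → ℝ}
    (hu : Integrable u μ) {k : ℝ} (hk : 0 ≤ k) : ∫⁻ x, ENNReal.ofReal (u x - k) ∂μ ≠ ⊤ := by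
  refine ne_top_of_le_ne_top hu.2.ne (lintegral_mono fun x => ?_)
  rw [← ofReal_norm, Real.norm_eq_abs]
  exact ENNReal.ofReal_le_ofReal (by linarith [le_abs_self (u x)])

lemma IsMixedDomain.isFiniteMeasure (h : IsMixedDomain Ω D N) :
    IsFiniteMeasure (volume.restrict Ω) :=
  ⟨by
    rw [Measure.restrict_apply_univ]
    exact (h.bounded.subset Set.subset_union_left).measure_lt_top⟩

/-- A bound on `Ω` that depends only on the domain, when `g ≤ 1` on `[1, ∞)`. -/
lemma IsMixedDomain.exists_bound_of_le_one (hn : 2 < n) (hs0 : 0 < s) (h : IsMixedDomain Ω D N) :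
    ∃ M : ℝ, ∀ (g : ℝ → ℝ) (u : Euc n → ℝ), Measurable g → (∀ t, 1 ≤ t → 0 ≤ g t ∧ g t ≤ 1) →
      MemLp u 2 volume → HasTruncationBound s Ω (fullSet Ω N) g u →
      ∀ᵐ x ∂(volume.restrict Ω), u x ≤ M := by
  obtain ⟨C, hC, hle⟩ := h.exists_lintegral_level_le hn hs0
  have hr := two_lt_critExp hn
  have := h.isFiniteMeasure
  set r := critExp n
  set B := C.toReal ^ r * volume.real Ω ^ (r - 2) * (2 ^ r * (2 ^ r) ^ (1 / (r - 2))) with hB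
  have hB0 : 0 ≤ B := by positivity
  set K := max 1 (B ^ (1 / r)) with hK
  have hK1 : 1 ≤ K := le_max_left _ _
  have hBK : B ≤ K ^ r := by
    have h1 : (B ^ (1 / r)) ^ r = B := by
      rw [← Real.rpow_mul hB0, one_div, inv_mul_cancel₀ (by linarith), Real.rpow_one]
    rw [← h1]
    exact Real.rpow_le_rpow (by positivity) (le_max_right _ _) (by linarith)
  refine ⟨2 * K, fun g u hg hg1 hu htr => ?_⟩
  have hui : Integrable u (volume.restrict Ω) := (hu.restrict Ω).integrable (by norm_num)
  have hum := hui.1.aemeasurable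
  refine ae_le_two_mul_of_level_inequality hum hr (K := K) (a := C.toReal) (by linarith)
    ENNReal.toReal_nonneg (lintegral_ofReal_sub_ne_top hui (by linarith)) (fun k hk _ => ?_)
    (measure_ne_top _ _) ?_
  · have hk1 : 1 ≤ k := hK1.trans hk
    have h1 : ∫⁻ x in Ω, ENNReal.ofReal (g (u x)) * ENNReal.ofReal (u x - k) ≤
        ∫⁻ x in Ω, ENNReal.ofReal (u x - k) := by
      refine lintegral_mono fun x => ?_
      rcases le_total (u x) k with h | h
      · simp [ENNReal.ofReal_of_nonpos (sub_nonpos.2 h)]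
      · exact mul_le_of_le_one_left bot_le
          (ENNReal.ofReal_le_one.2 (hg1 _ (hk1.trans h)).2)
    refine (hle g u hg (fun t ht => (hg1 t ht).1) hum htr k hk1
      (ne_top_of_le_ne_top (lintegral_ofReal_sub_ne_top hui (by linarith)) h1)).trans ?_
    rw [ENNReal.ofReal_toReal hC]
    gcongr
  · refine le_trans ?_ hBK
    rw [hB]
    have h2 : (volume.restrict Ω).real {x | K < u x} ≤ volume.real Ω :=
      ENNReal.toReal_mono (h.bounded.subset Set.subset_union_left).measure_lt_top.ne
        ((measure_mono (Set.subset_univ _)).trans_eq (Measure.restrict_apply_univ _))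
    have h3 : 0 ≤ r - 2 := by linarith
    gcongr

lemma le_two_mul_of_le_half_add {x y : ℝ≥0∞} (hx : x ≠ ⊤) (h : x ≤ x / 2 + y) : x ≤ 2 * y := by
  have h1 : x / 2 + x / 2 ≤ x / 2 + y := (ENNReal.add_halves x).le.trans h
  have h2 : x / 2 ≤ y := (ENNReal.add_le_add_iff_left
    (ne_top_of_le_ne_top hx ENNReal.half_le_self)).1 h1
  calc x = x / 2 + x / 2 := (ENNReal.add_halves x).symm
    _ ≤ y + y := add_le_add h2 h2
    _ = 2 * y := (two_mul y).symm

lemma tendsto_lintegral_superlevel {α : Type*} [MeasurableSpace α] {μ : Measure α} {u : α → ℝ}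
    (hu : AEMeasurable u μ) {f : α → ℝ≥0∞} (hf : AEMeasurable f μ) (hfin : ∫⁻ x, f x ∂μ ≠ ⊤) :
    Tendsto (fun j : ℕ => ∫⁻ x, {x | (j : ℝ) < u x}.indicator f x ∂μ) atTop (𝓝 0) := by
  have h := tendsto_lintegral_of_dominated_convergence' (μ := μ)
    (F := fun (j : ℕ) => {x | (j : ℝ) < u x}.indicator f) (f := fun _ => 0) f
    (fun j => hf.indicator₀ (nullMeasurableSet_lt aemeasurable_const hu))
    (fun j => Eventually.of_forall fun x => Set.indicator_le_self _ _ x) hfin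
    (Eventually.of_forall fun x => ?_)
  · simpa using h
  · refine tendsto_const_nhds.congr' ?_
    filter_upwards [tendsto_natCast_atTop_atTop.eventually_ge_atTop (u x)] with j hj
    exact (Set.indicator_of_notMem (s := {x | (j : ℝ) < u x}) (not_lt.2 hj) f).symm

/-- Splitting of the critical growth term on `{u > k}`, from
`t ^ (r - 1) ≤ 2 ^ (r - 2) ((t - k) ^ (r - 1) + k ^ (r - 1))`. -/
lemma ofReal_mul_ofReal_sub_le {r Λ t k y : ℝ} (hr : 2 < r) (hk : 0 ≤ k) (hΛ : 0 ≤ Λ)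
    (hy : k ≤ t → y ≤ Λ * t ^ (r - 1)) :
    ENNReal.ofReal y * ENNReal.ofReal (t - k) ≤ ENNReal.ofReal (Λ * 2 ^ (r - 2)) *
      (ENNReal.ofReal (t - k) ^ r + ENNReal.ofReal (k ^ (r - 1)) * ENNReal.ofReal (t - k)) := by
  rcases le_total t k with h | h
  · simp [ENNReal.ofReal_of_nonpos (sub_nonpos.2 h)]
  · have h0 : 0 ≤ t - k := sub_nonneg.2 h
    rw [ENNReal.ofReal_rpow_of_nonneg h0 (by linarith), ← ENNReal.ofReal_mul' h0,
      ← ENNReal.ofReal_mul (by positivity), ← ENNReal.ofReal_add (by positivity) (by positivity),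
      ← ENNReal.ofReal_mul (by positivity)]
    refine ENNReal.ofReal_le_ofReal ?_
    have h1 : t ^ (r - 1) ≤ 2 ^ (r - 2) * ((t - k) ^ (r - 1) + k ^ (r - 1)) := by
      have := NNReal.coe_le_coe.2 (NNReal.rpow_add_le_mul_rpow_add_rpow (t - k).toNNReal
        k.toNNReal (p := r - 1) (by linarith))
      simp only [NNReal.coe_rpow, NNReal.coe_add, NNReal.coe_mul, NNReal.coe_ofNat,
        Real.coe_toNNReal _ h0, Real.coe_toNNReal _ hk] at this
      rwa [sub_add_cancel, sub_sub, show (1 : ℝ) + 1 = 2 by norm_num] at this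
    have h2 : (t - k) ^ r = (t - k) ^ (r - 1) * (t - k) := by
      have := Real.rpow_add_of_nonneg h0 (y := r - 1) (z := 1) (by linarith) zero_le_one
      rwa [sub_add_cancel, Real.rpow_one] at this
    rw [h2]
    calc y * (t - k) ≤ (Λ * (2 ^ (r - 2) * ((t - k) ^ (r - 1) + k ^ (r - 1)))) * (t - k) := by
          gcongr
          exact (hy h).trans (by gcongr)
      _ = _ := by ring

/-- A bound on `Ω` for nonlinearities of critical growth. The superlinear part of the level set
inequality is absorbed at levels above which the critical norm of `u` is small. -/
lemma IsMixedDomain.exists_bound_of_critical (hn : 2 < n) (hs0 : 0 < s) (h : IsMixedDomain Ω D N)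
    (hg : Measurable g) {Λ : ℝ} (hΛ : 0 ≤ Λ)
    (hgΛ : ∀ t, 1 ≤ t → 0 ≤ g t ∧ g t ≤ Λ * t ^ (critExp n - 1))
    (hu : MemLp u (ENNReal.ofReal (critExp n)) (volume.restrict Ω))
    (htr : HasTruncationBound s Ω (fullSet Ω N) g u) :
    ∃ M : ℝ, ∀ᵐ x ∂(volume.restrict Ω), u x ≤ M := by
  obtain ⟨C, hC, hle⟩ := h.exists_lintegral_level_le hn hs0
  have hr := two_lt_critExp hn
  have := h.isFiniteMeasure
  set r := critExp n
  have hr0 : 0 < r := by linarith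
  have hui : Integrable u (volume.restrict Ω) := hu.integrable (by simp; linarith)
  have hum := hui.1.aemeasurable
  have hfr : AEMeasurable (fun x => ENNReal.ofReal (u x) ^ r) (volume.restrict Ω) :=
    hum.ennreal_ofReal.pow_const r
  have hfin : ∫⁻ x in Ω, ENNReal.ofReal (u x) ^ r ≠ ⊤ := by
    have h1 := hu.2
    rw [eLpNorm_lt_top_iff_lintegral_rpow_enorm_lt_top (by simp; linarith) ENNReal.ofReal_ne_top,
      ENNReal.toReal_ofReal hr0.le] at h1
    refine ne_top_of_le_ne_top h1.ne (lintegral_mono fun x => ?_)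
    gcongr
    exact Real.ofReal_le_enorm _
  let E : ℕ → ℝ≥0∞ := fun j =>
    ∫⁻ x in Ω, {x | (j : ℝ) < u x}.indicator (fun x => ENNReal.ofReal (u x) ^ r) x
  have hE : Tendsto E atTop (𝓝 0) := tendsto_lintegral_superlevel hum hfr hfin
  have hEtop : ∀ j, E j ≠ ⊤ := fun j =>
    ne_top_of_le_ne_top hfin (lintegral_mono fun x => Set.indicator_le_self _ _ x)
  set C' : ℝ≥0∞ := C * ENNReal.ofReal (Λ * 2 ^ (r - 2)) with hC'
  have hC'top : C' ≠ ⊤ := ENNReal.mul_ne_top hC ENNReal.ofReal_ne_top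
  set c : ℝ := 2 ^ r * (2 ^ r) ^ (1 / (r - 2)) with hc
  set b : ℝ := 2 * C'.toReal * 2 ^ (r - 1) with hb
  have hexp : 0 < 1 - 2 / r := by
    rw [sub_pos, div_lt_one hr0]
    exact hr
  have hev1 : ∀ᶠ j in atTop, C' * E j ^ (1 - 2 / r) < 1 / 2 := by
    have h1 := ENNReal.Tendsto.const_mul (a := C') (hE.ennrpow_const (1 - 2 / r)) (Or.inr hC'top)
    rw [ENNReal.zero_rpow_of_pos hexp, mul_zero] at h1
    exact h1.eventually_lt_const (by simp)
  have hev2 : ∀ᶠ j in atTop, b ^ r * c * (E j).toReal ^ (r - 2) < 1 := by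
    have h1 := (((ENNReal.tendsto_toReal ENNReal.zero_ne_top).comp hE).rpow_const
      (p := r - 2) (Or.inr (by linarith))).const_mul (b ^ r * c)
    rw [ENNReal.toReal_zero, Real.zero_rpow (by linarith), mul_zero] at h1
    exact h1.eventually_lt_const zero_lt_one
  obtain ⟨j, hj1, hj2, hjone⟩ := (hev1.and (hev2.and (eventually_ge_atTop 1))).exists
  set K : ℝ := (j : ℝ) with hKdef
  have hK1 : 1 ≤ K := by rw [hKdef]; exact_mod_cast hjone
  have hK0 : 0 < K := by linarith
  set a : ℝ := 2 * C'.toReal * (2 * K) ^ (r - 1) with ha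
  have hfink : ∀ k, 0 ≤ k → ∫⁻ x in Ω, ENNReal.ofReal (u x - k) ≠ ⊤ := fun k hk =>
    lintegral_ofReal_sub_ne_top hui hk
  refine ⟨2 * K, ae_le_two_mul_of_level_inequality hum hr (K := K) (a := a) hK0 (by positivity)
    (hfink K hK0.le) (fun k hk hk' => ?_) (measure_ne_top _ _) ?_⟩
  · have hk1 : 1 ≤ k := hK1.trans hk
    have hk0 : 0 ≤ k := by linarith
    set W := ∫⁻ x in Ω, ENNReal.ofReal (u x - k) ^ r with hW
    set φ := ∫⁻ x in Ω, ENNReal.ofReal (u x - k) with hφ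
    have hWE : W ≤ E j := by
      refine lintegral_mono fun x => ?_
      by_cases hx : K < u x
      · rw [Set.indicator_of_mem (s := {x | (j : ℝ) < u x}) hx]
        gcongr
        linarith
      · rw [ENNReal.ofReal_of_nonpos (by linarith [not_lt.1 hx]),
          ENNReal.zero_rpow_of_pos hr0]
        exact bot_le
    have hWtop : W ≠ ⊤ := ne_top_of_le_ne_top (hEtop j) hWE
    have hJ : ∫⁻ x in Ω, ENNReal.ofReal (g (u x)) * ENNReal.ofReal (u x - k) ≤
        ENNReal.ofReal (Λ * 2 ^ (r - 2)) * (W + ENNReal.ofReal (k ^ (r - 1)) * φ) := by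
      refine (lintegral_mono fun x => ofReal_mul_ofReal_sub_le hr hk0 hΛ
        fun hx => (hgΛ (u x) (hk1.trans hx)).2).trans_eq ?_
      rw [lintegral_const_mul' _ _ ENNReal.ofReal_ne_top, lintegral_add_left'
        ((hum.sub_const k).ennreal_ofReal.pow_const r),
        lintegral_const_mul' _ _ ENNReal.ofReal_ne_top]
    have hJtop : ∫⁻ x in Ω, ENNReal.ofReal (g (u x)) * ENNReal.ofReal (u x - k) ≠ ⊤ :=
      ne_top_of_le_ne_top (ENNReal.mul_ne_top ENNReal.ofReal_ne_top (ENNReal.add_ne_top.2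
        ⟨hWtop, ENNReal.mul_ne_top ENNReal.ofReal_ne_top (hfink k hk0)⟩)) hJ
    have hmain := hle g u hg (fun t ht => (hgΛ t ht).1) hum htr k hk1 hJtop
    rcases eq_or_ne W 0 with h0 | h0
    · rw [h0]; exact bot_le
    have h1 : W ^ (2 / r) ≤ C' * W + C' * (ENNReal.ofReal (k ^ (r - 1)) * φ) := by
      have h2 := ENNReal.rpow_le_rpow hmain (by positivity : 0 ≤ 2 / r)
      rw [← ENNReal.rpow_mul, div_mul_div_comm, mul_comm r 2, div_self (by positivity),
        ENNReal.rpow_one] at h2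
      refine h2.trans ((mul_le_mul_right hJ C).trans_eq ?_)
      rw [← mul_assoc, mul_add]
    -- the superlinear term is absorbed, since `W ^ (1 - 2 / r)` is small
    have h3 : C' * W ≤ W ^ (2 / r) / 2 := by
      have h4 : W = W ^ (1 - 2 / r) * W ^ (2 / r) := by
        rw [← ENNReal.rpow_add _ _ h0 hWtop, sub_add_cancel, ENNReal.rpow_one]
      calc C' * W = C' * W ^ (1 - 2 / r) * W ^ (2 / r) := by rw [mul_assoc C' (_ ^ _), ← h4]
        _ ≤ 1 / 2 * W ^ (2 / r) := by
            gcongr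
            exact le_trans (by gcongr) hj1.le
        _ = W ^ (2 / r) / 2 := by rw [one_div, ENNReal.div_eq_inv_mul]
    have h5 := le_two_mul_of_le_half_add
      (ENNReal.rpow_ne_top_of_nonneg (by positivity) hWtop) (h1.trans (add_le_add_left h3 _))
    have h6 : 2 * (C' * (ENNReal.ofReal (k ^ (r - 1)) * φ)) ≤ ENNReal.ofReal a * φ := by
      rw [← mul_assoc, ← mul_assoc]
      gcongr
      rw [ha, ENNReal.ofReal_mul (by positivity), ENNReal.ofReal_mul (by norm_num),
        ENNReal.ofReal_toReal hC'top, ENNReal.ofReal_ofNat]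
      gcongr
      linarith
    have h7 := ENNReal.rpow_le_rpow (h5.trans h6) (by positivity : 0 ≤ r / 2)
    rwa [← ENNReal.rpow_mul, div_mul_div_comm, mul_comm 2 r, div_self (by positivity),
      ENNReal.rpow_one] at h7
  · set m := (volume.restrict Ω).real {x | K < u x} with hm
    -- Chebyshev's inequality makes the smallness condition scale invariant: `a ^ r` grows like
    -- `K ^ (r (r - 1))`, which is balanced by `(K ^ r * m) ^ (r - 2)`
    have hKm : K ^ r * m ≤ (E j).toReal := by
      have h1 : ENNReal.ofReal (K ^ r) * (volume.restrict Ω) {x | K < u x} ≤ E j := by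
        have hnull : NullMeasurableSet {x | K < u x} (volume.restrict Ω) :=
          nullMeasurableSet_lt aemeasurable_const hum
        rw [← lintegral_indicator_const₀ hnull]
        refine lintegral_mono fun x => ?_
        by_cases hx : K < u x
        · rw [Set.indicator_of_mem (s := {x | K < u x}) hx,
            Set.indicator_of_mem (s := {x | (j : ℝ) < u x}) hx,
            ← ENNReal.ofReal_rpow_of_nonneg hK0.le hr0.le]
          gcongr
        · rw [Set.indicator_of_notMem (s := {x | K < u x}) hx]
          exact bot_le
      have h2 := ENNReal.toReal_mono (hEtop j) h1
      rwa [ENNReal.toReal_mul, ENNReal.toReal_ofReal (by positivity)] at h2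
    have hm0 : 0 ≤ m := measureReal_nonneg
    have h1 : a ^ r = b ^ r * ((K ^ r) ^ (r - 2) * K ^ r) := by
      have e : a = b * K ^ (r - 1) := by
        rw [ha, hb, Real.mul_rpow (by norm_num) hK0.le]
        ring
      rw [e, Real.mul_rpow (by positivity) (by positivity)]
      congr 1
      rw [← Real.rpow_mul hK0.le, ← Real.rpow_mul hK0.le, ← Real.rpow_add hK0]
      congr 1
      ring
    calc a ^ r * m ^ (r - 2) * c = (b ^ r * c * (K ^ r * m) ^ (r - 2)) * K ^ r := by
          rw [h1, Real.mul_rpow (by positivity) hm0]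
          ring
      _ ≤ 1 * K ^ r := by
          gcongr
          refine le_trans ?_ hj2.le
          have : 0 ≤ r - 2 := by linarith
          gcongr
      _ = K ^ r := one_mul _

lemma HasTruncationBound.ae_abs_le (hn : 0 < n) (h : IsMixedDomain Ω D N)
    (htr : HasTruncationBound s Ω (fullSet Ω N) g u)
    (hpos : ∀ᵐ x ∂(volume.restrict Ω), 0 < u x) {M : ℝ}
    (hM : ∀ᵐ x ∂(volume.restrict Ω), u x ≤ M) : ∀ᵐ x, ‖u x‖ ≤ max M 1 := by
  filter_upwards [htr.neg_one_le hn h.isOpen_domain h.nonempty_domain hpos,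
    htr.ae_le hn h.isOpen_domain h.nonempty_domain (le_max_right M 1)
      (hM.mono fun x hx => hx.trans (le_max_left _ _))] with x h1 h2
  rw [Real.norm_eq_abs, abs_le]
  exact ⟨by linarith [le_max_right M 1], h2⟩

lemma IsWeakSolution.hasTruncationBound (hn : 0 < n) (hs0 : 0 < s) (hs1 : s < 1)
    (h : IsMixedDomain Ω D N) (hu : IsWeakSolution s Ω N g u) :
    HasTruncationBound s Ω (fullSet Ω N) g u := by
  obtain ⟨G, hG, -, hweak⟩ := hu
  exact hasTruncationBound_of_memXWith hn hs0 hs1 h.isOpen_domain h.isOpen_neumann hG hweak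

/-- A bound for weak solutions that depends on the domain only, and so passes to limits of solutions. -/
lemma IsMixedDomain.exists_norm_le_of_isWeakSolution (hn : 2 < n) (hs0 : 0 < s) (hs1 : s < 1)
    (h : IsMixedDomain Ω D N) :
    ∃ M : ℝ, ∀ (g : ℝ → ℝ) (u : Euc n → ℝ), Measurable g → (∀ t, 1 ≤ t → 0 ≤ g t ∧ g t ≤ 1) →
      IsWeakSolution s Ω N g u → AEStronglyMeasurable u volume ∧ ∀ᵐ x, ‖u x‖ ≤ M := by
  obtain ⟨M, hM⟩ := h.exists_bound_of_le_one hn hs0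
  refine ⟨max M 1, fun g u hg hg1 hu => ?_⟩
  have htr := hu.hasTruncationBound (by lia) hs0 hs1 h
  obtain ⟨G, hG, hpos, -⟩ := hu
  exact ⟨hG.1.1, htr.ae_abs_le (by lia) h hpos (hM g u hg hg1 hG.1 htr)⟩

lemma memLinfty_of_ae_norm_le {U : Set (Euc n)} (hu : AEStronglyMeasurable u volume) {M : ℝ}
    (hM : ∀ᵐ x, ‖u x‖ ≤ M) : MemLinfty U u :=
  memLp_top_of_bound hu.restrict M (ae_restrict_of_ae hM)

end Bounds

end MixedNeumann


open MixedNeumann in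
theorem theorem2p4 (n : ℕ) (hn : 2 < n) (s : ℝ) (hs0 : 0 < s) (hs1 : s < 1)
    (Ω D N : Set (MixedNeumann.Euc n)) (hΩ : MixedNeumann.IsMixedDomain Ω D N) :
    (∀ q : ℝ, 0 < q → ∀ u : MixedNeumann.Euc n → ℝ,
      MixedNeumann.IsWeakSolution s Ω N (fun t => t ^ (-q)) u →
        MixedNeumann.MemLinfty (MixedNeumann.fullSet Ω N) u) ∧
    (∀ q : ℝ, 1 < q → ∀ u : MixedNeumann.Euc n → ℝ,
      MixedNeumann.IsLocalWeakSolution s q Ω N u →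
        MixedNeumann.MemLinfty (MixedNeumann.fullSet Ω N) u) ∧
    (∀ q : ℝ, 0 < q → ∀ (v : ℕ → MixedNeumann.Euc n → ℝ) (u : MixedNeumann.Euc n → ℝ),
      (∀ k : ℕ, MixedNeumann.IsWeakSolution s Ω N
        (fun t => (t + 1 / ((k : ℝ) + 1)) ^ (-q)) (v k)) →
      (∀ᵐ x, Tendsto (fun k => v k x) atTop (𝓝 (u x))) →
        MixedNeumann.MemLinfty (MixedNeumann.fullSet Ω N) u) ∧
    (∀ q p lam : ℝ, 0 < q → q < 1 → 1 < p → p ≤ 2 * (n : ℝ) / ((n : ℝ) - 2) - 1 → 0 < lam →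
      ∀ u : MixedNeumann.Euc n → ℝ,
        MixedNeumann.IsWeakSolution s Ω N (fun t => lam * t ^ (-q) + t ^ p) u →
          MixedNeumann.MemLinfty (MixedNeumann.fullSet Ω N) u) := by
  have hn0 : 0 < n := by lia
  have hpow : ∀ {q : ℝ}, 0 < q → ∀ t : ℝ, 1 ≤ t → 0 ≤ t ^ (-q) ∧ t ^ (-q) ≤ 1 := fun hq t ht =>
    ⟨Real.rpow_nonneg (by linarith) _,
      Real.rpow_le_one_of_one_le_of_nonpos ht (by linarith)⟩
  refine ⟨fun q hq u hu => ?_, fun q hq u hu => ?_, fun q hq v u hv hlim => ?_,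
    fun q p lam hq hq1 hp hpr hlam u hu => ?_⟩
  · obtain ⟨M, hM⟩ := hΩ.exists_norm_le_of_isWeakSolution hn hs0 hs1
    obtain ⟨hum, hb⟩ := hM _ u (by fun_prop) (hpow hq) hu
    exact memLinfty_of_ae_norm_le hum hb
  · obtain ⟨hu0, hpos, hX, G, hloc, hweak⟩ := hu
    obtain ⟨hu2, htr⟩ := hasTruncationBound_of_memXLocWith hn0 hs0 hs1 hΩ.isOpen_domain
      hΩ.isOpen_neumann hΩ.isBounded_fullSet hu0 (by linarith) hX hloc hweak
    obtain ⟨M, hM⟩ := hΩ.exists_bound_of_le_one (s := s) hn hs0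
    exact memLinfty_of_ae_norm_le hu2.1 (htr.ae_abs_le hn0 hΩ hpos
      (hM _ u (by fun_prop) (hpow (by linarith)) hu2 htr))
  · obtain ⟨M, hM⟩ := hΩ.exists_norm_le_of_isWeakSolution hn hs0 hs1
    have hk : ∀ k, AEStronglyMeasurable (v k) volume ∧ ∀ᵐ x, ‖v k x‖ ≤ M := fun k =>
      hM _ (v k) (by fun_prop) (fun t ht => hpow hq _ (by
        have : (0 : ℝ) ≤ 1 / ((k : ℝ) + 1) := by positivity
        linarith)) (hv k)
    refine memLinfty_of_ae_norm_le (M := M)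
      (aestronglyMeasurable_of_tendsto_ae atTop (fun k => (hk k).1) hlim) ?_
    filter_upwards [hlim, ae_all_iff.2 fun k => (hk k).2] with x hx hxM
    exact le_of_tendsto hx.norm (Eventually.of_forall hxM)
  · have htr := hu.hasTruncationBound hn0 hs0 hs1 hΩ
    obtain ⟨G, hG, hpos, -⟩ := hu
    have hw := isTestLimit_of_memXWith
      (measurableSet_fullSet hΩ.isOpen_domain hΩ.isOpen_neumann) hG
    obtain ⟨C, hC, hle⟩ := hΩ.exists_eLpNorm_critExp_le hn
    have hur : MemLp u (ENNReal.ofReal (critExp n)) (volume.restrict Ω) :=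
      ⟨hw.1.1.restrict, (hle _ _ _ hw).trans_lt (ENNReal.mul_lt_top hC.lt_top
        (ENNReal.add_lt_top.2 ⟨(hw.1.restrict Ω).2, (hw.2.1.restrict Ω).2⟩))⟩
    have hgr : ∀ t, 1 ≤ t → 0 ≤ lam * t ^ (-q) + t ^ p ∧
        lam * t ^ (-q) + t ^ p ≤ (lam + 1) * t ^ (critExp n - 1) := by
      intro t ht
      obtain ⟨h1, h2⟩ := hpow hq t ht
      have h3 : t ^ p ≤ t ^ (critExp n - 1) := Real.rpow_le_rpow_of_exponent_le ht hpr
      have h4 : 1 ≤ t ^ (critExp n - 1) :=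
        Real.one_le_rpow ht (by linarith [two_lt_critExp hn])
      have h5 : 0 ≤ t ^ p := Real.rpow_nonneg (by linarith) _
      have h6 : lam * t ^ (-q) ≤ lam * t ^ (critExp n - 1) :=
        mul_le_mul_of_nonneg_left (h2.trans h4) hlam.le
      exact ⟨by positivity, by linarith⟩
    obtain ⟨M, hM⟩ := hΩ.exists_bound_of_critical hn hs0 (by fun_prop) (by linarith) hgr hur htr
    exact memLinfty_of_ae_norm_le hw.1.1 (htr.ae_abs_le hn0 hΩ hpos hM)
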